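/- Let $d=(d_1,\dots,d_n)$, $n\ge 1$, be a non-increasing sequence of positive integers, and let $0\le\gamma\le n$ be an integer. A realization of $d$ is a simple graph $G$ on the vertex set $\{1,\dots,n\}$ with $\deg_G(i)=d_i$ for every $i$, and $d$ is graphic if it has a realization. A dominating set of $G$ is a set $D$ of vertices such that every vertex outside $D$ has a neighbour in $D$. Let $\mathrm{MDS}(d)$ denote, for graphic $d$, the minimum size of a dominating set, taken over all dominating sets of all realizations of $d$. All sums below run over indices in $[1,n]$ (so an upper limit larger than $n$ is read as $n$). (a) The sequence $d$ has a realization with a dominating set of size $\gamma$ if and only if $\sum_{i=1}^n d_i$ is even and the following three systems of inequalities hold: $$\sum_{i=\gamma+1}^{\gamma+k}(d_i-1)\;\le\; k(k-1)-(n-\gamma)+\sum_{i=1}^{\gamma}d_i+\sum_{i=\gamma+k+1}^{n}\min\{k,d_i-1\}\qquad\text{for every integer } k\in[0,n-\gamma],$$ $$\sum_{i=1}^{k}d_i\;\le\; k(k-1)+\sum_{i=k+1}^{n}\min\{k,d_i\}\qquad\text{for every integer } k\in[0,n],$$ $$\sum_{i=\gamma+1}^{\gamma+k}d_i\;\le\;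 k(k-1)+\sum_{i=1}^{\gamma}\min\{k,d_i\}+\sum_{i=\gamma+k+1}^{n}\min\{k,d_i-1\}\qquad\text{for every integer } k\in[0,d_1].$$ (b) $\mathrm{MDS}(d)$ can be computed in $O(n\log n)$ time: there is a fixed program for a unit-cost random access machine with words of $O(\log n)$ bits (with addition, subtraction, multiplication, halving, comparison, and indirect loads and stores as basic steps) that, given $n$ and any graphic non-increasing sequence $d$ of $n$ positive integers in its memory, halts after $O(n\log n)$ steps with output $\mathrm{MDS}(d)$. -/

import Mathlib

/-! ### Degree realizations and dominating sets -/

/-- `G` realizes `d`: vertex `i` has degree `d i`. -/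
def Realizes {n : ℕ} (G : SimpleGraph (Fin n)) (d : Fin n → ℕ) : Prop :=
  ∀ i, (G.neighborSet i).ncard = d i

/-- The sequence `d` is graphic: it is the degree sequence of some simple graph. -/
def IsGraphic {n : ℕ} (d : Fin n → ℕ) : Prop :=
  ∃ G : SimpleGraph (Fin n), Realizes G d

/-- `D` is a dominating set of `G`: each vertex outside `D` has a neighbour in `D`. -/
def IsDominatingSet {V : Type*} (G : SimpleGraph V) (D : Finset V) : Prop :=
  ∀ v, v ∉ D → ∃ u ∈ D, G.Adj u v

/-- `MDS(G)`, the minimum size of a dominating set of the graph `G`. -/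
noncomputable def graphMDS {n : ℕ} (G : SimpleGraph (Fin n)) : ℕ :=
  sInf {γ | ∃ D : Finset (Fin n), IsDominatingSet G D ∧ D.card = γ}

/-- `MDS(d)`, the minimum of `MDS(G)` over all realizations `G` of `d`
(used for graphic `d` only). -/
noncomputable def seqMDS {n : ℕ} (d : Fin n → ℕ) : ℕ :=
  sInf {γ | ∃ G : SimpleGraph (Fin n), Realizes G d ∧ graphMDS G = γ}

/-! ### A random access machine with bounded words and unit-cost steps -/

/-- The state of the machine: integer registers, and a random access memory. A program mentions
only finitely many registers. -/
structure RAMState where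
  reg : ℕ → ℤ
  mem : ℤ → ℤ

/-- The basic instructions; the first argument of all but `store` is the target register. -/
inductive RAMInstr where
  | const (r : ℕ) (c : ℤ)
  | add (r a b : ℕ)
  | sub (r a b : ℕ)
  | mul (r a b : ℕ)
  | half (r a : ℕ)
  | load (r a : ℕ)
  | store (a b : ℕ)

/-- The value that an instruction writes. -/
def RAMInstr.value (s : RAMState) : RAMInstr → ℤ
  | const _ c => c
  | add _ a b => s.reg a + s.reg b
  | sub _ a b => s.reg a - s.reg b
  | mul _ a b => s.reg a * s.reg b
  | half _ a => s.reg a / 2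
  | load _ a => s.mem (s.reg a)
  | store _ b => s.reg b

/-- The state after writing that value to the target: to the memory cell whose address is in
register `a` for `store a b`, and to register `r` otherwise. -/
def RAMInstr.exec (i : RAMInstr) (s : RAMState) : RAMState :=
  match i with
  | const r _ | add r _ _ | sub r _ _ | mul r _ _ | half r _ | load r _ =>
    { s with reg := Function.update s.reg r (i.value s) }
  | store a _ => { s with mem := Function.update s.mem (s.reg a) (i.value s) }

/-- Programs. The test of `ite a b` and of `while a b` is whether register `a` holds a value at
most that of register `b`. -/
inductive RAMProg where
  | skip
  | instr (i : RAMInstr)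
  | seq (p q : RAMProg)
  | ite (a b : ℕ) (p q : RAMProg)
  | while (a b : ℕ) (p : RAMProg)

/-- `RAMRun W p s t s'`: program `p`, started in state `s`, halts in state `s'` after exactly `t`
steps, and each value that it writes has absolute value at most `W`. Each basic instruction and
each evaluation of a test is one step. -/
inductive RAMRun (W : ℤ) : RAMProg → RAMState → ℕ → RAMState → Prop where
  | skip (s : RAMState) : RAMRun W .skip s 1 s
  | instr (i : RAMInstr) (s : RAMState) (h : |i.value s| ≤ W) : RAMRun W (.instr i) s 1 (i.exec s)
  | seq {p q : RAMProg} {s s' s'' : RAMState} {t t' : ℕ}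
      (h : RAMRun W p s t s') (h' : RAMRun W q s' t' s'') : RAMRun W (.seq p q) s (t + t') s''
  | ite_true {a b : ℕ} {p q : RAMProg} {s s' : RAMState} {t : ℕ}
      (hab : s.reg a ≤ s.reg b) (h : RAMRun W p s t s') : RAMRun W (.ite a b p q) s (t + 1) s'
  | ite_false {a b : ℕ} {p q : RAMProg} {s s' : RAMState} {t : ℕ}
      (hab : ¬ s.reg a ≤ s.reg b) (h : RAMRun W q s t s') : RAMRun W (.ite a b p q) s (t + 1) s'
  | while_true {a b : ℕ} {p : RAMProg} {s s' s'' : RAMState} {t t' : ℕ}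
      (hab : s.reg a ≤ s.reg b) (h : RAMRun W p s t s')
      (h' : RAMRun W (.while a b p) s' t' s'') : RAMRun W (.while a b p) s (t + t' + 1) s''
  | while_false {a b : ℕ} {p : RAMProg} {s : RAMState}
      (hab : ¬ s.reg a ≤ s.reg b) : RAMRun W (.while a b p) s 1 s

/-- The initial state on input `d = (d₁, …, dₙ)`: register `0` holds `n`, the memory cells
`0, …, n - 1` hold `d₁, …, dₙ`, and everything else is `0`. -/
def RAMState.input {n : ℕ} (d : Fin n → ℕ) : RAMState where
  reg r := if r = 0 then n else 0
  mem a := if h : 0 ≤ a ∧ a.toNat < n then d ⟨a.toNat, h.2⟩ else 0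

set_option linter.unusedSectionVars false

/-! Necessity in (a). An exchange that keeps all degrees replaces a dominating vertex by a vertex of
maximum degree outside the dominating set (`exists_dominating_swap`), so the first `γ` vertices may
be assumed to dominate (`HasDom.exists_low`). The inequalities are then double counts of the edges
at a block of `k` vertices, in which every vertex outside the first `γ` spends an edge on its
dominator.

Sufficiency in (a). The Erdős–Gallai system gives some realization `G`. If a degree reaches `n - γ`,
then `G` already has a suitable dominating set. Otherwise the other two systems yield a graph `H`
dominated by the first `γ` vertices, with degrees at most `d` and equal to `d` outside these
vertices: a star forest is saturated one vertex at a time, and a stage that is stuck is so rigid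
that counting its edges violates one of the inequalities (`MS.false_of_le`). The same process with
nothing to dominate proves Erdős–Gallai.

It remains to merge `G` and `H` (`exists_real_of_valid`). Among all such pairs take one that
minimizes the total deficiency of `H`, then the distance of the graphs, then the number of deficient
vertices. Call an edge red if it lies in `G` only and blue if it lies in `H` only. Let `r` be
deficient. Alternating walks from `r` must close up, and counting red and blue edges
(`MinPair.exists_wit`) shows that every red edge `rz` leads to a configuration in which `zp`, `zq`
are blue, `pq` is red, and `p`, `q` have `r` as their only neighbour in `D`. A deficiency of two, or
parity, supplies a second configuration, and the two combine to remove two units of deficiency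
(`MinPair.false_of_two_wits`).

For (b), `d` is graphic, so only two systems need testing (`hasDom_iff_of_isGraphic`), and their
joint validity is monotone in `γ`. Prefix sums and the numbers of entries that are at least `k` make
each test a constant number of operations (`sys_iff`). One `γ` thus costs linear time, and binary
search adds the logarithm. -/

namespace DegreeDomination

/-! ### Adjacency counts and changes of a single edge -/

section Counting

variable {V : Type*}

open Classical in
/-- The number of neighbours of `v` in `T`, as an integer. -/
noncomputable def cnt (G : SimpleGraph V) (T : Finset V) (v : V) : ℤ :=
  ∑ y ∈ T, if G.Adj v y then 1 else 0

/-- The graph `G` with the edge `ab` added. -/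
def addE (G : SimpleGraph V) (a b : V) : SimpleGraph V where
  Adj x y := G.Adj x y ∨ (x ≠ y ∧ ((x = a ∧ y = b) ∨ (x = b ∧ y = a)))
  symm := ⟨by
    intro x y h
    rcases h with h | ⟨h, h'⟩
    · exact Or.inl h.symm
    · exact Or.inr ⟨h.symm, by tauto⟩⟩
  loopless := ⟨by intro x h; simp at h⟩

/-- The graph `G` with the edge `ab` removed. -/
def delE (G : SimpleGraph V) (a b : V) : SimpleGraph V where
  Adj x y := G.Adj x y ∧ ¬ ((x = a ∧ y = b) ∨ (x = b ∧ y = a))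
  symm := ⟨by
    intro x y h
    exact ⟨h.1.symm, by have := h.2; tauto⟩⟩
  loopless := ⟨by intro x h; simp at h⟩

theorem addE_adj {G : SimpleGraph V} {a b x y : V} : (addE G a b).Adj x y ↔
    G.Adj x y ∨ (x ≠ y ∧ ((x = a ∧ y = b) ∨ (x = b ∧ y = a))) := Iff.rfl

theorem delE_adj {G : SimpleGraph V} {a b x y : V} : (delE G a b).Adj x y ↔
    G.Adj x y ∧ ¬ ((x = a ∧ y = b) ∨ (x = b ∧ y = a)) := Iff.rfl

theorem cnt_eq_card (G : SimpleGraph V) (T : Finset V) (v : V) [DecidablePred (G.Adj v)] :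
    cnt G T v = ((T.filter (G.Adj v)).card : ℤ) := by
  rw [Finset.card_filter]
  push_cast
  unfold cnt
  exact Finset.sum_congr rfl fun _ _ => by congr

theorem cnt_nonneg (G : SimpleGraph V) (T : Finset V) (v : V) : 0 ≤ cnt G T v :=
  Finset.sum_nonneg fun _ _ => by split_ifs <;> simp

theorem cnt_le_card (G : SimpleGraph V) (T : Finset V) (v : V) : cnt G T v ≤ T.card := by
  classical
  rw [cnt_eq_card]
  exact_mod_cast Finset.card_filter_le _ _

theorem cnt_mono {G H : SimpleGraph V} {T : Finset V} {v : V}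
    (h : ∀ y ∈ T, G.Adj v y → H.Adj v y) : cnt G T v ≤ cnt H T v := by
  refine Finset.sum_le_sum fun y hy => ?_
  have := h y hy
  split_ifs <;> simp_all

theorem cnt_congr {G H : SimpleGraph V} {T : Finset V} {v : V}
    (h : ∀ y ∈ T, G.Adj v y ↔ H.Adj v y) : cnt G T v = cnt H T v :=
  le_antisymm (cnt_mono fun y hy => (h y hy).1) (cnt_mono fun y hy => (h y hy).2)

theorem cnt_le_of_subset (G : SimpleGraph V) {S T : Finset V} (h : S ⊆ T) (v : V) :
    cnt G S v ≤ cnt G T v :=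
  Finset.sum_le_sum_of_subset_of_nonneg h fun _ _ _ => by split_ifs <;> simp

theorem cnt_le_of_forall {G : SimpleGraph V} {S T : Finset V} {v : V}
    (h : ∀ y ∈ S, G.Adj v y → y ∈ T) : cnt G S v ≤ cnt G T v := by
  classical
  rw [cnt_eq_card, cnt_eq_card]
  refine mod_cast Finset.card_le_card fun y hy => ?_
  rw [Finset.mem_filter] at hy ⊢
  exact ⟨h y hy.1 hy.2, hy.2⟩

theorem cnt_union [DecidableEq V] (G : SimpleGraph V) {S T : Finset V} (h : Disjoint S T) (v : V) :
    cnt G (S ∪ T) v = cnt G S v + cnt G T v :=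
  Finset.sum_union h

theorem cnt_pos {G : SimpleGraph V} {T : Finset V} {v : V} :
    0 < cnt G T v ↔ ∃ y ∈ T, G.Adj v y := by
  classical
  rw [cnt_eq_card]
  simp [Finset.card_pos, Finset.Nonempty]

theorem cnt_eq_zero {G : SimpleGraph V} {T : Finset V} {v : V}
    (h : ∀ y ∈ T, ¬ G.Adj v y) : cnt G T v = 0 :=
  Finset.sum_eq_zero fun y hy => if_neg (h y hy)

theorem exists_ne_of_one_lt_cnt {G : SimpleGraph V} {T : Finset V} {v : V}
    (h : 1 < cnt G T v) (a : V) : ∃ y ∈ T, G.Adj v y ∧ y ≠ a := by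
  classical
  rw [cnt_eq_card] at h
  obtain ⟨y, hy, hya⟩ := Finset.exists_mem_ne (by exact_mod_cast h) a
  rw [Finset.mem_filter] at hy
  exact ⟨y, hy.1, hy.2, hya⟩

theorem eq_of_cnt_le_one {G : SimpleGraph V} {T : Finset V} {v a b : V}
    (h : cnt G T v ≤ 1) (ha : a ∈ T) (hb : b ∈ T) (hva : G.Adj v a) (hvb : G.Adj v b) : a = b := by
  classical
  rw [cnt_eq_card] at h
  exact Finset.card_le_one.1 (by exact_mod_cast h) a (by simp [ha, hva]) b (by simp [hb, hvb])

theorem exists_not_adj_of_cnt_lt_card {G : SimpleGraph V} {T : Finset V} {v : V}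
    (h : cnt G T v < T.card) : ∃ y ∈ T, ¬ G.Adj v y := by
  by_contra! hc
  have : cnt G T v = T.card := by
    unfold cnt
    rw [Finset.sum_congr rfl fun y hy => if_pos (hc y hy)]
    simp
  omega

/-- A vertex with more neighbours in `T` has a neighbour in `T` which the other vertex lacks. -/
theorem exists_adj_not_adj [DecidableEq V] {G : SimpleGraph V} {T : Finset V} {r i : V}
    (hi : r ∈ T → i ∈ T) (h : cnt G T r < cnt G T i) :
    ∃ u ∈ T, G.Adj i u ∧ u ≠ r ∧ ¬ G.Adj r u := by
  classical
  by_contra! hc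
  rw [cnt_eq_card, cnt_eq_card] at h
  have h1 : (T.filter (G.Adj i)).card ≤ (T.filter (G.Adj r)).card := by
    -- The only neighbour of `i` that `r` cannot share is `r` itself. It is sent to `i`, which is
    -- not a neighbour of `i`, so the map stays injective.
    refine Finset.card_le_card_of_injOn (fun y => if y = r then i else y) ?_ ?_
    · intro y hy
      simp only [Finset.coe_filter, Set.mem_ofPred_eq] at hy ⊢
      by_cases hyr : y = r
      · subst hyr
        simp only [if_true]
        exact ⟨hi hy.1, hy.2.symm⟩
      · simp only [hyr, if_false]
        exact ⟨hy.1, hc y hy.1 hy.2 hyr⟩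
    · intro x hx y hy hxy
      simp only [Finset.coe_filter, Set.mem_ofPred_eq] at hx hy
      have hxi := hx.2.ne
      have hyi := hy.2.ne
      simp only at hxy
      split_ifs at hxy <;> simp_all
  omega

theorem sum_cnt_comm (G : SimpleGraph V) (S T : Finset V) :
    ∑ v ∈ S, cnt G T v = ∑ v ∈ T, cnt G S v := by
  unfold cnt
  rw [Finset.sum_comm]
  exact Finset.sum_congr rfl fun x _ => Finset.sum_congr rfl fun y _ => by rw [G.adj_comm]

theorem even_sum_cnt [Fintype V] (G : SimpleGraph V) : Even (∑ v, cnt G Finset.univ v) := by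
  classical
  have h := G.sum_degrees_eq_twice_card_edges
  have h2 : ∑ v, cnt G Finset.univ v = ((∑ v, G.degree v : ℕ) : ℤ) := by
    push_cast
    refine Finset.sum_congr rfl fun v _ => ?_
    rw [cnt_eq_card, ← G.card_neighborFinset_eq_degree]
    congr 2
    ext y
    simp
  rw [h2, h]
  push_cast
  exact even_two_mul _

theorem cnt_addE [DecidableEq V] {G : SimpleGraph V} {a b : V} (hab : a ≠ b) (h : ¬ G.Adj a b)
    (T : Finset V) (v : V) : cnt (addE G a b) T v = cnt G T v +
      (if v = a ∧ b ∈ T then 1 else 0) + (if v = b ∧ a ∈ T then 1 else 0) := by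
  classical
  have h1 : (if v = a ∧ b ∈ T then (1 : ℤ) else 0) =
      ∑ y ∈ T, if y = b then (if v = a then 1 else 0) else 0 := by
    rw [Finset.sum_ite_eq' T b]; split_ifs <;> simp_all
  have h2 : (if v = b ∧ a ∈ T then (1 : ℤ) else 0) =
      ∑ y ∈ T, if y = a then (if v = b then 1 else 0) else 0 := by
    rw [Finset.sum_ite_eq' T a]; split_ifs <;> simp_all
  rw [h1, h2]
  unfold cnt
  rw [← Finset.sum_add_distrib, ← Finset.sum_add_distrib]
  refine Finset.sum_congr rfl fun y _ => ?_
  have h' : ¬ G.Adj b a := fun h0 => h h0.symm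
  simp only [addE_adj]
  by_cases e1 : v = a
  · by_cases e2 : y = b
    · subst e1 e2; simp [h, hab]
    · subst e1; simp [e2, hab]
  · by_cases e2 : v = b
    · by_cases e3 : y = a
      · subst e2 e3; simp [h', e1]
      · subst e2; simp [e1, e3]
    · simp [e1, e2]

/-- Deletion undoes addition: this is `cnt_addE` for the graph without the edge, solved for the
other side. -/
theorem cnt_delE [DecidableEq V] {G : SimpleGraph V} {a b : V} (h : G.Adj a b)
    (T : Finset V) (v : V) : cnt (delE G a b) T v = cnt G T v -
      (if v = a ∧ b ∈ T then 1 else 0) - (if v = b ∧ a ∈ T then 1 else 0) := by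
  have h1 : addE (delE G a b) a b = G := by
    ext x y
    rw [addE_adj, delE_adj]
    have := h.symm
    grind [h.ne]
  have h2 : ¬ (delE G a b).Adj a b := by simp [delE_adj]
  have h3 := cnt_addE h.ne h2 T v
  rw [h1] at h3
  linarith

end Counting

/-! ### Symmetric difference of two graphs -/

section Distance

variable {V : Type*} [Fintype V]

open Classical in
/-- The number of ordered pairs which are adjacent in exactly one of two graphs. -/
noncomputable def dist (G H : SimpleGraph V) : ℤ :=
  ∑ x, ∑ y, if (G.Adj x y ↔ H.Adj x y) then 0 else 1

theorem dist_nonneg (G H : SimpleGraph V) : 0 ≤ dist G H :=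
  Finset.sum_nonneg fun _ _ => Finset.sum_nonneg fun _ _ => by split_ifs <;> simp

theorem dist_comm (G H : SimpleGraph V) : dist G H = dist H G := by
  unfold dist
  exact Finset.sum_congr rfl fun x _ => Finset.sum_congr rfl fun y _ => by
    by_cases h1 : G.Adj x y <;> by_cases h2 : H.Adj x y <;> simp [h1, h2]

/-- An edge is two ordered pairs, which is why `dist` moves in steps of two. -/
theorem sum_pair [DecidableEq V] {a b : V} (hab : a ≠ b) : ∑ x : V, ∑ y : V,
    (if (x = a ∧ y = b) ∨ (x = b ∧ y = a) then (1 : ℤ) else 0) = 2 := by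
  have : ∀ x y : V, (if (x = a ∧ y = b) ∨ (x = b ∧ y = a) then (1 : ℤ) else 0) =
      (if x = a then (if y = b then 1 else 0) else 0) +
      (if x = b then (if y = a then 1 else 0) else 0) := by
    intro x y
    by_cases h1 : x = a <;> by_cases h2 : x = b <;> simp_all
  rw [Finset.sum_congr rfl fun x _ => Finset.sum_congr rfl fun y _ => this x y]
  simp [Finset.sum_add_distrib]

theorem dist_addE [DecidableEq V] {G H : SimpleGraph V} {a b : V} (hab : a ≠ b)
    (h : ¬ H.Adj a b) : (G.Adj a b → dist G (addE H a b) = dist G H - 2) ∧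
      (¬ G.Adj a b → dist G (addE H a b) = dist G H + 2) := by
  classical
  have h' : ¬ H.Adj b a := fun h0 => h h0.symm
  constructor
  · intro hG
    have hG' := hG.symm
    rw [← sum_pair hab]
    unfold dist
    rw [← Finset.sum_sub_distrib]
    refine Finset.sum_congr rfl fun x _ => ?_
    rw [← Finset.sum_sub_distrib]
    refine Finset.sum_congr rfl fun y _ => ?_
    by_cases hp : (x = a ∧ y = b) ∨ (x = b ∧ y = a)
    · rcases hp with ⟨rfl, rfl⟩ | ⟨rfl, rfl⟩
      · simp [addE_adj, h, hG, hab]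
      · simp [addE_adj, h', hG', hab.symm]
    · simp [addE_adj, hp]
  · intro hG
    have hG' : ¬ G.Adj b a := fun h0 => hG h0.symm
    rw [← sum_pair hab]
    unfold dist
    rw [← Finset.sum_add_distrib]
    refine Finset.sum_congr rfl fun x _ => ?_
    rw [← Finset.sum_add_distrib]
    refine Finset.sum_congr rfl fun y _ => ?_
    by_cases hp : (x = a ∧ y = b) ∨ (x = b ∧ y = a)
    · rcases hp with ⟨rfl, rfl⟩ | ⟨rfl, rfl⟩
      · simp [addE_adj, h, hG, hab]
      · simp [addE_adj, h', hG', hab.symm]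
    · simp [addE_adj, hp]

theorem dist_delE [DecidableEq V] {G H : SimpleGraph V} {a b : V}
    (h : H.Adj a b) : (G.Adj a b → dist G (delE H a b) = dist G H + 2) ∧
      (¬ G.Adj a b → dist G (delE H a b) = dist G H - 2) := by
  have h1 : addE (delE H a b) a b = H := by
    ext x y
    rw [addE_adj, delE_adj]
    have := h.symm
    grind [h.ne]
  have h2 : ¬ (delE H a b).Adj a b := by simp [delE_adj]
  have h3 := dist_addE (G := G) h.ne h2
  rw [h1] at h3
  constructor
  · intro hG
    have := h3.1 hG
    linarith
  · intro hG
    have := h3.2 hG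
    linarith

end Distance

/-! ### Minimal pairs of a realization and a valid graph -/

section Merge

variable {V : Type*} [Fintype V] [DecidableEq V]

theorem dist_addE' {G H : SimpleGraph V} {a b : V} (hab : a ≠ b) (h : ¬ H.Adj a b) :
    dist G (addE H a b) ≤ dist G H + 2 := by
  by_cases hG : G.Adj a b
  · rw [(dist_addE hab h).1 hG]; linarith
  · rw [(dist_addE hab h).2 hG]

theorem dist_delE' {G H : SimpleGraph V} {a b : V} (h : H.Adj a b) :
    dist G (delE H a b) ≤ dist G H + 2 := by
  by_cases hG : G.Adj a b
  · rw [(dist_delE h).1 hG]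
  · rw [(dist_delE h).2 hG]; linarith

/-- The graphs with degrees at most `d`, equal to `d` outside `D`, in which each vertex outside
`D` has a neighbour in `D`. -/
structure Valid (d : V → ℤ) (D : Finset V) (H : SimpleGraph V) : Prop where
  le : ∀ v, cnt H Finset.univ v ≤ d v
  eq : ∀ v, v ∉ D → cnt H Finset.univ v = d v
  dom : ∀ v, v ∉ D → ∃ a ∈ D, H.Adj v a

/-- The total deficiency. -/
noncomputable def defic (d : V → ℤ) (H : SimpleGraph V) : ℤ := ∑ v, (d v - cnt H Finset.univ v)

open Classical in
/-- The number of deficient vertices. -/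
noncomputable def numDef (d : V → ℤ) (H : SimpleGraph V) : ℕ :=
  (Finset.univ.filter fun v => cnt H Finset.univ v < d v).card

/-- A realization of `d` and a valid graph which minimize deficiency, distance and number of
deficient vertices, in this order. -/
structure MinPair (d : V → ℤ) (D : Finset V) (G H : SimpleGraph V) : Prop where
  real : ∀ v, cnt G Finset.univ v = d v
  valid : Valid d D H
  min_defic : ∀ H', Valid d D H' → defic d H ≤ defic d H'
  min_dist : ∀ G' H', (∀ v, cnt G' Finset.univ v = d v) → Valid d D H' → defic d H' = defic d H →
    dist G H ≤ dist G' H'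
  min_num : ∀ G' H', (∀ v, cnt G' Finset.univ v = d v) → Valid d D H' → defic d H' = defic d H →
    dist G' H' ≤ dist G H → numDef d H ≤ numDef d H'

theorem Valid.defic_nonneg {d : V → ℤ} {D : Finset V} {H : SimpleGraph V} (h : Valid d D H) :
    0 ≤ defic d H :=
  Finset.sum_nonneg fun v _ => by linarith [h.le v]

/-- Deficiency and distance are nonnegative, so the three quantities can be read as naturals, whose
lexicographic order is well-founded. -/
theorem exists_minPair {d : V → ℤ} {D : Finset V} {G H : SimpleGraph V}
    (hG : ∀ v, cnt G Finset.univ v = d v) (hH : Valid d D H) :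
    ∃ G' H', MinPair d D G' H' := by
  classical
  let f : SimpleGraph V × SimpleGraph V → ℕ ×ₗ (ℕ ×ₗ ℕ) := fun p =>
    toLex ((defic d p.2).toNat, toLex ((dist p.1 p.2).toNat, numDef d p.2))
  let S : Set (SimpleGraph V × SimpleGraph V) :=
    {p | (∀ v, cnt p.1 Finset.univ v = d v) ∧ Valid d D p.2}
  have hS : S.Nonempty := ⟨(G, H), hG, hH⟩
  obtain ⟨⟨G', H'⟩, hm, hmin⟩ := (InvImage.wf f wellFounded_lt).has_min S hS
  refine ⟨G', H', hm.1, hm.2, ?_, ?_, ?_⟩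
  · intro K hK
    have := hmin (G', K) ⟨hm.1, hK⟩
    by_contra! hc
    apply this
    change f _ < f _
    simp only [f, Prod.Lex.toLex_lt_toLex]
    left
    have := hK.defic_nonneg
    omega
  · intro G'' K h1 hK h2
    have := hmin (G'', K) ⟨h1, hK⟩
    by_contra! hc
    apply this
    change f _ < f _
    simp only [f, Prod.Lex.toLex_lt_toLex]
    right
    refine ⟨by rw [h2], Or.inl ?_⟩
    have := dist_nonneg G'' K
    omega
  · intro G'' K h1 hK h2 h3
    have := hmin (G'', K) ⟨h1, hK⟩
    by_contra! hc
    apply this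
    change f _ < f _
    simp only [f, Prod.Lex.toLex_lt_toLex]
    right
    refine ⟨by rw [h2], ?_⟩
    rcases h3.lt_or_eq with h4 | h4
    · left
      have := dist_nonneg G'' K
      omega
    · right
      exact ⟨by rw [h4], hc⟩

variable {d : V → ℤ} {D : Finset V} {G H : SimpleGraph V}

theorem MinPair.mem_of_lt (M : MinPair d D G H) {r : V} (hr : cnt H Finset.univ r < d r) :
    r ∈ D := by
  by_contra h
  linarith [M.valid.eq r h]

/-- No other realization of `d` is closer. -/
theorem MinPair.dist_le_left (M : MinPair d D G H) {G' : SimpleGraph V}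
    (h : ∀ v, cnt G' Finset.univ v = cnt G Finset.univ v) : dist G H ≤ dist G' H :=
  M.min_dist G' H (fun v => (h v).trans (M.real v)) M.valid rfl

/-- No other valid graph with the same degrees is closer. -/
theorem MinPair.dist_le_right (M : MinPair d D G H) {H' : SimpleGraph V}
    (h : ∀ v, cnt H' Finset.univ v = cnt H Finset.univ v)
    (hd : ∀ v, v ∉ D → ∃ a ∈ D, H'.Adj v a) : dist G H ≤ dist G H' := by
  refine M.min_dist G H' M.real ⟨fun v => ?_, fun v hv => ?_, hd⟩ ?_
  · rw [h]; exact M.valid.le v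
  · rw [h]; exact M.valid.eq v hv
  · unfold defic
    simp_rw [h]

/-- Two units of deficiency cannot be removed. -/
theorem MinPair.false_of_add_two (M : MinPair d D G H) {H' : SimpleGraph V} {r r' : V}
    (h : ∀ v, cnt H' Finset.univ v = cnt H Finset.univ v + (if v = r then 1 else 0) +
      (if v = r' then 1 else 0))
    (hr : cnt H Finset.univ r + 1 ≤ d r) (hr' : cnt H Finset.univ r' + 1 ≤ d r')
    (hrr : r = r' → cnt H Finset.univ r + 2 ≤ d r)
    (hd : ∀ v, v ∉ D → ∃ a ∈ D, H'.Adj v a) : False := by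
  have h1 := M.min_defic H' ⟨fun v => ?_, fun v hv => ?_, hd⟩
  · have h2 : defic d H' = defic d H - 1 - 1 := by
      have h3 : (1 : ℤ) = ∑ v, if v = r then 1 else 0 := by simp
      have h4 : (1 : ℤ) = ∑ v, if v = r' then 1 else 0 := by simp
      have h5 : defic d H' = defic d H - (∑ v, if v = r then 1 else 0) -
          (∑ v, if v = r' then 1 else 0) := by
        unfold defic
        rw [← Finset.sum_sub_distrib, ← Finset.sum_sub_distrib]
        exact Finset.sum_congr rfl fun v _ => by rw [h]; ring
      rw [h5, ← h3, ← h4]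
    linarith
  · rw [h]
    have := M.valid.le v
    split_ifs with h1 h2 h2
    · subst h1; linarith [hrr h2]
    · subst h1; linarith
    · subst h2; linarith
    · linarith
  · rw [h]
    have h1 := M.valid.eq v hv
    have h2 : v ≠ r := by rintro rfl; exact hv (M.mem_of_lt (by omega))
    have h3 : v ≠ r' := by rintro rfl; exact hv (M.mem_of_lt (by omega))
    simp [h1, h2, h3]

/-- Deficient vertices are adjacent. -/
theorem MinPair.adj_of_lt (M : MinPair d D G H) {r r' : V} (hr : cnt H Finset.univ r < d r)
    (hr' : cnt H Finset.univ r' < d r') (hne : r ≠ r') : H.Adj r r' := by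
  by_contra h
  refine M.false_of_add_two (H' := addE H r r') (r := r) (r' := r') (fun v => ?_) (by omega)
    (by omega) (fun h => absurd h hne) ?_
  · rw [cnt_addE hne h]; simp
  · intro v hv
    obtain ⟨a, ha, hva⟩ := M.valid.dom v hv
    exact ⟨a, ha, Or.inl hva⟩

/-- The degree of a deficient vertex cannot be raised by two while coming closer. -/
theorem MinPair.dist_lt_of_add_two (M : MinPair d D G H) {H' : SimpleGraph V} {r : V}
    (hr : cnt H Finset.univ r < d r)
    (h : ∀ v, cnt H' Finset.univ v = cnt H Finset.univ v + (if v = r then 2 else 0))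
    (hd : ∀ v, v ∉ D → ∃ a ∈ D, H'.Adj v a) (hadj : ∀ x, H.Adj r x → H'.Adj r x) :
    dist G H < dist G H' + 2 := by
  by_contra! hc
  -- With two units missing at `r`, the graph `H'` is itself valid and less deficient. Otherwise
  -- exactly one unit is missing and `H'` overshoots at `r`.
  by_cases h2 : cnt H Finset.univ r + 2 ≤ d r
  · refine M.false_of_add_two (H' := H') (r := r) (r' := r) (fun v => ?_) (by omega) (by omega)
      (fun _ => h2) hd
    rw [h]
    split_ifs <;> ring
  -- The total deficiency is a difference of two even degree sums, so it cannot be a single unit.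
  obtain ⟨r', hne, hr'⟩ : ∃ r', r' ≠ r ∧ cnt H Finset.univ r' < d r' := by
    by_contra! hall
    have h3 : ∑ v, cnt G Finset.univ v - ∑ v, cnt H Finset.univ v = 1 := by
      rw [← Finset.sum_sub_distrib, Finset.sum_eq_single r]
      · rw [M.real]; omega
      · intro b _ hb
        rw [M.real]
        linarith [hall b hb, M.valid.le b]
      · simp
    have h4 := (even_sum_cnt G).sub (even_sum_cnt H)
    rw [h3] at h4
    exact absurd h4 (by decide)
  have hrD := M.mem_of_lt hr
  have hrD' := M.mem_of_lt hr'
  have hrr := M.adj_of_lt hr hr' hne.symm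
  have hrr' := hadj r' hrr
  -- Deleting `rr'` repairs the overshoot and moves the missing unit of `r` to `r'`, which was
  -- deficient before. Deficiency is unchanged and the distance is no larger than before, but there
  -- is one deficient vertex fewer.
  have hcnt : ∀ v, cnt (delE H' r r') Finset.univ v = cnt H Finset.univ v +
      (if v = r then 1 else 0) - (if v = r' then 1 else 0) := by
    intro v
    rw [cnt_delE hrr', h]
    by_cases e1 : v = r
    · subst e1; simp [hne.symm]; ring
    · simp [e1]
  have hval : Valid d D (delE H' r r') := by
    refine ⟨fun v => ?_, fun v hv => ?_, fun v hv => ?_⟩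
    · rw [hcnt]
      have := M.valid.le v
      split_ifs with e1 e2 e2
      · subst e1; omega
      · subst e1; omega
      · omega
      · omega
    · rw [hcnt, if_neg, if_neg, M.valid.eq v hv]
      · ring
      · rintro rfl; exact hv hrD'
      · rintro rfl; exact hv hrD
    · obtain ⟨a, ha, hva⟩ := hd v hv
      exact ⟨a, ha, hva, by grind⟩
  have hdef : defic d (delE H' r r') = defic d H := by
    have h3 : (1 : ℤ) = ∑ v, if v = r then 1 else 0 := by simp
    have h4 : (1 : ℤ) = ∑ v, if v = r' then 1 else 0 := by simp
    have h5 : defic d (delE H' r r') = defic d H - (∑ v, if v = r then 1 else 0) +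
        (∑ v, if v = r' then 1 else 0) := by
      unfold defic
      rw [← Finset.sum_sub_distrib, ← Finset.sum_add_distrib]
      exact Finset.sum_congr rfl fun v _ => by rw [hcnt]; ring
    rw [h5, ← h3, ← h4]; ring
  have hnum := M.min_num G (delE H' r r') M.real hval hdef
    (by have := dist_delE' (G := G) hrr'; linarith)
  have hlt : numDef d (delE H' r r') < numDef d H := by
    classical
    apply Finset.card_lt_card
    rw [Finset.ssubset_iff_of_subset]
    · refine ⟨r, by simpa using hr, ?_⟩
      simp only [Finset.mem_filter, Finset.mem_univ, true_and, hcnt]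
      simp [hne.symm]
      omega
    · intro v
      simp only [Finset.mem_filter, Finset.mem_univ, true_and, hcnt]
      intro hv
      by_cases e : v = r'
      · rw [e]; exact hr'
      · simp only [e, if_false] at hv
        split_ifs at hv <;> omega
  omega

end Merge

/-! ### Alternating paths and four-cycles -/

section Flips

variable {V : Type*} [Fintype V] [DecidableEq V]

/-- Add `ab`, remove `bc`, add `ce`. -/
def path3 (H : SimpleGraph V) (a b c e : V) : SimpleGraph V := addE (delE (addE H a b) b c) c e

/-- Add `ab`, remove `bc`, add `ce`, remove `ea`. -/
def flip4 (H : SimpleGraph V) (a b c e : V) : SimpleGraph V := delE (path3 H a b c e) e a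

variable {G H : SimpleGraph V} {a b c e : V}

theorem path3_steps (hbc : H.Adj b c) (hce : ¬ H.Adj c e) :
    (addE H a b).Adj b c ∧ ¬ (delE (addE H a b) b c).Adj c e := by
  refine ⟨Or.inl hbc, ?_⟩
  simp only [delE_adj, addE_adj]
  grind [SimpleGraph.Adj.symm, SimpleGraph.Adj.ne]

theorem cnt_path3 (ha : a ≠ b) (hc : c ≠ e) (hab : ¬ H.Adj a b) (hbc : H.Adj b c)
    (hce : ¬ H.Adj c e) (v : V) : cnt (path3 H a b c e) Finset.univ v =
      cnt H Finset.univ v + (if v = a then 1 else 0) + (if v = e then 1 else 0) := by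
  obtain ⟨h1, h2⟩ := path3_steps hbc hce
  unfold path3
  rw [cnt_addE hc h2, cnt_delE h1, cnt_addE ha hab]
  simp only [Finset.mem_univ, and_true]
  ring

theorem dist_path3 (ha : a ≠ b) (hc : c ≠ e) (hab : ¬ H.Adj a b) (hbc : H.Adj b c)
    (hce : ¬ H.Adj c e) (gab : G.Adj a b) (gbc : ¬ G.Adj b c) (gce : G.Adj c e) :
    dist G (path3 H a b c e) = dist G H - 6 := by
  obtain ⟨h1, h2⟩ := path3_steps hbc hce
  unfold path3
  rw [(dist_addE hc h2).1 gce, (dist_delE h1).2 gbc, (dist_addE ha hab).1 gab]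
  ring

/-- Only the first two changes are known to approach `G`; the third costs at most what one of them
gains. -/
theorem dist_path3_le (ha : a ≠ b) (hc : c ≠ e) (hab : ¬ H.Adj a b) (hbc : H.Adj b c)
    (hce : ¬ H.Adj c e) (gab : G.Adj a b) (gbc : ¬ G.Adj b c) :
    dist G (path3 H a b c e) ≤ dist G H - 2 := by
  obtain ⟨h1, h2⟩ := path3_steps hbc hce
  unfold path3
  have h3 := dist_addE' (G := G) hc h2
  rw [(dist_delE h1).2 gbc, (dist_addE ha hab).1 gab] at h3
  linarith

theorem flip4_step (b c : V) (ha : a ≠ b)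
    (hea : H.Adj e a) : (path3 H a b c e).Adj e a := by
  simp only [path3, delE_adj, addE_adj]
  grind [SimpleGraph.Adj.symm, SimpleGraph.Adj.ne]

theorem cnt_flip4 (ha : a ≠ b) (hc : c ≠ e) (hab : ¬ H.Adj a b) (hbc : H.Adj b c)
    (hce : ¬ H.Adj c e) (hea : H.Adj e a) (v : V) :
    cnt (flip4 H a b c e) Finset.univ v = cnt H Finset.univ v := by
  have h := flip4_step b c ha hea
  unfold flip4
  rw [cnt_delE h, cnt_path3 ha hc hab hbc hce]
  simp only [Finset.mem_univ, and_true]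
  ring

/-- Three of the four changes approach `G`, so the fourth cannot undo the gain. The variant below
leaves a different edge undetermined. -/
theorem dist_flip4 (ha : a ≠ b) (hc : c ≠ e) (hab : ¬ H.Adj a b) (hbc : H.Adj b c)
    (hce : ¬ H.Adj c e) (hea : H.Adj e a) (gab : G.Adj a b) (gbc : ¬ G.Adj b c)
    (gce : G.Adj c e) : dist G (flip4 H a b c e) < dist G H := by
  have h := flip4_step b c ha hea
  have h1 := dist_delE' (G := G) h
  rw [dist_path3 ha hc hab hbc hce gab gbc gce] at h1
  unfold flip4
  linarith

theorem dist_flip4' (ha : a ≠ b) (hc : c ≠ e) (hab : ¬ H.Adj a b) (hbc : H.Adj b c)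
    (hce : ¬ H.Adj c e) (hea : H.Adj e a) (gab : G.Adj a b) (gbc : ¬ G.Adj b c)
    (gea : ¬ G.Adj e a) : dist G (flip4 H a b c e) < dist G H := by
  have h := flip4_step b c ha hea
  have h1 := dist_path3_le ha hc hab hbc hce gab gbc
  unfold flip4
  rw [(dist_delE h).2 gea]
  linarith

theorem path3_adj {x y : V} : (path3 H a b c e).Adj x y ↔
    ((H.Adj x y ∨ (x ≠ y ∧ ((x = a ∧ y = b) ∨ (x = b ∧ y = a)))) ∧
      ¬ ((x = b ∧ y = c) ∨ (x = c ∧ y = b))) ∨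
      (x ≠ y ∧ ((x = c ∧ y = e) ∨ (x = e ∧ y = c))) := Iff.rfl

/-- Three edges of an alternating cycle, the first and third of which belong to `G` only. -/
theorem MinPair.four_red {d : V → ℤ} {D : Finset V} (M : MinPair d D G H)
    (gab : G.Adj a b) (hab : ¬ H.Adj a b) (gbc : ¬ G.Adj b c) (hbc : H.Adj b c)
    (gce : G.Adj c e) (hce : ¬ H.Adj c e) (hae : a ≠ e) :
    G.Adj a e ∧ (H.Adj a e → ∃ v, v ∉ D ∧ ∀ x ∈ D, ¬ (flip4 H a b c e).Adj v x) := by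
  constructor
  · by_contra hne
    have hne' : ¬ G.Adj e a := fun h => hne h.symm
    have h1 := M.dist_le_left (G' := flip4 G b c e a)
      (cnt_flip4 hbc.ne hae.symm gbc gce hne' gab)
    rw [dist_comm, dist_comm _ H] at h1
    have h2 := dist_flip4' (G := H) hbc.ne hae.symm gbc gce hne' gab hbc hce hab
    linarith
  · intro hae'
    by_contra! hc
    have h1 := M.dist_le_right (H' := flip4 H a b c e)
      (cnt_flip4 gab.ne gce.ne hab hbc hce hae'.symm) hc
    have h2 := dist_flip4 (G := G) gab.ne gce.ne hab hbc hce hae'.symm gab gbc gce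
    linarith

/-- Three edges of an alternating cycle, the first and third of which belong to `H` only. -/
theorem MinPair.four_blue {d : V → ℤ} {D : Finset V} (M : MinPair d D G H)
    (gab : ¬ G.Adj a b) (hab : H.Adj a b) (gbc : G.Adj b c) (hbc : ¬ H.Adj b c)
    (gce : ¬ G.Adj c e) (hce : H.Adj c e) (hae : a ≠ e)
    (hd : ∀ v, v ∉ D → ∃ x ∈ D, (flip4 H b c e a).Adj v x) :
    ¬ G.Adj a e ∧ H.Adj a e := by
  constructor
  · intro hae'
    have h1 := M.dist_le_left (G' := flip4 G a b c e)
      (cnt_flip4 hab.ne hce.ne gab gbc gce hae'.symm)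
    rw [dist_comm, dist_comm _ H] at h1
    have h2 := dist_flip4 (G := H) hab.ne hce.ne gab gbc gce hae'.symm hab hbc hce
    linarith
  · by_contra hae'
    have hae'' : ¬ H.Adj e a := fun h => hae' h.symm
    have h1 := M.dist_le_right (H' := flip4 H b c e a)
      (cnt_flip4 gbc.ne hae.symm hbc hce hae'' hab) hd
    have h2 := dist_flip4' (G := G) gbc.ne hae.symm hbc hce hae'' hab gbc gce gab
    linarith

end Flips

/-! ### Red (`G` only) and blue (`H` only) walks from a deficient vertex -/

section MergeMain

variable {V : Type*} [Fintype V] [DecidableEq V]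
variable {d : V → ℤ} {D : Finset V} {G H : SimpleGraph V}

/-- The edges of `G` only and of `H` only. -/
theorem MinPair.red_nbr_not_lt (M : MinPair d D G H) {r z : V}
    (hr : cnt H Finset.univ r < d r) (gz : G.Adj r z) (hz : ¬ H.Adj r z) :
    cnt H Finset.univ z = d z := by
  by_contra hne
  exact hz (M.adj_of_lt hr (lt_of_le_of_ne (M.valid.le z) hne) gz.ne)

/-- Otherwise adding `rz`, removing `zp` and adding `pr` raises the degree of `r` by two and comes
closer to `G`, while `z` and `p` are dominated by `r`. -/
theorem MinPair.adj_of_red_blue (M : MinPair d D G H) {r z p : V}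
    (hr : cnt H Finset.univ r < d r) (gz : G.Adj r z) (hz : ¬ H.Adj r z)
    (gp : ¬ G.Adj z p) (hp : H.Adj z p) : H.Adj r p := by
  by_contra hrp
  have hrD := M.mem_of_lt hr
  have hpr : p ≠ r := by rintro rfl; exact hz hp.symm
  have a1 : ¬ H.Adj r z := hz
  have a2 : (addE H r z).Adj z p := Or.inl hp
  have a3 : ¬ (delE (addE H r z) z p).Adj p r := by
    simp only [delE_adj, addE_adj]
    grind [SimpleGraph.Adj.symm, SimpleGraph.Adj.ne]
  have h1 := M.dist_lt_of_add_two (H' := path3 H r z p r) hr (fun v => ?_) ?_ ?_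
  · have h2 := dist_path3_le (G := G) gz.ne hpr hz hp (fun h => hrp h.symm) gz gp
    linarith
  · rw [cnt_path3 gz.ne hpr hz hp (fun h => hrp h.symm)]
    split_ifs <;> ring
  · intro v hv
    by_cases h1 : v = z
    · exact ⟨r, hrD, by rw [path3_adj]; grind [SimpleGraph.Adj.ne]⟩
    by_cases h2 : v = p
    · exact ⟨r, hrD, by rw [path3_adj]; grind [SimpleGraph.Adj.ne]⟩
    obtain ⟨x, hx, hvx⟩ := M.valid.dom v hv
    exact ⟨x, hx, by rw [path3_adj]; grind⟩
  · intro x hx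
    rw [path3_adj]
    grind [SimpleGraph.Adj.ne]

/-- A vertex outside `D` joined to `r` in both graphs, with no other neighbour in `D`. -/
def Priv (D : Finset V) (G H : SimpleGraph V) (r q : V) : Prop :=
  q ∉ D ∧ G.Adj r q ∧ H.Adj r q ∧ ∀ x ∈ D, H.Adj q x → x = r

/-- The private neighbours `q` of `r` which are reached from `r` by way of `z` and `p`. -/
def Wit (D : Finset V) (G H : SimpleGraph V) (r z p q : V) : Prop :=
  Priv D G H r q ∧ p ∉ D ∧ (G.Adj r z ∧ ¬ H.Adj r z) ∧ (¬ G.Adj z p ∧ H.Adj z p) ∧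
    (G.Adj p q ∧ ¬ H.Adj p q)

/-- By minimality the walk `r z p q` closes up in `G`. If `rq` also lies in `H`, flipping the
four-cycle comes closer to `G`, so it must destroy domination. Since `z` and `p` are joined to `r`,
only `q` can suffer, and `r` was its only dominator. -/
theorem MinPair.red_or_wit (M : MinPair d D G H) {r z p q : V}
    (hr : cnt H Finset.univ r < d r) (gz : G.Adj r z) (hz : ¬ H.Adj r z)
    (gp : ¬ G.Adj z p) (hp : H.Adj z p) (gq : G.Adj p q) (hq : ¬ H.Adj p q) :
    (G.Adj r q ∧ ¬ H.Adj r q) ∨ Wit D G H r z p q := by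
  have hrD := M.mem_of_lt hr
  have hrp := M.adj_of_red_blue hr gz hz gp hp
  have hqr : r ≠ q := by rintro rfl; exact hq hrp.symm
  obtain ⟨h1, h2⟩ := M.four_red gz hz gp hp gq hq hqr
  by_cases h3 : H.Adj r q
  swap
  · exact Or.inl ⟨h1, h3⟩
  obtain ⟨v, hv, hv'⟩ := h2 h3
  right
  obtain ⟨x, hx, hvx⟩ := M.valid.dom v hv
  have hvr : v ≠ r := by rintro rfl; exact hv hrD
  have hrz := gz.ne
  have hzp := hp.ne
  have hpq := gq.ne
  have hrp' := hrp.ne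
  have hzq : z ≠ q := by rintro rfl; exact hz h3
  have key : ∀ x ∈ D, ¬ (flip4 H r z p q).Adj v x := hv'
  simp only [flip4, delE_adj, path3_adj] at key
  have hvq : v = q := by
    by_contra hvq
    have k1 := key r hrD
    by_cases e1 : v = z
    · grind
    by_cases e2 : v = p
    · have := hrp.symm
      grind
    have := key x hx
    grind
  subst hvq
  -- The flip joins `q` to `p`, so `p` in `D` would dominate `q`.
  have hpD : p ∉ D := by
    intro hpD
    have := key p hpD
    grind
  refine ⟨⟨hv, h1, h3, ?_⟩, hpD, ⟨gz, hz⟩, ⟨gp, hp⟩, gq, hq⟩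
  intro y hy hvy
  have := key y hy
  have h4 := hvy.ne
  by_contra hyr
  have e3 : y ≠ p := by rintro rfl; exact hpD hy
  grind

/-- A longer form of `MinPair.adj_of_red_blue`: add `rz`, remove `zp`, add `pq`, remove `qt`, add
`tr`. Every vertex that loses an edge ends up adjacent to `r`. -/
theorem MinPair.adj_of_wit_blue (M : MinPair d D G H) {r z p q t : V}
    (hr : cnt H Finset.univ r < d r) (hw : Wit D G H r z p q)
    (gt : ¬ G.Adj q t) (ht : H.Adj q t) (htz : t ≠ z) : H.Adj r t := by
  by_contra hrt
  obtain ⟨⟨hqD, grq, hrq, hpriv⟩, hpD, ⟨gz, hz⟩, ⟨gp, hp⟩, gq, hq⟩ := hw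
  have hrD := M.mem_of_lt hr
  have hrp := M.adj_of_red_blue hr gz hz gp hp
  have htr : t ≠ r := by rintro rfl; exact gt grq.symm
  have htp : t ≠ p := by rintro rfl; exact gt gq.symm
  have hzq : z ≠ q := by rintro rfl; exact hz hrq
  have hqr := hrq.ne
  have hzr := gz.ne
  have hzp := hp.ne
  have hpq := gq.ne
  have hpr := hrp.ne
  have hqt := ht.ne
  have a2 : (path3 H r z p q).Adj q t := by rw [path3_adj]; grind
  have a3 : ¬ (delE (path3 H r z p q) q t).Adj t r := by
    rw [delE_adj, path3_adj]; have := H.adj_comm r t; grind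
  have hsymm := hrq.symm
  have hsymm' := hrp.symm
  have h1 := M.dist_lt_of_add_two (H' := addE (delE (path3 H r z p q) q t) t r) hr
    (fun v => ?_) ?_ ?_
  · have h2 := dist_addE' (G := G) htr a3
    have h3 := dist_path3 (G := G) gz.ne gq.ne hz hp hq gz gp gq
    rw [(dist_delE a2).2 gt, h3] at h2
    linarith
  · rw [cnt_addE htr a3, cnt_delE a2, cnt_path3 gz.ne gq.ne hz hp hq]
    simp only [Finset.mem_univ, and_true]
    split_ifs <;> omega
  · intro v hv
    simp only [addE_adj, delE_adj, path3_adj]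
    by_cases e1 : v = z ∨ v = p ∨ v = q ∨ v = t
    · exact ⟨r, hrD, by grind⟩
    obtain ⟨x, hx, hvx⟩ := M.valid.dom v hv
    exact ⟨x, hx, by grind⟩
  · intro x hx
    simp only [addE_adj, delE_adj, path3_adj]
    grind [SimpleGraph.Adj.ne]

/-- A red–blue–red path `p q t s` between vertices outside `D`, with `p` and `q` dominated by `r`,
closes to a red triangle or cycle. -/
theorem MinPair.red_of_priv (M : MinPair d D G H) {r p q t s : V} (hrD : r ∈ D)
    (hp : p ∉ D) (hrp : H.Adj r p) (hq : q ∉ D) (hrq : H.Adj r q)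
    (gpq : G.Adj p q) (hpq : ¬ H.Adj p q) (gqt : ¬ G.Adj q t) (hqt : H.Adj q t)
    (gts : G.Adj t s) (hts : ¬ H.Adj t s) (hps : p ≠ s) (hsr : s ≠ r) (htr : t ≠ r) :
    G.Adj p s ∧ ¬ H.Adj p s := by
  obtain ⟨h1, h2⟩ := M.four_red gpq hpq gqt hqt gts hts hps
  refine ⟨h1, fun h3 => ?_⟩
  obtain ⟨v, hv, hv'⟩ := h2 h3
  have e1 := gpq.ne
  have e2 := hqt.ne
  have e3 := gts.ne
  have e4 := hrp.ne
  have e5 := hrq.ne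
  have e6 := hrp.symm
  have e7 := hrq.symm
  have e8 : v ≠ r := by rintro rfl; exact hv hrD
  have k1 := hv' r hrD
  simp only [flip4, delE_adj, path3_adj] at k1
  by_cases f1 : v = p
  · grind
  by_cases f2 : v = q
  · grind
  obtain ⟨x, hx, hvx⟩ := M.valid.dom v hv
  have k2 := hv' x hx
  simp only [flip4, delE_adj, path3_adj] at k2
  grind

/-- This keeps the set counted in `MinPair.exists_wit` closed under a blue step followed by a red
one. In the main case the walk `p q t s` closes to a red edge `ps`, and `s` is reached from `r` by
way of `z` and `p`. -/
theorem MinPair.red_or_wit_of_wit (M : MinPair d D G H) {r z p q t s : V}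
    (hr : cnt H Finset.univ r < d r) (hw : Wit D G H r z p q)
    (gt : ¬ G.Adj q t) (ht : H.Adj q t) (gs : G.Adj t s) (hs : ¬ H.Adj t s) (hsr : s ≠ r) :
    (G.Adj r s ∧ ¬ H.Adj r s) ∨ ∃ z' p', Wit D G H r z' p' s := by
  obtain ⟨⟨hqD, grq, hrq, hpriv⟩, hpD, ⟨gz, hz⟩, ⟨gp, hp⟩, gq, hq⟩ := hw
  have hrD := M.mem_of_lt hr
  have hrp := M.adj_of_red_blue hr gz hz gp hp
  -- If the walk returns to `p`, the blue edges `zp`, `tq` and the red edge `pt` force `zq` to be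
  -- blue, so `p` is reached by way of `z` and `q`.
  by_cases hps : p = s
  · subst hps
    have htz : t ≠ z := by rintro rfl; exact hs hp
    have hzq : z ≠ q := by rintro rfl; exact hz hrq
    have hrt := M.adj_of_wit_blue hr
      ⟨⟨hqD, grq, hrq, hpriv⟩, hpD, ⟨gz, hz⟩, ⟨gp, hp⟩, gq, hq⟩ gt ht htz
    have htD : t ∉ D := fun h => by
      have := hpriv t h ht
      subst this
      exact gt grq.symm
    have hdom : ∀ v, v ∉ D → ∃ x ∈ D, (flip4 H p t q z).Adj v x := by
      intro v hv
      have e1 := hrq.symm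
      have e2 := hrp.symm
      have e3 := hrt.symm
      have e4 := hrq.ne
      have e5 := hrp.ne
      have e6 := hrt.ne
      have e7 := gz.ne
      have e8 := hp.ne
      have e9 := ht.ne
      have e10 := gq.ne
      have e11 := gs.ne
      simp only [flip4, delE_adj, path3_adj]
      by_cases f1 : v = p ∨ v = q ∨ v = t
      · exact ⟨r, hrD, by grind⟩
      obtain ⟨x, hx, hvx⟩ := M.valid.dom v hv
      have e12 : x ≠ p := by rintro rfl; exact hpD hx
      exact ⟨x, hx, by grind⟩
    obtain ⟨k1, k2⟩ := M.four_blue gp hp gs.symm (fun h => hs h.symm)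
      (fun h => gt h.symm) ht.symm hzq hdom
    rcases M.red_or_wit hr gz hz k1 k2 gq.symm (fun h => hq h.symm) with h | h
    · exact Or.inl h
    · exact Or.inr ⟨_, _, h⟩
  · obtain ⟨k1, k2⟩ := M.red_of_priv hrD hpD hrp hqD hrq gq hq gt ht gs hs hps hsr
      (by rintro rfl; exact gt grq.symm)
    rcases M.red_or_wit hr gz hz gp hp k1 k2 with h | h
    · exact Or.inl h
    · exact Or.inr ⟨_, _, h⟩

end MergeMain

/-! ### The count of red and blue edges, and the merging theorem -/

section MergeEnd

variable {V : Type*} [Fintype V] [DecidableEq V]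
variable {d : V → ℤ} {D : Finset V} {G H : SimpleGraph V}

theorem cnt_sdiff (G H : SimpleGraph V) (T : Finset V) (v : V) :
    cnt (G \ H) T v - cnt (H \ G) T v = cnt G T v - cnt H T v := by
  unfold cnt
  rw [← Finset.sum_sub_distrib, ← Finset.sum_sub_distrib]
  refine Finset.sum_congr rfl fun y _ => ?_
  by_cases h1 : G.Adj v y <;> by_cases h2 : H.Adj v y <;> simp [h1, h2]

/-- Double counting. Let `R` consist of the red neighbours of `r` and the private vertices reached
from it, and `P` of the blue neighbours of `R`. Vertices of `R` are saturated in `H`, so they have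
as many red as blue edges, and their blue edges all enter `P`. Vertices of `P` have at most as many
blue as red edges, and these red edges end in `R` or at `r`. Hence `r` has at least as many red
edges to `P` as to `R`, so all its red neighbours lie in `P`. -/
theorem MinPair.exists_wit (M : MinPair d D G H) {r z : V}
    (hr : cnt H Finset.univ r < d r) (gz : G.Adj r z) (hz : ¬ H.Adj r z) :
    ∃ p q, Wit D G H r z p q ∧ H.Adj z q ∧ ¬ G.Adj z q := by
  classical
  set R : Finset V := Finset.univ.filter fun x =>
    (G.Adj r x ∧ ¬ H.Adj r x) ∨ ∃ z p, Wit D G H r z p x with hR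
  set P : Finset V := Finset.univ.filter fun y => ∃ x ∈ R, H.Adj x y ∧ ¬ G.Adj x y with hP
  have memR : ∀ x, x ∈ R ↔ (G.Adj r x ∧ ¬ H.Adj r x) ∨ ∃ z p, Wit D G H r z p x := by
    intro x; simp [hR]
  have memP : ∀ y, y ∈ P ↔ ∃ x ∈ R, H.Adj x y ∧ ¬ G.Adj x y := by intro x; simp [hP]
  have hPr : r ∉ P := by
    intro h
    obtain ⟨x, hx, h1, h2⟩ := (memP r).1 h
    rcases (memR x).1 hx with h3 | ⟨_, _, h3⟩
    · exact h2 h3.1.symm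
    · exact h2 h3.1.2.1.symm
  have hbal : ∀ x ∈ R, cnt (G \ H) Finset.univ x = cnt (H \ G) Finset.univ x := by
    intro x hx
    have h1 := cnt_sdiff G H Finset.univ x
    have h2 : cnt H Finset.univ x = d x := by
      rcases (memR x).1 hx with h3 | ⟨_, _, h3⟩
      · exact M.red_nbr_not_lt hr h3.1 h3.2
      · exact M.valid.eq x h3.1.1
    rw [M.real, h2] at h1
    linarith
  have h1 : ∑ x ∈ R, cnt (H \ G) Finset.univ x ≤ ∑ x ∈ R, cnt (H \ G) P x := by
    refine Finset.sum_le_sum fun x hx => ?_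
    exact cnt_le_of_forall fun y _ hy => (memP y).2 ⟨x, hx, hy.1, hy.2⟩
  have h2 : ∑ y ∈ P, cnt (H \ G) R y ≤ ∑ y ∈ P, cnt (G \ H) Finset.univ y := by
    refine Finset.sum_le_sum fun y hy => ?_
    have h3 := cnt_le_of_subset (H \ G) (Finset.subset_univ R) y
    have h4 := cnt_sdiff G H Finset.univ y
    have h5 := M.valid.le y
    rw [M.real] at h4
    linarith
  have h3 : ∑ y ∈ P, cnt (G \ H) Finset.univ y ≤
      ∑ y ∈ P, (cnt (G \ H) R y + cnt (G \ H) {r} y) := by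
    refine Finset.sum_le_sum fun y hy => ?_
    have hrR : r ∉ R := by
      intro h
      rcases (memR r).1 h with h3 | ⟨_, _, h3⟩
      · exact G.irrefl h3.1
      · exact G.irrefl h3.1.2.1
    rw [← cnt_union _ (by simpa using hrR)]
    refine cnt_le_of_forall fun s _ hs => ?_
    rw [Finset.mem_union, Finset.mem_singleton, memR]
    by_cases hsr : s = r
    · exact Or.inr hsr
    left
    obtain ⟨x, hx, h1, h2⟩ := (memP y).1 hy
    rcases (memR x).1 hx with h3 | ⟨_, _, h3⟩
    · rcases M.red_or_wit hr h3.1 h3.2 h2 h1 hs.1 hs.2 with h | h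
      · exact Or.inl h
      · exact Or.inr ⟨_, _, h⟩
    · exact M.red_or_wit_of_wit hr h3 h2 h1 hs.1 hs.2 hsr
  have h4 : ∑ x ∈ R, (cnt (G \ H) P x + cnt (G \ H) {r} x) ≤
      ∑ x ∈ R, cnt (G \ H) Finset.univ x := by
    refine Finset.sum_le_sum fun x hx => ?_
    rw [← cnt_union _ (by simpa using hPr)]
    exact cnt_le_of_subset _ (Finset.subset_univ _) _
  rw [Finset.sum_add_distrib] at h3 h4
  rw [Finset.sum_congr rfl hbal, sum_cnt_comm _ R P, sum_cnt_comm _ R {r}] at h4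
  rw [sum_cnt_comm _ P {r}] at h3
  rw [sum_cnt_comm _ R P] at h1
  simp only [Finset.sum_singleton] at h3 h4
  have h5 : cnt (G \ H) R r ≤ cnt (G \ H) P r := by linarith
  have hzP : z ∈ P := by
    by_contra hzP
    have h6 : cnt (G \ H) {z} r + cnt (G \ H) P r ≤ cnt (G \ H) R r := by
      rw [← cnt_union _ (by simpa using hzP)]
      exact cnt_le_of_forall fun s _ hs => (memR s).2 (Or.inl hs)
    have h7 : 0 < cnt (G \ H) {z} r := cnt_pos.2 ⟨z, by simp, gz, hz⟩
    linarith
  obtain ⟨x, hx, k1, k2⟩ := (memP z).1 hzP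
  -- If `x` were a red neighbour of `r`, or private but reached through another vertex than `z`, the
  -- blue edge `xz` would put `rz` into `H`.
  rcases (memR x).1 hx with h6 | ⟨z', p', h6⟩
  · exact absurd (M.adj_of_red_blue hr h6.1 h6.2 k2 k1) hz
  · by_cases hzz : z = z'
    · subst hzz
      exact ⟨p', x, h6, k1.symm, fun h => k2 h.symm⟩
    · exact absurd (M.adj_of_wit_blue hr h6 k2 k1 hzz) hz

/-- The configurations at `r` and `r'` are linked into one alternating path that starts and ends
with an addition, so both ends gain an edge. All inner vertices are joined to `r` or `r'`
afterwards, which secures domination. -/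
theorem MinPair.false_of_two_wits (M : MinPair d D G H) {r z p q r' z' p' q' : V}
    (hr : cnt H Finset.univ r < d r) (hr' : cnt H Finset.univ r' < d r')
    (hrr : r = r' → cnt H Finset.univ r + 2 ≤ d r ∧ z ≠ z') (hzr : z ≠ r') (hzr' : z' ≠ r)
    (w : Wit D G H r z p q) (w' : Wit D G H r' z' p' q') (hp : Priv D G H r p)
    (hp' : Priv D G H r' p') (hzq : H.Adj z q) (hzq' : H.Adj z' q')
    (e1 : p ≠ p') (e2 : p ≠ q') (e3 : q ≠ p') (e4 : q ≠ q') (e5 : z ≠ q') : False := by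
  obtain ⟨⟨hqD, grq, hrq, -⟩, -, ⟨gz, hz⟩, ⟨gzp, hzp⟩, gpq, hpq⟩ := w
  obtain ⟨⟨hqD', grq', hrq', -⟩, -, ⟨gz', hz'⟩, ⟨gzp', hzp'⟩, gpq', hpq'⟩ := w'
  obtain ⟨hpD, grp, hrp, -⟩ := hp
  obtain ⟨hpD', grp', hrp', -⟩ := hp'
  have hrD := M.mem_of_lt hr
  have hrD' := M.mem_of_lt hr'
  have f1 := hrq.symm
  have f2 := hrp.symm
  have f3 := hrq'.symm
  have f4 := hrp'.symm
  have n1 := hrq.ne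
  have n2 := hrp.ne
  have n3 := hrq'.ne
  have n4 := hrp'.ne
  have n5 := gz.ne
  have n6 := gz'.ne
  have n7 := hzp.ne
  have n8 := hzq.ne
  have n9 := hzp'.ne
  have n10 := hzq'.ne
  have n11 := gpq.ne
  have n12 := gpq'.ne
  have m1 : p ≠ r' := by rintro rfl; exact hpD hrD'
  have m2 : q ≠ r' := by rintro rfl; exact hqD hrD'
  have m3 : p' ≠ r := by rintro rfl; exact hpD' hrD
  have m4 : q' ≠ r := by rintro rfl; exact hqD' hrD
  have s1 := hzp'.symm
  have s2 := hzq'.symm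
  have s3 : ¬ H.Adj z' r' := fun h => hz' h.symm
  -- The path is `r z p q p' q' z' r'` if `qp'` can be removed, and `r z q p' z' r'` if it can be
  -- added.
  by_cases hqp : H.Adj q p'
  · have a1 : (path3 H r z p q).Adj q p' := by rw [path3_adj]; grind
    have a2 : ¬ (delE (path3 H r z p q) q p').Adj p' q' := by
      rw [delE_adj, path3_adj]; grind
    have a3 : (addE (delE (path3 H r z p q) q p') p' q').Adj q' z' := by
      rw [addE_adj, delE_adj, path3_adj]; grind
    have a4 : ¬ (delE (addE (delE (path3 H r z p q) q p') p' q') q' z').Adj z' r' := by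
      rw [delE_adj, addE_adj, delE_adj, path3_adj]; grind
    refine M.false_of_add_two (H' := addE (delE (addE (delE (path3 H r z p q) q p') p' q')
      q' z') z' r') (r := r) (r' := r') (fun v => ?_) (by omega) (by omega)
      (fun h => (hrr h).1) ?_
    · rw [cnt_addE n6.symm a4, cnt_delE a3, cnt_addE n12 a2, cnt_delE a1,
        cnt_path3 n5 n11 hz hzp hpq]
      simp only [Finset.mem_univ, and_true]
      ring
    · intro v hv
      simp only [addE_adj, delE_adj, path3_adj]
      by_cases k1 : v = z ∨ v = p ∨ v = q
      · exact ⟨r, hrD, by grind⟩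
      by_cases k2 : v = z' ∨ v = p' ∨ v = q'
      · exact ⟨r', hrD', by grind⟩
      obtain ⟨x, hx, hvx⟩ := M.valid.dom v hv
      exact ⟨x, hx, by grind⟩
  · have a1 : (path3 H r z q p').Adj p' z' := by rw [path3_adj]; grind
    have a2 : ¬ (delE (path3 H r z q p') p' z').Adj z' r' := by
      rw [delE_adj, path3_adj]; grind
    refine M.false_of_add_two (H' := addE (delE (path3 H r z q p') p' z') z' r')
      (r := r) (r' := r') (fun v => ?_) (by omega) (by omega) (fun h => (hrr h).1) ?_
    · rw [cnt_addE n6.symm a2, cnt_delE a1, cnt_path3 n5 e3 hz hzq hqp]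
      simp only [Finset.mem_univ, and_true]
      ring
    · intro v hv
      simp only [addE_adj, delE_adj, path3_adj]
      by_cases k1 : v = z ∨ v = p ∨ v = q
      · exact ⟨r, hrD, by grind⟩
      by_cases k2 : v = z' ∨ v = p' ∨ v = q'
      · exact ⟨r', hrD', by grind⟩
      obtain ⟨x, hx, hvx⟩ := M.valid.dom v hv
      exact ⟨x, hx, by grind⟩

/-- The red degree of `r` exceeds its blue degree by its deficiency. Two missing units give two red
edges at `r` and so two configurations; for one missing unit, parity provides a second deficient
vertex. -/
theorem MinPair.not_lt (M : MinPair d D G H) (r : V) : ¬ cnt H Finset.univ r < d r := by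
  intro hr
  have hred : ∀ s, cnt (G \ H) Finset.univ s - cnt (H \ G) Finset.univ s =
      d s - cnt H Finset.univ s := fun s => by rw [cnt_sdiff, M.real]
  -- The configuration is symmetric in `p` and `q`, so `p` is private to `r` as well.
  have priv : ∀ {r z p q}, cnt H Finset.univ r < d r → Wit D G H r z p q → H.Adj z q →
      ¬ G.Adj z q → Wit D G H r z q p := by
    intro r z p q hr w h1 h2
    obtain ⟨w1, w2, ⟨w3, w4⟩, ⟨w5, w6⟩, w7, w8⟩ := w
    rcases M.red_or_wit hr w3 w4 h2 h1 w7.symm (fun h => w8 h.symm) with h | h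
    · exact absurd (M.adj_of_red_blue hr w3 w4 w5 w6) h.2
    · exact h
  obtain ⟨z, -, gz, hz⟩ : ∃ z ∈ Finset.univ, (G \ H).Adj r z := by
    apply cnt_pos.1
    have := hred r
    have := cnt_nonneg (H \ G) Finset.univ r
    omega
  obtain ⟨p, q, w, k1, k2⟩ := M.exists_wit hr gz hz
  have w2 := priv hr w k1 k2
  by_cases hr2 : cnt H Finset.univ r + 2 ≤ d r
  · obtain ⟨z', -, ⟨gz', hz'⟩, hne⟩ : ∃ z' ∈ Finset.univ, (G \ H).Adj r z' ∧ z' ≠ z := by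
      apply exists_ne_of_one_lt_cnt
      have := hred r
      have := cnt_nonneg (H \ G) Finset.univ r
      omega
    obtain ⟨p', q', w', k1', k2'⟩ := M.exists_wit hr gz' hz'
    have w2' := priv hr w' k1' k2'
    -- A common private vertex would have blue edges to both `z` and `z'`, which would put `rz'`
    -- into `H`.
    have key : ∀ a b c e, Wit D G H r z a b → Wit D G H r z' c e → H.Adj z' e → ¬ G.Adj z' e →
        b ≠ e := by
      rintro a b c e v1 v2 v3 v4 rfl
      exact hz' (M.adj_of_wit_blue hr v1 (fun h => v4 h.symm) v3.symm hne)
    exact M.false_of_two_wits hr hr (fun _ => ⟨hr2, hne.symm⟩) gz.ne.symm gz'.ne.symm w w' w2.1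
      w2'.1 k1 k1' (key _ _ _ _ w2 w2' w'.2.2.2.1.2 w'.2.2.2.1.1) (key _ _ _ _ w2 w' k1' k2')
      (key _ _ _ _ w w2' w'.2.2.2.1.2 w'.2.2.2.1.1) (key _ _ _ _ w w' k1' k2')
      (by rintro rfl; exact hz w'.1.2.2.1)
  · obtain ⟨r', hne, hr'⟩ : ∃ r', r' ≠ r ∧ cnt H Finset.univ r' < d r' := by
      by_contra! hall
      have h3 : ∑ v, cnt G Finset.univ v - ∑ v, cnt H Finset.univ v = 1 := by
        rw [← Finset.sum_sub_distrib, Finset.sum_eq_single r]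
        · rw [M.real]; omega
        · intro b _ hb
          rw [M.real]
          linarith [hall b hb, M.valid.le b]
        · simp
      have h4 := (even_sum_cnt G).sub (even_sum_cnt H)
      rw [h3] at h4
      exact absurd h4 (by decide)
    obtain ⟨z', -, gz', hz'⟩ : ∃ z ∈ Finset.univ, (G \ H).Adj r' z := by
      apply cnt_pos.1
      have := hred r'
      have := cnt_nonneg (H \ G) Finset.univ r'
      omega
    obtain ⟨p', q', w', k1', k2'⟩ := M.exists_wit hr' gz' hz'
    have w2' := priv hr' w' k1' k2'
    have hrr := M.adj_of_lt hr hr' hne.symm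
    -- A private vertex has just one neighbour of `H` in `D`, so it cannot belong to both `r` and
    -- `r'`.
    have key : ∀ a c, Priv D G H r a → Priv D G H r' c → a ≠ c := by
      rintro a c v1 v2 rfl
      exact hne (v1.2.2.2 r' (M.mem_of_lt hr') v2.2.2.1.symm)
    -- The linking path needs `z ≠ q'`. If they coincide, `p'` and `q'` change roles.
    by_cases hzq' : z = q'
    · exact M.false_of_two_wits hr hr' (fun h => absurd h.symm hne)
        (by rintro rfl; exact hz hrr) (by rintro rfl; exact hz' hrr.symm) w w2' w2.1
        w'.1 k1 w'.2.2.2.1.2 (key _ _ w2.1 w'.1) (key _ _ w2.1 w2'.1) (key _ _ w.1 w'.1)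
        (key _ _ w.1 w2'.1) (hzq' ▸ w'.2.2.2.2.1.ne.symm)
    · exact M.false_of_two_wits hr hr' (fun h => absurd h.symm hne)
        (by rintro rfl; exact hz hrr) (by rintro rfl; exact hz' hrr.symm) w w' w2.1
        w2'.1 k1 k1' (key _ _ w2.1 w2'.1) (key _ _ w2.1 w'.1) (key _ _ w.1 w2'.1)
        (key _ _ w.1 w'.1) hzq'

/-- If `d` is graphic and some graph is valid then `d` has a valid realization. -/
theorem exists_real_of_valid (hG : ∀ v, cnt G Finset.univ v = d v) (hH : Valid d D H) :
    ∃ K : SimpleGraph V, (∀ v, cnt K Finset.univ v = d v) ∧ ∀ v, v ∉ D → ∃ a ∈ D, K.Adj v a := by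
  obtain ⟨G', H', M⟩ := exists_minPair hG hH
  exact ⟨H', fun v => le_antisymm (M.valid.le v) (not_lt.1 (M.not_lt v)), M.valid.dom⟩

end MergeEnd

/-! ### Saturating the vertices outside `[0, γ)` in order -/

section Saturation

variable {n : ℕ}

/-- The vertices `i < γ`. -/
def low (n γ : ℕ) : Finset (Fin n) := Finset.univ.filter fun i => i.val < γ

/-- The vertices `γ ≤ i ≤ r`. -/
def mid (γ : ℕ) (r : Fin n) : Finset (Fin n) := Finset.univ.filter fun i => γ ≤ i.val ∧ i ≤ r

/-- The vertices `r < i`. -/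
def high (r : Fin n) : Finset (Fin n) := Finset.univ.filter fun i => r < i

@[simp] theorem mem_low {γ : ℕ} {i : Fin n} : i ∈ low n γ ↔ i.val < γ := by simp [low]
@[simp] theorem mem_mid {γ : ℕ} {r i : Fin n} : i ∈ mid γ r ↔ γ ≤ i.val ∧ i ≤ r := by simp [mid]
@[simp] theorem mem_high {r i : Fin n} : i ∈ high r ↔ r < i := by simp [high]

/-- The graphs with degrees at most `d` and exactly `d` on `[γ, r)`, in which there are no edges
within `[0, γ)` and within `(r, n)`, and each vertex `i ≥ γ` has `c` neighbours in `[0, γ)`. -/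
structure St (d : Fin n → ℤ) (γ : ℕ) (c : ℤ) (r : Fin n) (G : SimpleGraph (Fin n)) : Prop where
  le : ∀ v, cnt G Finset.univ v ≤ d v
  sat : ∀ i, γ ≤ i.val → i < r → cnt G Finset.univ i = d i
  ind_low : ∀ a b : Fin n, a.val < γ → b.val < γ → ¬ G.Adj a b
  ind_high : ∀ a b : Fin n, r < a → r < b → ¬ G.Adj a b
  dom : ∀ v : Fin n, γ ≤ v.val → c ≤ cnt G (low n γ) v

/-- Such a graph with maximum degree of `r`, which is less than `d r`. -/
structure MS (d : Fin n → ℤ) (γ : ℕ) (c : ℤ) (r : Fin n) (G : SimpleGraph (Fin n)) : Prop where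
  st : St d γ c r G
  anti : ∀ i j : Fin n, γ ≤ i.val → i ≤ j → d j ≤ d i
  le_r : γ ≤ r.val
  lt : cnt G Finset.univ r < d r
  max : ∀ G', St d γ c r G' → cnt G' Finset.univ r ≤ cnt G Finset.univ r

variable {d : Fin n → ℤ} {γ : ℕ} {c : ℤ} {r : Fin n} {G : SimpleGraph (Fin n)}

theorem MS.of_eq (M : MS d γ c r G) {G' : SimpleGraph (Fin n)} (h : St d γ c r G')
    (hr : cnt G' Finset.univ r = cnt G Finset.univ r) : MS d γ c r G' :=
  ⟨h, M.anti, M.le_r, hr ▸ M.lt, fun K hK => hr ▸ M.max K hK⟩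

theorem cnt_univ_eq (G : SimpleGraph (Fin n)) (hr : γ ≤ r.val) (v : Fin n) :
    cnt G Finset.univ v = cnt G (low n γ) v + cnt G (mid γ r) v + cnt G (high r) v := by
  rw [← cnt_union, ← cnt_union]
  · congr 1
    ext i
    simp only [Finset.mem_univ, Finset.mem_union, mem_low, mem_mid, mem_high, true_iff]
    by_cases h1 : i.val < γ
    · simp [h1]
    · by_cases h2 : i ≤ r
      · simp [h2, not_lt.1 h1]
      · simp [not_le.1 h2]
  · rw [Finset.disjoint_left]
    intro i hi hi'
    simp only [Finset.mem_union, mem_low, mem_mid, mem_high] at hi hi'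
    have := Fin.lt_def.1 hi'
    rcases hi with h | h
    · omega
    · exact absurd h.2 (not_le.2 hi')
  · rw [Finset.disjoint_left]
    intro i hi hi'
    simp only [mem_low, mem_mid] at hi hi'
    omega

theorem cnt_univ_eq' (G : SimpleGraph (Fin n)) (γ : ℕ) (v : Fin n) :
    cnt G Finset.univ v = cnt G (low n γ) v + cnt G (Finset.univ \ low n γ) v := by
  rw [← cnt_union _ Finset.disjoint_sdiff, Finset.union_sdiff_of_subset (Finset.subset_univ _)]

/-- A saturated vertex `i < r` has a dispensable neighbour which is not adjacent to `r`. -/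
theorem MS.exists_swap (M : MS d γ c r G) {i : Fin n} (hi : γ ≤ i.val) (hir : i < r) :
    ∃ u, G.Adj i u ∧ u ≠ r ∧ ¬ G.Adj r u ∧ (γ ≤ u.val ∨ c + 1 ≤ cnt G (low n γ) i) := by
  have h1 := M.st.sat i hi hir
  have h2 := M.anti i r hi hir.le
  have h3 := M.lt
  -- The degree of `i` exceeds that of `r`. If `i` has only `c` neighbours below `γ`, then `r` has
  -- no fewer there, so the surplus of `i` lies outside.
  by_cases hc : c + 1 ≤ cnt G (low n γ) i
  · obtain ⟨u, -, h4, h5, h6⟩ := exists_adj_not_adj (G := G) (T := Finset.univ) (r := r) (i := i)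
      (by simp) (by omega)
    exact ⟨u, h4, h5, h6, Or.inr hc⟩
  · have h4 := cnt_univ_eq' G γ i
    have h5 := cnt_univ_eq' G γ r
    have h6 := M.st.dom r M.le_r
    obtain ⟨u, hu, h4, h5, h6⟩ := exists_adj_not_adj (G := G) (T := Finset.univ \ low n γ)
      (r := r) (i := i) (by simp [hi]) (by omega)
    exact ⟨u, h4, h5, h6, Or.inl (by simpa using hu)⟩

/-- An unsaturated vertex outside `[γ, r]` is adjacent to all of `[γ, r]`. -/
theorem MS.adj_of_lt (M : MS d γ c r G) {x i : Fin n} (hx : x.val < γ ∨ r < x)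
    (hxd : cnt G Finset.univ x < d x) (hi : γ ≤ i.val) (hir : i ≤ r) : G.Adj x i := by
  by_contra hxi
  have hr := M.le_r
  have hlt := M.lt
  have hne : x ≠ i := by
    rintro rfl
    rcases hx with h | h
    · omega
    · exact absurd hir (not_le.2 h)
  rcases hir.lt_or_eq with hir | rfl
  -- Add `xi`, remove `iu`, add `ur`: only the degrees of `x` and `r` change, and both rise.
  · obtain ⟨u, h1, h2, h3, h4⟩ := M.exists_swap hi hir
    have n1 := h1.ne
    have n2 := hir.ne
    have h1' := h1.symm
    have hxu : x ≠ u := by rintro rfl; exact hxi h1'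
    have hxi' : ¬ G.Adj i x := fun h => hxi h.symm
    have hxr : x ≠ r := by
      rintro rfl
      rcases hx with h | h
      · omega
      · exact lt_irrefl _ h
    have a2 : (addE G x i).Adj i u := Or.inl h1
    have a3 : ¬ (delE (addE G x i) i u).Adj u r := by
      rw [delE_adj, addE_adj]; have := G.adj_comm r u; grind
    have hval : ∀ T v, cnt (addE (delE (addE G x i) i u) u r) T v = _ := fun T v => by
      rw [cnt_addE h2 a3, cnt_delE a2, cnt_addE hne hxi]
    have := M.max (addE (delE (addE G x i) i u) u r) ⟨?_, ?_, ?_, ?_, ?_⟩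
    · rw [hval] at this
      simp [n2.symm, h2.symm, hxr.symm] at this
    · intro v
      have := M.st.le v
      rw [hval]
      simp only [Finset.mem_univ, and_true]
      grind
    · intro v hv hvr
      have := M.st.sat v hv hvr
      rw [hval]
      simp only [Finset.mem_univ, and_true]
      grind
    · intro a b ha hb
      have := M.st.ind_low a b ha hb
      simp only [addE_adj, delE_adj]
      grind
    · intro a b ha hb
      have := M.st.ind_high a b ha hb
      simp only [addE_adj, delE_adj]
      grind
    · intro v hv
      have := M.st.dom v hv
      rw [hval]
      simp only [mem_low]
      grind
  · have := M.max (addE G x i) ⟨?_, ?_, ?_, ?_, ?_⟩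
    · rw [cnt_addE hne hxi] at this
      simp [hne.symm] at this
    · intro v
      have := M.st.le v
      rw [cnt_addE hne hxi]
      simp only [Finset.mem_univ, and_true]
      grind
    · intro v hv hvr
      have := M.st.sat v hv hvr
      rw [cnt_addE hne hxi]
      simp only [Finset.mem_univ, and_true]
      grind
    · intro a b ha hb
      have := M.st.ind_low a b ha hb
      simp only [addE_adj]
      grind
    · intro a b ha hb
      have := M.st.ind_high a b ha hb
      simp only [addE_adj]
      grind
    · intro v hv
      have := M.st.dom v hv
      rw [cnt_addE hne hxi]
      simp only [mem_low]
      grind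

/-- A superfluous edge may be removed. -/
theorem MS.remove (M : MS d γ c r G) {a s : Fin n} (ha : a.val < γ) (hs : r < s)
    (has : G.Adj a s) (hc : c + 1 ≤ cnt G (low n γ) s) : MS d γ c r (delE G a s) := by
  have hr := M.le_r
  refine M.of_eq ⟨?_, ?_, ?_, ?_, ?_⟩ ?_
  · intro v
    have := M.st.le v
    rw [cnt_delE has]
    split_ifs <;> omega
  · intro v hv hvr
    have := M.st.sat v hv hvr
    rw [cnt_delE has]
    simp only [Finset.mem_univ, and_true]
    grind
  · intro x y hx hy h
    exact M.st.ind_low x y hx hy h.1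
  · intro x y hx hy h
    exact M.st.ind_high x y hx hy h.1
  · intro v hv
    have := M.st.dom v hv
    rw [cnt_delE has]
    simp only [mem_low]
    grind
  · rw [cnt_delE has]
    simp only [Finset.mem_univ, and_true]
    grind

/-- A vertex may be attached to another vertex of `[0, γ)`. -/
theorem MS.move (M : MS d γ c r G) {a b s : Fin n} (ha : a.val < γ) (hb : b.val < γ) (hs : r < s)
    (has : G.Adj a s) (hbs : ¬ G.Adj b s) (hbd : cnt G Finset.univ b < d b) :
    MS d γ c r (addE (delE G a s) b s) := by
  have hr := M.le_r
  have hbs' : b ≠ s := by rintro rfl; have := Fin.lt_def.1 hs; omega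
  have h2 : ¬ (delE G a s).Adj b s := fun h => hbs h.1
  refine M.of_eq ⟨?_, ?_, ?_, ?_, ?_⟩ ?_
  · intro v
    have := M.st.le v
    rw [cnt_addE hbs' h2, cnt_delE has]
    simp only [Finset.mem_univ, and_true]
    grind
  · intro v hv hvr
    have := M.st.sat v hv hvr
    rw [cnt_addE hbs' h2, cnt_delE has]
    simp only [Finset.mem_univ, and_true]
    grind
  · intro x y hx hy
    have := M.st.ind_low x y hx hy
    simp only [addE_adj, delE_adj]
    grind
  · intro x y hx hy
    have := M.st.ind_high x y hx hy
    simp only [addE_adj, delE_adj]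
    grind
  · intro v hv
    have := M.st.dom v hv
    rw [cnt_addE hbs' h2, cnt_delE has]
    simp only [mem_low]
    grind
  · rw [cnt_addE hbs' h2, cnt_delE has]
    simp only [Finset.mem_univ, and_true]
    grind

end Saturation

/-! ### The structure of a stuck stage -/

section Saturation

variable {n : ℕ} {d : Fin n → ℤ} {γ : ℕ} {c : ℤ} {r : Fin n} {G : SimpleGraph (Fin n)}

/-- Removing `iu` and adding `ur`, `ri` gives `r` two more edges. If only one is missing, parity
yields another unsaturated vertex `w`, and dropping `rw` corrects the excess, unless `w` is the last
dominator of `r`; then edges at `w` are exchanged instead. -/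
theorem MS.adj_r (M : MS d γ c r G) (hc : c ≤ 1) (heven : Even (∑ i, d i))
    (hlow : c = 1 → ∀ a : Fin n, a.val < γ → d a ≤ (Finset.univ \ low n γ).card)
    {i : Fin n} (hi : γ ≤ i.val) (hir : i < r) : G.Adj r i := by
  by_contra hri
  have hr := M.le_r
  have hlt := M.lt
  obtain ⟨u, h1, h2, h3, h4⟩ := M.exists_swap hi hir
  have n1 := h1.ne
  have n2 := hir.ne
  have h1' := h1.symm
  have hri' : ¬ G.Adj i r := fun h => hri h.symm
  have a2 : ¬ (delE G i u).Adj u r := fun h => h3 h.1.symm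
  have a3 : ¬ (addE (delE G i u) u r).Adj r i := by
    rw [addE_adj, delE_adj]; grind
  have hval : ∀ T v, cnt (addE (addE (delE G i u) u r) r i) T v = _ := fun T v => by
    rw [cnt_addE n2.symm a3, cnt_addE h2 a2, cnt_delE h1]
  by_cases hdef : cnt G Finset.univ r + 2 ≤ d r
  · have := M.max (addE (addE (delE G i u) u r) r i) ⟨?_, ?_, ?_, ?_, ?_⟩
    · rw [hval] at this
      simp [n2.symm, h2.symm] at this
    · intro v
      have := M.st.le v
      rw [hval]
      simp only [Finset.mem_univ, and_true]
      grind
    · intro v hv hvr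
      have := M.st.sat v hv hvr
      rw [hval]
      simp only [Finset.mem_univ, and_true]
      grind
    · intro a b ha hb
      have := M.st.ind_low a b ha hb
      simp only [addE_adj, delE_adj]
      grind
    · intro a b ha hb
      have := M.st.ind_high a b ha hb
      simp only [addE_adj, delE_adj]
      grind
    · intro v hv
      have := M.st.dom v hv
      rw [hval]
      simp only [mem_low]
      grind
  obtain ⟨w, hwr, hw⟩ : ∃ w, w ≠ r ∧ cnt G Finset.univ w < d w := by
    by_contra! hall
    have h3 : ∑ v, d v - ∑ v, cnt G Finset.univ v = 1 := by
      rw [← Finset.sum_sub_distrib, Finset.sum_eq_single r]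
      · omega
      · intro b _ hb
        linarith [hall b hb, M.st.le b]
      · simp
    have h4 := heven.sub (even_sum_cnt G)
    rw [h3] at h4
    exact absurd h4 (by decide)
  have hw' : w.val < γ ∨ r < w := by
    by_contra! h
    have := M.st.sat w h.1 (lt_of_le_of_ne h.2 hwr)
    omega
  have hwadj := M.adj_of_lt hw' hw hr le_rfl
  have hwi : w ≠ i := by
    rintro rfl
    exact hri' hwadj
  by_cases hcase : r < w ∨ c + 1 ≤ cnt G (low n γ) r
  · have a4 : (addE (addE (delE G i u) u r) r i).Adj r w := by
      simp only [addE_adj, delE_adj]; have := hwadj.symm; grind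
    have hval' : ∀ T v, cnt (delE (addE (addE (delE G i u) u r) r i) r w) T v = _ := fun T v => by
      rw [cnt_delE a4, hval]
    have := M.max (delE (addE (addE (delE G i u) u r) r i) r w) ⟨?_, ?_, ?_, ?_, ?_⟩
    · rw [hval'] at this
      simp [n2.symm, h2.symm, hwr.symm] at this
    · intro v
      have := M.st.le v
      rw [hval']
      simp only [Finset.mem_univ, and_true]
      grind
    · intro v hv hvr
      have := M.st.sat v hv hvr
      rw [hval']
      simp only [Finset.mem_univ, and_true]
      grind
    · intro a b ha hb
      have := M.st.ind_low a b ha hb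
      simp only [addE_adj, delE_adj]
      grind
    · intro a b ha hb
      have := M.st.ind_high a b ha hb
      simp only [addE_adj, delE_adj]
      grind
    · intro v hv
      have := M.st.dom v hv
      rw [hval']
      simp only [mem_low]
      grind
  -- Here `w` is the only neighbour of `r` below `γ`. Its degree is less than the number of vertices
  -- outside, so it misses some `z`, which has a dominator `w'`: add `wz`, remove `zw'`, add `w'r`.
  · rw [not_or, not_le] at hcase
    have hwγ : w.val < γ := hw'.resolve_right hcase.1
    have hpos : 0 < cnt G (low n γ) r := cnt_pos.2 ⟨w, by simpa using hwγ, hwadj.symm⟩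
    have hc1 : c = 1 := by omega
    have hle := hlow hc1 w hwγ
    have hcntU := cnt_le_of_subset G (Finset.subset_univ (Finset.univ \ low n γ)) w
    obtain ⟨z, hz, hwz⟩ := exists_not_adj_of_cnt_lt_card (G := G) (T := Finset.univ \ low n γ)
      (v := w) (by omega)
    have hzγ : γ ≤ z.val := by simpa using hz
    obtain ⟨w', hw'γ, hzw'⟩ : ∃ y ∈ low n γ, G.Adj z y := by
      apply cnt_pos.1
      have := M.st.dom z hzγ
      omega
    rw [mem_low] at hw'γ
    have hww : w' ≠ w := by rintro rfl; exact hwz hzw'.symm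
    have hrw' : ¬ G.Adj w' r := by
      intro h
      exact hww (eq_of_cnt_le_one (G := G) (T := low n γ) (v := r) (by omega)
        (by simpa using hw'γ) (by simpa using hwγ) h.symm hwadj.symm)
    have hzr : z ≠ r := by rintro rfl; exact hwz hwadj
    have hwz' : w ≠ z := by rintro rfl; omega
    have hrw'' : w' ≠ r := by rintro rfl; omega
    have b2 : (addE G w z).Adj z w' := Or.inl hzw'
    have b3 : ¬ (delE (addE G w z) z w').Adj w' r := by
      rw [delE_adj, addE_adj]; grind
    have hval' : ∀ T v, cnt (addE (delE (addE G w z) z w') w' r) T v = _ := fun T v => by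
      rw [cnt_addE hrw'' b3, cnt_delE b2, cnt_addE hwz' hwz]
    have := M.max (addE (delE (addE G w z) z w') w' r) ⟨?_, ?_, ?_, ?_, ?_⟩
    · rw [hval'] at this
      simp [hwr.symm, hzr.symm, hrw''.symm] at this
    · intro v
      have := M.st.le v
      rw [hval']
      simp only [Finset.mem_univ, and_true]
      grind
    · intro v hv hvr
      have := M.st.sat v hv hvr
      rw [hval']
      simp only [Finset.mem_univ, and_true]
      grind
    · intro a b ha hb
      have := M.st.ind_low a b ha hb
      simp only [addE_adj, delE_adj]
      grind
    · intro a b ha hb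
      have := M.st.ind_high a b ha hb
      simp only [addE_adj, delE_adj]
      grind
    · intro v hv
      have := M.st.dom v hv
      rw [hval']
      simp only [mem_low]
      grind

/-- The interval `[γ, r]` is a clique. -/
theorem MS.clique (M : MS d γ c r G) (hA : ∀ i : Fin n, γ ≤ i.val → i < r → G.Adj r i)
    {i j : Fin n} (hi : γ ≤ i.val) (hir : i < r) (hj : γ ≤ j.val) (hjr : j < r) (hij : i ≠ j) :
    G.Adj i j := by
  by_contra hadj
  have hr := M.le_r
  have hlt := M.lt
  obtain ⟨u, h1, h2, h3, h4⟩ := M.exists_swap hi hir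
  obtain ⟨w, k1, k2, k3, k4⟩ := M.exists_swap hj hjr
  have n1 := h1.ne
  have n2 := hir.ne
  have n3 := k1.ne
  have n4 := hjr.ne
  have h1' := h1.symm
  have k1' := k1.symm
  have hadj' : ¬ G.Adj j i := fun h => hadj h.symm
  have hu := hA u
  have hw := hA w
  -- Remove `iu` and `jw`, add `ij` and `ur`. As `u` and `w` are not adjacent to `r`, they lie
  -- outside `[γ, r]` and need not stay saturated.
  have ha2 : (delE G i u).Adj j w := by rw [delE_adj]; grind
  have ha3 : ¬ (delE (delE G i u) j w).Adj i j := fun h => hadj h.1.1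
  have ha4 : ¬ (addE (delE (delE G i u) j w) i j).Adj u r := by
    simp only [addE_adj, delE_adj]; have := G.adj_comm r u; grind
  have hval : ∀ T v, cnt (addE (addE (delE (delE G i u) j w) i j) u r) T v = _ := fun T v => by
    rw [cnt_addE h2 ha4, cnt_addE hij ha3, cnt_delE ha2, cnt_delE h1]
  have := M.max (addE (addE (delE (delE G i u) j w) i j) u r) ⟨?_, ?_, ?_, ?_, ?_⟩
  · rw [hval] at this
    simp [n2.symm, h2.symm, n4.symm, k2.symm] at this
  · intro v
    have := M.st.le v
    rw [hval]
    simp only [Finset.mem_univ, and_true]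
    grind
  · intro v hv hvr
    have := M.st.sat v hv hvr
    rw [hval]
    simp only [Finset.mem_univ, and_true]
    grind
  · intro a b ha hb
    have := M.st.ind_low a b ha hb
    simp only [addE_adj, delE_adj]
    grind
  · intro a b ha hb
    have := M.st.ind_high a b ha hb
    simp only [addE_adj, delE_adj]
    grind
  · intro v hv
    have := M.st.dom v hv
    rw [hval]
    simp only [mem_low]
    grind

/-- A vertex that misses some of `[γ, r]` is saturated by `MS.adj_of_lt`. It has exactly `c`
neighbours below `γ`, since dropping a superfluous one would leave it unsaturated. -/
theorem MS.cnt_high (M : MS d γ c r G) (hc : 0 ≤ c) {s : Fin n} (hs : r < s) :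
    cnt G (mid γ r) s = min ((mid γ r).card : ℤ) (d s - c) := by
  have hr := M.le_r
  have hsγ : γ ≤ s.val := by have := Fin.lt_def.1 hs; omega
  have h1 := cnt_univ_eq G hr s
  have h2 : cnt G (high r) s = 0 :=
    cnt_eq_zero fun y hy => M.st.ind_high s y hs (by simpa using hy)
  have h3 := M.st.le s
  have h4 := M.st.dom s hsγ
  have h5 := cnt_le_card G (mid γ r) s
  by_cases hall : ∀ i ∈ mid γ r, G.Adj s i
  · have h6 : cnt G (mid γ r) s = (mid γ r).card := by
      by_contra hne
      obtain ⟨y, hy, hy'⟩ := exists_not_adj_of_cnt_lt_card (lt_of_le_of_ne h5 hne)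
      exact hy' (hall y hy)
    omega
  · push Not at hall
    obtain ⟨i, hi, hsi⟩ := hall
    rw [mem_mid] at hi
    have h6 : cnt G Finset.univ s = d s := by
      by_contra hne
      exact hsi (M.adj_of_lt (Or.inr hs) (lt_of_le_of_ne h3 hne) hi.1 hi.2)
    have h7 : cnt G (low n γ) s ≤ c := by
      by_contra hgt
      obtain ⟨a, ha, hsa⟩ := cnt_pos.1 (show 0 < cnt G (low n γ) s by omega)
      rw [mem_low] at ha
      have M' := M.remove ha hs hsa.symm (by omega)
      refine hsi (M'.adj_of_lt (Or.inr hs) ?_ hi.1 hi.2).1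
      rw [cnt_delE hsa.symm]
      have := hsa.ne
      simp [this]
      omega
    omega

/-- A vertex `a` that falls short of the minimum is saturated and has a neighbour `s` beyond `r`.
Any slack among the edges between `[0, γ)` and `(r, n)` could be shifted to `a`, making it
unsaturated against `MS.adj_of_lt`. -/
theorem MS.cnt_low (M : MS d γ c r G) (hc : c = 0 ∨ c = 1) :
    (∀ a : Fin n, a.val < γ → cnt G (mid γ r) a = min ((mid γ r).card : ℤ) (d a)) ∨
      (c = 1 ∧ (∀ a : Fin n, a.val < γ → cnt G Finset.univ a = d a) ∧
        ∀ s, r < s → cnt G (low n γ) s = c) := by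
  have hr := M.le_r
  by_contra! hcon
  obtain ⟨⟨a, ha, hne⟩, h2⟩ := hcon
  have h1 := cnt_univ_eq G hr a
  have h3 : cnt G (low n γ) a = 0 :=
    cnt_eq_zero fun y hy => M.st.ind_low a y ha (by simpa using hy)
  have h4 := M.st.le a
  have h5 := cnt_le_card G (mid γ r) a
  have h6 := cnt_nonneg G (high r) a
  obtain ⟨i, hi, hai⟩ : ∃ i ∈ mid γ r, ¬ G.Adj a i :=
    exists_not_adj_of_cnt_lt_card (lt_of_le_of_ne h5 fun h => hne (by omega))
  rw [mem_mid] at hi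
  have h7 : cnt G Finset.univ a = d a := by
    by_contra hne'
    exact hai (M.adj_of_lt (Or.inl ha) (lt_of_le_of_ne h4 hne') hi.1 hi.2)
  obtain ⟨s, hs, has⟩ : ∃ s ∈ high r, G.Adj a s := by
    apply cnt_pos.1
    omega
  rw [mem_high] at hs
  have remove : ∀ s, r < s → G.Adj a s → cnt G (low n γ) s ≤ c := by
    intro s hs has
    by_contra hgt
    have M' := M.remove ha hs has (by omega)
    refine hai (M'.adj_of_lt (Or.inl ha) ?_ hi.1 hi.2).1
    rw [cnt_delE has]
    simp [has.ne]
    omega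
  have hsc := remove s hs has
  have hpos : 0 < cnt G (low n γ) s := cnt_pos.2 ⟨a, by simpa using ha, has.symm⟩
  have hc1 : c = 1 := by omega
  have hother : ∀ b : Fin n, b.val < γ → b ≠ a → ¬ G.Adj b s := fun b hb hba h =>
    hba (eq_of_cnt_le_one (G := G) (T := low n γ) (v := s) (by omega) (by simpa using hb)
      (by simpa using ha) h.symm has.symm)
  have has' := has.ne
  -- Moving `s` from `a` to an unsaturated `b` would free `a`.
  have hsat : ∀ b : Fin n, b.val < γ → cnt G Finset.univ b = d b := by
    intro b hb
    by_contra hbd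
    have hba : b ≠ a := by rintro rfl; exact hbd h7
    have M' := M.move ha hb hs has (hother b hb hba) (lt_of_le_of_ne (M.st.le b) hbd)
    have h8 := M'.adj_of_lt (x := a) (Or.inl ha) ?_ hi.1 hi.2
    · simp only [addE_adj, delE_adj] at h8
      grind
    · have hbs : b ≠ s := by rintro rfl; have := Fin.lt_def.1 hs; omega
      have hbs2 : ¬ (delE G a s).Adj b s := fun h => hother b hb hba h.1
      rw [cnt_addE hbs hbs2, cnt_delE has]
      simp [has', hba.symm]
      omega
  -- If `t` has a superfluous neighbour `b`, dropping `bt` makes room at `b` for `s`, and `a` is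
  -- freed again.
  obtain ⟨t, ht, htc⟩ := h2 hc1 hsat
  have htγ : γ ≤ t.val := by have := Fin.lt_def.1 ht; omega
  have h9 := M.st.dom t htγ
  have hta : ¬ G.Adj a t := fun h => htc (le_antisymm (remove t ht h) h9)
  obtain ⟨b, hb, htb⟩ := cnt_pos.1 (show 0 < cnt G (low n γ) t by omega)
  rw [mem_low] at hb
  have hba : b ≠ a := by rintro rfl; exact hta htb.symm
  have hbs := hother b hb hba
  have M' := M.remove hb ht htb.symm (by omega)
  have hst : s ≠ t := by rintro rfl; exact hta has
  have hbs' : b ≠ s := by rintro rfl; have := Fin.lt_def.1 hs; omega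
  have hbt : b ≠ t := htb.ne.symm
  have has2 : (delE G b t).Adj a s := by rw [delE_adj]; grind
  have hbs2 : ¬ (delE G b t).Adj b s := fun h => hbs h.1
  have M'' := M'.move ha hb hs has2 hbs2 (by
    rw [cnt_delE htb.symm]
    simp [hbt]
    have := hsat b hb
    omega)
  have hat : a ≠ t := by rintro rfl; omega
  have h8 := M''.adj_of_lt (x := a) (Or.inl ha) ?_ hi.1 hi.2
  · simp only [addE_adj, delE_adj] at h8
    grind
  · have hbs3 : ¬ (delE (delE G b t) a s).Adj b s := fun h => hbs2 h.1
    rw [cnt_addE hbs' hbs3, cnt_delE has2, cnt_delE htb.symm]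
    simp [has', hba.symm, hat]
    omega

/-- The two systems of inequalities exclude a maximal unsaturated graph. -/
theorem MS.false_of_le (M : MS d γ c r G) (hc : c = 0 ∨ c = 1) (heven : Even (∑ i, d i))
    (hlow : c = 1 → ∀ a : Fin n, a.val < γ → d a ≤ (Finset.univ \ low n γ).card)
    (hA : c = 1 → ∑ i ∈ mid γ r, (d i - 1) ≤ ((mid γ r).card : ℤ) * ((mid γ r).card - 1)
      - ((mid γ r).card + (high r).card) + ∑ i ∈ low n γ, d i
      + ∑ i ∈ high r, min ((mid γ r).card : ℤ) (d i - 1))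
    (hC : ∑ i ∈ mid γ r, d i ≤ ((mid γ r).card : ℤ) * ((mid γ r).card - 1)
      + ∑ i ∈ low n γ, min ((mid γ r).card : ℤ) (d i)
      + ∑ i ∈ high r, min ((mid γ r).card : ℤ) (d i - c)) : False := by
  have hr := M.le_r
  have hadj := fun i hi hir => M.adj_r (by omega) heven hlow (i := i) hi hir
  have hclique : ∀ i ∈ mid γ r, ((mid γ r).card : ℤ) - 1 ≤ cnt G (mid γ r) i := by
    intro i hi
    have hsub : ∀ j ∈ (mid γ r).erase i, G.Adj i j := by
      intro j hj
      rw [Finset.mem_erase, mem_mid] at hj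
      rw [mem_mid] at hi
      rcases hi.2.lt_or_eq with h1 | rfl
      · rcases hj.2.2.lt_or_eq with h2 | rfl
        · exact M.clique hadj hi.1 h1 hj.2.1 h2 hj.1.symm
        · exact (hadj i hi.1 h1).symm
      · exact hadj j hj.2.1 (lt_of_le_of_ne hj.2.2 hj.1)
    have h1 := cnt_le_of_subset G (Finset.erase_subset i (mid γ r)) i
    have h2 : cnt G ((mid γ r).erase i) i = ((mid γ r).erase i).card := by
      by_contra hne
      obtain ⟨y, hy, hy'⟩ := exists_not_adj_of_cnt_lt_card
        (lt_of_le_of_ne (cnt_le_card G ((mid γ r).erase i) i) hne)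
      exact hy' (hsub y hy)
    rw [Finset.card_erase_of_mem hi] at h2
    have : 0 < (mid γ r).card := Finset.card_pos.2 ⟨i, hi⟩
    omega
  have hsum : ∑ i ∈ mid γ r, cnt G Finset.univ i < ∑ i ∈ mid γ r, d i :=
    Finset.sum_lt_sum (fun i _ => M.st.le i) ⟨r, by simp [hr], M.lt⟩
  have hsplit : ∑ i ∈ mid γ r, cnt G Finset.univ i = ∑ i ∈ mid γ r, cnt G (low n γ) i
      + ∑ i ∈ mid γ r, cnt G (mid γ r) i + ∑ i ∈ mid γ r, cnt G (high r) i := by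
    rw [← Finset.sum_add_distrib, ← Finset.sum_add_distrib]
    exact Finset.sum_congr rfl fun i _ => cnt_univ_eq G hr i
  have hmid : ((mid γ r).card : ℤ) * ((mid γ r).card - 1) ≤ ∑ i ∈ mid γ r, cnt G (mid γ r) i := by
    have := Finset.card_nsmul_le_sum _ _ _ hclique
    rwa [nsmul_eq_mul] at this
  have hhigh : ∑ i ∈ mid γ r, cnt G (high r) i =
      ∑ i ∈ high r, min ((mid γ r).card : ℤ) (d i - c) := by
    rw [sum_cnt_comm]
    exact Finset.sum_congr rfl fun s hs => M.cnt_high (by omega) (by simpa using hs)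
  -- All contributions to the degree sum of the block are now known. The first alternative
  -- contradicts `hC`, the second `hA`.
  rcases M.cnt_low hc with h | ⟨rfl, h1, h2⟩
  · have hl : ∑ i ∈ mid γ r, cnt G (low n γ) i =
        ∑ i ∈ low n γ, min ((mid γ r).card : ℤ) (d i) := by
      rw [sum_cnt_comm]
      exact Finset.sum_congr rfl fun s hs => h s (by simpa using hs)
    linarith
  · have hA := hA rfl
    have hl : ∑ i ∈ low n γ, d i = ∑ i ∈ mid γ r, cnt G (low n γ) i + (high r).card := by
      have e1 : ∑ i ∈ low n γ, d i = ∑ i ∈ low n γ, (cnt G (mid γ r) i + cnt G (high r) i) := by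
        refine Finset.sum_congr rfl fun a ha => ?_
        rw [mem_low] at ha
        have h3 : cnt G (low n γ) a = 0 :=
          cnt_eq_zero fun y hy => M.st.ind_low a y ha (by simpa using hy)
        rw [← h1 a ha, cnt_univ_eq G hr a, h3, zero_add]
      have e2 : ∑ i ∈ high r, cnt G (low n γ) i = (high r).card := by
        rw [Finset.sum_congr rfl fun s hs => h2 s (by simpa using hs)]
        simp
      rw [e1, Finset.sum_add_distrib, sum_cnt_comm _ (low n γ) (mid γ r),
        sum_cnt_comm _ (low n γ) (high r), e2]
    rw [Finset.sum_sub_distrib] at hA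
    simp only [Finset.sum_const, nsmul_eq_mul, mul_one] at hA
    linarith

end Saturation

/-! ### Existence of valid graphs -/

section Existence

variable {n : ℕ} {d : Fin n → ℤ} {γ : ℕ} {c : ℤ}

/-- Each stage takes a graph that maximizes the degree of the next vertex, and `MS.false_of_le`
shows this vertex to be saturated. The parameter `c` is `1` for domination, and `0` with `γ = 0` for
Erdős–Gallai. -/
theorem exists_saturated (hc : c = 0 ∨ c = 1) (heven : Even (∑ i, d i))
    (hanti : ∀ i j : Fin n, γ ≤ i.val → i ≤ j → d j ≤ d i)
    (hlow : c = 1 → ∀ a : Fin n, a.val < γ → d a ≤ (Finset.univ \ low n γ).card)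
    (hA : c = 1 → ∀ r : Fin n, γ ≤ r.val →
      ∑ i ∈ mid γ r, (d i - 1) ≤ ((mid γ r).card : ℤ) * ((mid γ r).card - 1)
        - ((mid γ r).card + (high r).card) + ∑ i ∈ low n γ, d i
        + ∑ i ∈ high r, min ((mid γ r).card : ℤ) (d i - 1))
    (hC : ∀ r : Fin n, γ ≤ r.val →
      ∑ i ∈ mid γ r, d i ≤ ((mid γ r).card : ℤ) * ((mid γ r).card - 1)
        + ∑ i ∈ low n γ, min ((mid γ r).card : ℤ) (d i)
        + ∑ i ∈ high r, min ((mid γ r).card : ℤ) (d i - c))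
    {G₀ : SimpleGraph (Fin n)} (hle : ∀ v, cnt G₀ Finset.univ v ≤ d v)
    (hind_low : ∀ a b : Fin n, a.val < γ → b.val < γ → ¬ G₀.Adj a b)
    (hind_high : ∀ a b : Fin n, γ ≤ a.val → γ ≤ b.val → ¬ G₀.Adj a b)
    (hdom : ∀ v : Fin n, γ ≤ v.val → c ≤ cnt G₀ (low n γ) v) :
    ∃ G : SimpleGraph (Fin n), (∀ v, cnt G Finset.univ v ≤ d v) ∧
      (∀ v : Fin n, γ ≤ v.val → cnt G Finset.univ v = d v) ∧
      ∀ v : Fin n, γ ≤ v.val → c ≤ cnt G (low n γ) v := by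
  have key : ∀ m, γ ≤ m → ∃ G : SimpleGraph (Fin n), (∀ v, cnt G Finset.univ v ≤ d v) ∧
      (∀ v : Fin n, γ ≤ v.val → v.val < m → cnt G Finset.univ v = d v) ∧
      (∀ a b : Fin n, a.val < γ → b.val < γ → ¬ G.Adj a b) ∧
      (∀ a b : Fin n, m ≤ a.val → m ≤ b.val → ¬ G.Adj a b) ∧
      ∀ v : Fin n, γ ≤ v.val → c ≤ cnt G (low n γ) v := by
    intro m hm
    induction m, hm using Nat.le_induction with
    | base => exact ⟨G₀, hle, fun v h1 h2 => absurd h2 (not_lt.2 h1), hind_low, hind_high, hdom⟩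
    | succ m hm ih =>
      obtain ⟨G₁, h1, h2, h3, h4, h5⟩ := ih
      by_cases hmn : m < n
      · have hst : St d γ c ⟨m, hmn⟩ G₁ :=
          ⟨h1, fun i hi hir => h2 i hi hir, h3, fun a b ha hb => h4 a b ha.le hb.le, h5⟩
        obtain ⟨G, hG, hmax⟩ := (Set.toFinite {G | St d γ c ⟨m, hmn⟩ G}).exists_maximalFor
          (fun G => cnt G Finset.univ ⟨m, hmn⟩) _ ⟨G₁, hst⟩
        have hG : St d γ c ⟨m, hmn⟩ G := hG
        have hsat : cnt G Finset.univ ⟨m, hmn⟩ = d ⟨m, hmn⟩ := by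
          by_contra hne
          have M : MS d γ c ⟨m, hmn⟩ G := ⟨hG, hanti, hm, lt_of_le_of_ne (hG.le _) hne,
            fun G' hG' => by
              by_contra hlt
              exact hlt (hmax hG' (not_le.1 hlt).le)⟩
          exact M.false_of_le hc heven hlow (fun h => hA h _ hm) (hC _ hm)
        refine ⟨G, hG.le, fun v hv hvm => ?_, hG.ind_low, fun a b ha hb => ?_, hG.dom⟩
        · rcases (Nat.lt_succ_iff.1 hvm).lt_or_eq with h | h
          · exact hG.sat v hv h
          · have hv' : v = ⟨m, hmn⟩ := Fin.ext h
            rw [hv']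
            exact hsat
        · exact hG.ind_high a b (Fin.lt_def.2 ha) (Fin.lt_def.2 hb)
      · exact ⟨G₁, h1, fun v h6 h7 => h2 v h6 (by omega), h3, fun a b ha hb =>
          h4 a b (by omega) (by omega), h5⟩
  obtain ⟨G, h1, h2, -, -, h5⟩ := key (max γ n) (le_max_left _ _)
  exact ⟨G, h1, fun v hv => h2 v hv (lt_of_lt_of_le v.2 (le_max_right _ _)), h5⟩

theorem card_low (h : γ ≤ n) : (low n γ).card = γ := by
  unfold low
  rw [Fin.card_filter_val_lt, min_eq_right h]

theorem card_sdiff_low (h : γ ≤ n) : (Finset.univ \ low n γ).card = n - γ := by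
  rw [Finset.card_sdiff_of_subset (Finset.subset_univ _), card_low h]
  simp

theorem mid_eq {r : Fin n} : mid γ r = low n (r.val + 1) \ low n γ := by
  ext i
  simp only [mem_mid, Finset.mem_sdiff, mem_low, Fin.le_def]
  omega

theorem card_mid {r : Fin n} (h : γ ≤ r.val) : (mid γ r).card = r.val + 1 - γ := by
  have h1 : low n γ ⊆ low n (r.val + 1) := by
    intro i
    simp only [mem_low]
    omega
  rw [mid_eq, Finset.card_sdiff_of_subset h1, card_low, card_low]
  · have := r.2; omega
  · have := r.2; omega

theorem card_high {r : Fin n} : (high r).card = n - (r.val + 1) := by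
  have h1 : high r = Finset.univ \ low n (r.val + 1) := by
    ext i
    simp only [mem_high, Finset.mem_sdiff, Finset.mem_univ, true_and, mem_low, Fin.lt_def]
    omega
  rw [h1, card_sdiff_low]
  exact r.2

/-- Disjoint stars centred at the vertices `i < γ` which cover the other vertices. -/
theorem exists_star_forest (hγ : γ ≤ n) (hd : ∀ i, 1 ≤ d i)
    (hsum : (n : ℤ) - γ ≤ ∑ i ∈ low n γ, d i) :
    ∃ G : SimpleGraph (Fin n), (∀ v, cnt G Finset.univ v ≤ d v) ∧
      (∀ a b : Fin n, a.val < γ → b.val < γ → ¬ G.Adj a b) ∧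
      (∀ a b : Fin n, γ ≤ a.val → γ ≤ b.val → ¬ G.Adj a b) ∧
      ∀ v : Fin n, γ ≤ v.val → 1 ≤ cnt G (low n γ) v := by
  classical
  -- Each centre offers as many slots as its degree allows, and the remaining vertices are embedded
  -- into the slots.
  let T : Finset (Σ _ : Fin n, ℕ) := (low n γ).sigma fun a => Finset.range (d a).toNat
  have hcard : Fintype.card ↥(Finset.univ \ low n γ) ≤ Fintype.card ↥T := by
    rw [Fintype.card_coe, Fintype.card_coe, card_sdiff_low hγ, Finset.card_sigma]
    zify
    simp only [Finset.card_range]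
    rw [Nat.cast_sub hγ, Finset.sum_congr rfl fun i _ => Int.toNat_of_nonneg
      (show 0 ≤ d i by linarith [hd i])]
    exact hsum
  obtain ⟨e⟩ := Function.Embedding.nonempty_of_card_le hcard
  let f : Fin n → Fin n := fun x => if h : x ∈ Finset.univ \ low n γ then (e ⟨x, h⟩).1.1 else x
  have hf : ∀ x, γ ≤ x.val → (f x).val < γ := by
    intro x hx
    have hx' : x ∈ Finset.univ \ low n γ := by simpa using hx
    have h2 := (Finset.mem_sigma.1 (e ⟨x, hx'⟩).2).1
    rw [mem_low] at h2
    simpa only [f, dif_pos hx'] using h2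
  let G : SimpleGraph (Fin n) := SimpleGraph.fromRel fun x y => γ ≤ x.val ∧ f x = y
  have hadj : ∀ x y, G.Adj x y ↔ (γ ≤ x.val ∧ f x = y) ∨ (γ ≤ y.val ∧ f y = x) := by
    intro x y
    simp only [G, SimpleGraph.fromRel_adj]
    refine ⟨fun h => h.2, fun h => ⟨?_, h⟩⟩
    rintro rfl
    rcases h with h | h
    · have := hf x h.1; rw [h.2] at this; omega
    · have := hf x h.1; rw [h.2] at this; omega
  refine ⟨G, fun v => ?_, fun a b ha hb h => ?_, fun a b ha hb h => ?_, fun v hv => ?_⟩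
  · by_cases hv : γ ≤ v.val
    · refine le_trans ?_ (hd v)
      have h1 : cnt G Finset.univ v ≤ cnt G {f v} v := by
        refine cnt_le_of_forall fun y _ hy => ?_
        rw [hadj] at hy
        rw [Finset.mem_singleton]
        rcases hy with h | h
        · exact h.2.symm
        · have := hf y h.1; rw [h.2] at this; omega
      exact h1.trans (by simpa using cnt_le_card G {f v} v)
    · rw [cnt_eq_card]
      have hdv := hd v
      suffices h : (Finset.univ.filter (G.Adj v)).card ≤ (Finset.range (d v).toNat).card by
        rw [Finset.card_range] at h
        omega
      refine Finset.card_le_card_of_injOn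
        (fun y => if h : y ∈ Finset.univ \ low n γ then (e ⟨y, h⟩).1.2 else 0) ?_ ?_
      · intro y hy
        simp only [Finset.coe_filter, Finset.mem_univ, true_and, Set.mem_ofPred_eq, hadj] at hy
        have hy' : γ ≤ y.val ∧ f y = v := hy.resolve_left fun h => hv h.1
        have hyU : y ∈ Finset.univ \ low n γ := by simpa using hy'.1
        have h2 := (Finset.mem_sigma.1 (e ⟨y, hyU⟩).2).2
        have h3 := hy'.2
        simp only [f, dif_pos hyU] at h3
        rw [h3] at h2
        simpa only [dif_pos hyU, Finset.mem_coe] using h2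
      · intro y hy z hz hyz
        simp only [Finset.coe_filter, Finset.mem_univ, true_and, Set.mem_ofPred_eq, hadj] at hy hz
        have hy' : γ ≤ y.val ∧ f y = v := hy.resolve_left fun h => hv h.1
        have hz' : γ ≤ z.val ∧ f z = v := hz.resolve_left fun h => hv h.1
        have hyU : y ∈ Finset.univ \ low n γ := by simpa using hy'.1
        have hzU : z ∈ Finset.univ \ low n γ := by simpa using hz'.1
        have h3 := hy'.2.trans hz'.2.symm
        simp only [f, dif_pos hyU, dif_pos hzU] at h3
        simp only [dif_pos hyU, dif_pos hzU] at hyz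
        have h4 : e ⟨y, hyU⟩ = e ⟨z, hzU⟩ := by
          apply Subtype.ext
          exact Sigma.ext h3 (heq_of_eq hyz)
        exact congrArg Subtype.val (e.injective h4)
  · rcases (hadj a b).1 h with h | h <;> omega
  · rcases (hadj a b).1 h with h | h
    · have := hf a h.1; rw [h.2] at this; omega
    · have := hf b h.1; rw [h.2] at this; omega
  · have : 0 < cnt G (low n γ) v :=
      cnt_pos.2 ⟨f v, by simpa using hf v hv, (hadj _ _).2 (Or.inl ⟨hv, rfl⟩)⟩
    omega

end Existence

/-! ### Sufficiency of the inequalities -/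

section Sufficiency

variable {n : ℕ}

/-- The inequality on the sum of the `k` largest degrees outside `[0, γ)`, less one each. -/
def SysA (d : Fin n → ℕ) (γ k : ℕ) : Prop :=
  ∑ i : Fin n with γ ≤ i.val ∧ i.val < γ + k, ((d i : ℤ) - 1) ≤
    (k : ℤ) * ((k : ℤ) - 1) - ((n : ℤ) - (γ : ℤ))
      + ∑ i : Fin n with i.val < γ, (d i : ℤ)
      + ∑ i : Fin n with γ + k ≤ i.val, min (k : ℤ) ((d i : ℤ) - 1)

/-- The Erdős–Gallai inequality. -/
def SysB (d : Fin n → ℕ) (k : ℕ) : Prop :=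
  ∑ i : Fin n with i.val < k, (d i : ℤ) ≤
    (k : ℤ) * ((k : ℤ) - 1) + ∑ i : Fin n with k ≤ i.val, min (k : ℤ) (d i : ℤ)

/-- The inequality on the sum of the `k` largest degrees outside `[0, γ)`. -/
def SysC (d : Fin n → ℕ) (γ k : ℕ) : Prop :=
  ∑ i : Fin n with γ ≤ i.val ∧ i.val < γ + k, (d i : ℤ) ≤
    (k : ℤ) * ((k : ℤ) - 1)
      + ∑ i : Fin n with i.val < γ, min (k : ℤ) (d i : ℤ)
      + ∑ i : Fin n with γ + k ≤ i.val, min (k : ℤ) ((d i : ℤ) - 1)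

/-- Some realization of `d` has a dominating set of size `γ`. -/
def HasDom (d : Fin n → ℕ) (γ : ℕ) : Prop :=
  ∃ G : SimpleGraph (Fin n), Realizes G d ∧
    ∃ D : Finset (Fin n), IsDominatingSet G D ∧ D.card = γ

theorem ncard_neighborSet (G : SimpleGraph (Fin n)) (i : Fin n) :
    ((G.neighborSet i).ncard : ℤ) = cnt G Finset.univ i := by
  classical
  rw [cnt_eq_card, Set.ncard_eq_toFinset_card']
  congr 2
  ext y
  simp

theorem realizes_iff {G : SimpleGraph (Fin n)} {d : Fin n → ℕ} :
    Realizes G d ↔ ∀ v, cnt G Finset.univ v = d v := by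
  refine forall_congr' fun v => ?_
  rw [← ncard_neighborSet]
  exact Nat.cast_inj.symm

theorem low_eq (γ : ℕ) : (Finset.univ.filter fun i : Fin n => i.val < γ) = low n γ := rfl

theorem mid_eq_filter {γ k : ℕ} {r : Fin n} (h : r.val + 1 = γ + k) :
    (Finset.univ.filter fun i : Fin n => γ ≤ i.val ∧ i.val < γ + k) = mid γ r := by
  ext i
  simp only [Finset.mem_filter, Finset.mem_univ, true_and, mem_mid, Fin.le_def]
  omega

theorem high_eq_filter {m : ℕ} {r : Fin n} (h : r.val + 1 = m) :
    (Finset.univ.filter fun i : Fin n => m ≤ i.val) = high r := by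
  ext i
  simp only [Finset.mem_filter, Finset.mem_univ, true_and, mem_high, Fin.lt_def]
  omega

/-- The Erdős–Gallai theorem: sufficiency of the inequalities. -/
theorem isGraphic_of_sysB {d : Fin n → ℕ} (hd : Antitone d) (heven : Even (∑ i, d i))
    (hB : ∀ k ≤ n, SysB d k) : IsGraphic d := by
  have heven' : Even (∑ i, (d i : ℤ)) := by exact_mod_cast heven
  have h0 : ∀ v, cnt (⊥ : SimpleGraph (Fin n)) Finset.univ v = 0 := fun v =>
    cnt_eq_zero fun y _ => by simp
  obtain ⟨G, -, hG, -⟩ := exists_saturated (n := n) (d := fun i => (d i : ℤ)) (γ := 0) (c := 0)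
    (G₀ := ⊥) (Or.inl rfl) heven' (fun i j _ hij => by exact_mod_cast hd hij) (by simp) (by simp)
    (fun r _ => by
      have h := hB (r.val + 1) r.2
      unfold SysB at h
      have e1 : (Finset.univ.filter fun i : Fin n => i.val < r.val + 1) = mid 0 r := by
        ext i
        simp only [Finset.mem_filter, Finset.mem_univ, true_and, mem_mid, Fin.le_def]
        omega
      rw [e1, high_eq_filter rfl] at h
      have e2 : (mid 0 r).card = r.val + 1 := by rw [card_mid (Nat.zero_le _)]; rfl
      have e3 : low n 0 = ∅ := by ext; simp
      rw [e2, e3]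
      simpa using h)
    (fun v => by rw [h0]; positivity) (by simp) (by simp) (fun v _ => cnt_nonneg _ _ _)
  exact ⟨G, realizes_iff.2 fun v => hG v (Nat.zero_le _)⟩

/-- A vertex of large degree yields a small dominating set. -/
theorem hasDom_of_degree_ge {d : Fin n → ℕ} {γ : ℕ} (hγ : γ ≤ n) (hG : IsGraphic d) {w : Fin n}
    (hw : n - γ ≤ d w) : HasDom d γ := by
  classical
  obtain ⟨G, hG⟩ := hG
  have h1 : (Finset.univ.filter (G.Adj w)).card = d w := by
    have := realizes_iff.1 hG w
    rw [cnt_eq_card] at this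
    exact_mod_cast this
  -- The non-neighbours of `w`, with `w` among them, number at most `γ`, and `w` dominates all other
  -- vertices.
  obtain ⟨D, hD, hcard⟩ := Finset.exists_superset_card_eq
    (s := Finset.univ \ Finset.univ.filter (G.Adj w)) (n := γ)
    (by
      rw [Finset.card_sdiff_of_subset (Finset.subset_univ _), h1, Finset.card_univ,
        Fintype.card_fin]
      omega) (by simpa using hγ)
  refine ⟨G, hG, D, fun v hv => ⟨w, hD (by simp), ?_⟩, hcard⟩
  by_contra h
  exact hv (hD (by simp [h]))

/-- The star forest is saturated to a valid graph, which is merged with a given realization. A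
degree of at least `n - γ` is treated apart because `MS.adj_r` needs every centre to have room
outside. -/
theorem hasDom_of_sys {d : Fin n → ℕ} (hd : Antitone d) (hpos : ∀ i, 0 < d i) {γ : ℕ}
    (hγ : γ ≤ n) (hG : IsGraphic d) (hA : ∀ k ≤ n - γ, SysA d γ k) (hC : ∀ k ≤ n - γ, SysC d γ k) :
    HasDom d γ := by
  by_cases hbig : ∃ w, n - γ ≤ d w
  · obtain ⟨w, hw⟩ := hbig
    exact hasDom_of_degree_ge hγ hG hw
  push Not at hbig
  obtain ⟨G, hG⟩ := hG
  rw [realizes_iff] at hG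
  have heven : Even (∑ i, (d i : ℤ)) := by
    rw [← Finset.sum_congr rfl fun i _ => hG i]
    exact even_sum_cnt G
  have hpos' : ∀ i, (1 : ℤ) ≤ d i := fun i => by exact_mod_cast hpos i
  obtain ⟨G₀, k1, k2, k3, k4⟩ := exists_star_forest (d := fun i => (d i : ℤ)) hγ hpos' (by
    -- At `k = 0` the inequality says that the stars have enough slots.
    have h := hA 0 (Nat.zero_le _)
    unfold SysA at h
    have e1 : ∀ i : Fin n, min ((0 : ℕ) : ℤ) ((d i : ℤ) - 1) = 0 := fun i => by
      have := hpos' i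
      simp
      omega
    have e2 : (Finset.univ.filter fun i : Fin n => γ ≤ i.val ∧ i.val < γ + 0) = ∅ := by
      ext i; simp
    rw [e2, Finset.sum_congr rfl fun i _ => e1 i, low_eq] at h
    simp at h
    linarith)
  obtain ⟨H, h1, h2, h3⟩ := exists_saturated (n := n) (d := fun i => (d i : ℤ)) (γ := γ) (c := 1)
    (Or.inr rfl) heven (fun i j _ hij => by exact_mod_cast hd hij)
    (fun _ a _ => by
      rw [card_sdiff_low hγ]
      exact_mod_cast (hbig a).le)
    (fun _ r hr => by
      have h := hA (r.val + 1 - γ) (by have := r.2; omega)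
      unfold SysA at h
      rw [mid_eq_filter (r := r) (by omega), high_eq_filter (r := r) (by omega), low_eq] at h
      have hr2 := r.2
      have e : ((mid γ r).card : ℤ) + (high r).card = n - γ := by
        rw [card_mid hr, card_high]
        omega
      rw [e, card_mid hr]
      exact h)
    (fun r hr => by
      have h := hC (r.val + 1 - γ) (by have := r.2; omega)
      unfold SysC at h
      rw [mid_eq_filter (r := r) (by omega), high_eq_filter (r := r) (by omega), low_eq] at h
      rw [card_mid hr]
      exact h) k1 k2 k3 k4
  obtain ⟨K, hK, hdom⟩ := exists_real_of_valid (D := low n γ) (H := H) hG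
    ⟨h1, fun v hv => h2 v (by simpa using hv), fun v hv => cnt_pos.1
      (lt_of_lt_of_le one_pos (h3 v (by simpa using hv)))⟩
  refine ⟨K, realizes_iff.2 hK, low n γ, fun v hv => ?_, card_low hγ⟩
  obtain ⟨a, ha, hva⟩ := hdom v hv
  exact ⟨a, ha, hva.symm⟩

end Sufficiency

/-! ### Moving the dominating set to vertices of large degree -/

section Exchange

variable {V : Type*} [Fintype V] [DecidableEq V]

/-- Exchange the adjacency to `b` and to `c` of the vertices in `T`. -/
def exchange (G : SimpleGraph V) (b c : V) (T : Finset V) : SimpleGraph V where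
  Adj x y := G.Adj (if y ∈ T then Equiv.swap b c x else x) (if x ∈ T then Equiv.swap b c y else y)
  symm := ⟨fun _ _ h => h.symm⟩
  loopless := ⟨fun x h => G.irrefl (v := if x ∈ T then Equiv.swap b c x else x) h⟩

theorem exchange_adj {G : SimpleGraph V} {b c x y : V} {T : Finset V} :
    (exchange G b c T).Adj x y ↔ G.Adj (if y ∈ T then Equiv.swap b c x else x)
      (if x ∈ T then Equiv.swap b c y else y) := Iff.rfl

/-- A vertex of `T` merely swaps its adjacencies to `b` and `c`; these two trade their neighbours in
`T`, equally many on both sides. -/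
theorem cnt_exchange {G : SimpleGraph V} {b c : V} {T : Finset V} (hb : b ∉ T) (hc : c ∉ T)
    (h : cnt G T b = cnt G T c) (v : V) :
    cnt (exchange G b c T) Finset.univ v = cnt G Finset.univ v := by
  classical
  have split : ∀ (K : SimpleGraph V) w, cnt K Finset.univ w =
      cnt K T w + cnt K (Finset.univ \ T) w := fun K w => by
    rw [← cnt_union _ Finset.disjoint_sdiff, Finset.union_sdiff_of_subset (Finset.subset_univ _)]
  by_cases hvb : v = b
  · subst hvb
    rw [split, split G, h]
    congr 1
    · unfold cnt
      refine Finset.sum_congr rfl fun y hy => ?_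
      simp [exchange_adj, hb, hy]
    · refine cnt_congr fun y hy => ?_
      have hy' : y ∉ T := (Finset.mem_sdiff.1 hy).2
      simp [exchange_adj, hb, hy']
  by_cases hvc : v = c
  · subst hvc
    rw [split, split G, ← h]
    congr 1
    · unfold cnt
      refine Finset.sum_congr rfl fun y hy => ?_
      simp [exchange_adj, hc, hy]
    · refine cnt_congr fun y hy => ?_
      have hy' : y ∉ T := (Finset.mem_sdiff.1 hy).2
      simp [exchange_adj, hc, hy']
  have hs : Equiv.swap b c v = v := Equiv.swap_apply_of_ne_of_ne hvb hvc
  by_cases hvT : v ∈ T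
  · unfold cnt
    rw [← Equiv.sum_comp (Equiv.swap b c) fun y => if G.Adj v y then (1 : ℤ) else 0]
    refine Finset.sum_congr rfl fun y _ => ?_
    simp [exchange_adj, hvT, hs]
  · refine cnt_congr fun y _ => ?_
    simp [exchange_adj, hvT, hs]

/-- Among the neighbours of `c`, the set `T` takes exactly those that `b` lacks, so `b` inherits all
of them. Only `c` itself then needs a dominator, which is `hdom`. -/
theorem isDominatingSet_exchange {G : SimpleGraph V} {b c : V} {T D : Finset V} (hb : b ∉ T)
    (hbD : b ∉ D) (hD : IsDominatingSet G D)
    (hT : ∀ v, v ≠ b → v ≠ c → G.Adj c v → (v ∈ T ↔ ¬ G.Adj b v))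
    (hdom : ∃ u ∈ insert b (D.erase c), (exchange G b c T).Adj u c) :
    IsDominatingSet (exchange G b c T) (insert b (D.erase c)) := by
  intro v hv
  by_cases hvc : v = c
  · rw [hvc]; exact hdom
  have hvb : v ≠ b := by rintro rfl; exact hv (Finset.mem_insert_self _ _)
  have hvD : v ∉ D := fun h => hv (Finset.mem_insert_of_mem (Finset.mem_erase.2 ⟨hvc, h⟩))
  have hsv : Equiv.swap b c v = v := Equiv.swap_apply_of_ne_of_ne hvb hvc
  obtain ⟨a, ha, hav⟩ := hD v hvD
  by_cases hac : a = c
  · subst hac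
    refine ⟨b, Finset.mem_insert_self _ _, ?_⟩
    have := hT v hvb hvc hav
    by_cases hbv : G.Adj b v
    · have hvT : v ∉ T := fun h => (this.1 h) hbv
      simp [exchange_adj, hb, hvT, hbv]
    · simp [exchange_adj, hb, this.2 hbv, hav]
  · have hab : a ≠ b := by rintro rfl; exact hbD ha
    have hsa : Equiv.swap b c a = a := Equiv.swap_apply_of_ne_of_ne hab hac
    refine ⟨a, Finset.mem_insert_of_mem (Finset.mem_erase.2 ⟨hac, ha⟩), ?_⟩
    simp [exchange_adj, hsa, hsv, hav]

/-- A dominating vertex may be replaced by a vertex outside the dominating set of maximum degree. -/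
theorem exists_dominating_swap {G : SimpleGraph V} {b c : V} {D : Finset V}
    (hD : IsDominatingSet G D) (hb : b ∉ D) (hc : c ∈ D)
    (hmax : ∀ x, x ∉ D → cnt G Finset.univ x ≤ cnt G Finset.univ b)
    (hcb : cnt G Finset.univ c ≤ cnt G Finset.univ b) (hpos : 0 < cnt G Finset.univ c) :
    ∃ G' : SimpleGraph V, (∀ v, cnt G' Finset.univ v = cnt G Finset.univ v) ∧
      IsDominatingSet G' (insert b (D.erase c)) := by
  classical
  have hbc : b ≠ c := by rintro rfl; exact hb hc
  set B : Finset V := (Finset.univ.filter (G.Adj b)).erase c with hB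
  set C : Finset V := (Finset.univ.filter (G.Adj c)).erase b with hC
  have memB : ∀ v, v ∈ B ↔ v ≠ c ∧ G.Adj b v := fun v => by simp [hB]
  have memC : ∀ v, v ∈ C ↔ v ≠ b ∧ G.Adj c v := fun v => by simp [hC]
  have hcard : C.card ≤ B.card := by
    rw [cnt_eq_card, cnt_eq_card] at hcb
    by_cases h : G.Adj b c
    · rw [hB, hC, Finset.card_erase_of_mem (by simpa using h.symm),
        Finset.card_erase_of_mem (by simpa using h)]
      omega
    · rw [hB, hC, Finset.erase_eq_of_notMem (by simpa using fun h' => h h'.symm),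
        Finset.erase_eq_of_notMem (by simpa using h)]
      omega
  have hcard' : (C \ B).card ≤ (B \ C).card := Finset.card_sdiff_le_card_sdiff_iff.2 hcard
  -- The generic exchange uses all of `C \ B` and equally many vertices of `B \ C`. It works once
  -- `c` is dominated: by `b`, by a common neighbour in `D`, or by an element of `D` in `Y`.
  have bulk : ∀ Y ⊆ B \ C, Y.card = (C \ B).card →
      (G.Adj b c ∨ (∃ u ∈ D, G.Adj b u ∧ G.Adj c u) ∨ ∃ u ∈ D, u ∈ Y) →
      ∃ G' : SimpleGraph V, (∀ v, cnt G' Finset.univ v = cnt G Finset.univ v) ∧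
        IsDominatingSet G' (insert b (D.erase c)) := by
    intro Y hY hYcard hdom
    have hYmem : ∀ v ∈ Y, v ≠ c ∧ v ≠ b ∧ G.Adj b v ∧ ¬ G.Adj c v := fun v hv => by
      have h1 := Finset.mem_sdiff.1 (hY hv)
      rw [memB, memC] at h1
      have h2 := h1.1.2.ne
      exact ⟨h1.1.1, h2.symm, h1.1.2, fun h => h1.2 ⟨h2.symm, h⟩⟩
    have hXmem : ∀ v, v ∈ C \ B ↔ v ≠ b ∧ v ≠ c ∧ G.Adj c v ∧ ¬ G.Adj b v := fun v => by
      rw [Finset.mem_sdiff, memB, memC]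
      constructor
      · rintro ⟨⟨h1, h2⟩, h3⟩
        exact ⟨h1, h2.ne.symm, h2, fun h => h3 ⟨h2.ne.symm, h⟩⟩
      · rintro ⟨h1, h2, h3, h4⟩
        exact ⟨⟨h1, h3⟩, fun h => h4 h.2⟩
    have hbT : b ∉ C \ B ∪ Y := by
      rw [Finset.mem_union, hXmem]
      rintro (h | h)
      · exact h.1 rfl
      · exact (hYmem b h).2.1 rfl
    have hcT : c ∉ C \ B ∪ Y := by
      rw [Finset.mem_union, hXmem]
      rintro (h | h)
      · exact h.2.1 rfl
      · exact (hYmem c h).1 rfl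
    have hdisj : Disjoint (C \ B) Y := by
      rw [Finset.disjoint_left]
      intro v h1 h2
      exact ((hXmem v).1 h1).2.2.2 (hYmem v h2).2.2.1
    have hall : ∀ (T : Finset V) w, (∀ y ∈ T, G.Adj w y) → cnt G T w = T.card := by
      intro T w h
      rw [cnt_eq_card, Finset.filter_true_of_mem h]
    refine ⟨exchange G b c (C \ B ∪ Y), cnt_exchange hbT hcT ?_, isDominatingSet_exchange hbT hb hD
      (fun v h1 h2 h3 => ?_) ?_⟩
    · rw [cnt_union _ hdisj, cnt_union _ hdisj, hall Y b fun y hy => (hYmem y hy).2.2.1,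
        hall (C \ B) c fun y hy => ((hXmem y).1 hy).2.2.1,
        cnt_eq_zero fun y hy => ((hXmem y).1 hy).2.2.2, cnt_eq_zero fun y hy => (hYmem y hy).2.2.2,
        hYcard]
      ring
    · rw [Finset.mem_union, hXmem]
      constructor
      · rintro (h | h)
        · exact h.2.2.2
        · exact absurd h3 (hYmem v h).2.2.2
      · intro h
        exact Or.inl ⟨h1, h2, h3, h⟩
    · rcases hdom with h | ⟨u, hu, h1, h2⟩ | ⟨u, hu, h1⟩
      · refine ⟨b, Finset.mem_insert_self _ _, ?_⟩
        rw [exchange_adj, if_neg hcT, if_neg hbT]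
        exact h
      · refine ⟨u, Finset.mem_insert_of_mem (Finset.mem_erase.2 ⟨h2.ne.symm, hu⟩), ?_⟩
        have huT : u ∉ C \ B ∪ Y := by
          rw [Finset.mem_union, hXmem]
          rintro (h | h)
          · exact h.2.2.2 h1
          · exact (hYmem u h).2.2.2 h2
        rw [exchange_adj, if_neg hcT, if_neg huT]
        exact h2.symm
      · have h2 := hYmem u h1
        refine ⟨u, Finset.mem_insert_of_mem (Finset.mem_erase.2 ⟨h2.1, hu⟩), ?_⟩
        rw [exchange_adj, if_neg hcT, if_pos (Finset.mem_union_right _ h1), Equiv.swap_apply_right]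
        exact h2.2.2.1.symm
  by_cases hadj : G.Adj b c
  · obtain ⟨Y, hY, hYc⟩ := Finset.exists_subset_card_eq hcard'
    exact bulk Y hY hYc (Or.inl hadj)
  by_cases hcom : ∃ u ∈ D, G.Adj b u ∧ G.Adj c u
  · obtain ⟨Y, hY, hYc⟩ := Finset.exists_subset_card_eq hcard'
    exact bulk Y hY hYc (Or.inr (Or.inl hcom))
  push Not at hcom
  obtain ⟨u, hu, hub⟩ := hD b hb
  have huc : u ≠ c := by rintro rfl; exact hadj hub.symm
  have hcu : ¬ G.Adj c u := hcom u hu hub.symm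
  -- The dominator `u` of `b` lies in `B \ C`, so it can be chosen for `Y` as soon as `Y` is
  -- nonempty.
  by_cases hX : (C \ B).Nonempty
  · have huBC : {u} ⊆ B \ C := by
      rw [Finset.singleton_subset_iff, Finset.mem_sdiff, memB, memC]
      exact ⟨⟨huc, hub.symm⟩, fun h => hcu h.2⟩
    obtain ⟨Y, hY1, hY2, hYc⟩ := Finset.exists_subsuperset_card_eq huBC
      (by simpa using hX.card_pos) hcard'
    exact bulk Y hY2 hYc (Or.inr (Or.inr ⟨u, hu, hY1 (Finset.mem_singleton_self u)⟩))
  -- Now every neighbour of `c` is a neighbour of `b`, and a flip of one four-cycle has to join `c`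
  -- to `b`.
  have hsub : ∀ x, G.Adj c x → G.Adj b x := by
    intro x hx
    by_contra h
    have hxb : x ≠ b := by rintro rfl; exact hadj hx.symm
    exact hX ⟨x, Finset.mem_sdiff.2 ⟨(memC x).2 ⟨hxb, hx⟩, fun h' => h ((memB x).1 h').2⟩⟩
  have hND : ∀ x, G.Adj c x → x ∉ D := fun x hx hxD => hcom x hxD (hsub x hx) hx
  have hncb : ¬ G.Adj c b := fun h => hadj h.symm
  by_cases hxu : ∃ x, G.Adj c x ∧ ¬ G.Adj u x
  · obtain ⟨x, hcx, hux⟩ := hxu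
    have hxD := hND x hcx
    have hne : u ≠ x := by rintro rfl; exact hxD hu
    -- Add `cb`, remove `bu`, add `ux`, remove `xc`: `u` takes over `x`, and `b` the other
    -- neighbours of `c`.
    refine ⟨flip4 G c b u x, cnt_flip4 hbc.symm hne hncb hub.symm hux hcx.symm, fun v hv => ?_⟩
    have e1 := hcx.ne
    have e2 := hub.ne
    have e3 := (hsub x hcx).ne
    by_cases hvc : v = c
    · refine ⟨b, Finset.mem_insert_self _ _, ?_⟩
      simp only [flip4, delE_adj, path3_adj]
      grind
    have hvb : v ≠ b := by rintro rfl; exact hv (Finset.mem_insert_self _ _)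
    have hvD : v ∉ D := fun h => hv (Finset.mem_insert_of_mem (Finset.mem_erase.2 ⟨hvc, h⟩))
    obtain ⟨a, ha, hav⟩ := hD v hvD
    have hab : a ≠ b := by rintro rfl; exact hb ha
    have hvu : v ≠ u := by rintro rfl; exact hvD hu
    have hax : a ≠ x := by rintro rfl; exact hxD ha
    by_cases hvx : v = x
    · refine ⟨u, Finset.mem_insert_of_mem (Finset.mem_erase.2 ⟨huc, hu⟩), ?_⟩
      simp only [flip4, delE_adj, path3_adj]
      grind
    by_cases hac : a = c
    · subst hac
      have := hsub v hav
      refine ⟨b, Finset.mem_insert_self _ _, ?_⟩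
      simp only [flip4, delE_adj, path3_adj]
      grind
    · refine ⟨a, Finset.mem_insert_of_mem (Finset.mem_erase.2 ⟨hac, ha⟩), ?_⟩
      simp only [flip4, delE_adj, path3_adj]
      grind
  · push Not at hxu
    obtain ⟨x, -, hcx⟩ := cnt_pos.1 hpos
    have hxD := hND x hcx
    have hbx := hsub x hcx
    -- Now `u` dominates all neighbours of `c`. The degree of `x` is at most that of `b`, and `x`
    -- but not `b` is adjacent to `c`, so `b` has a neighbour `w` that `x` lacks. Add `cb`, remove
    -- `bw`, add `wx`, remove `xc`.
    obtain ⟨w, hbw, hxw, hwx⟩ : ∃ w, G.Adj b w ∧ ¬ G.Adj x w ∧ w ≠ x := by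
      have split : ∀ w, cnt G Finset.univ w = cnt G {c} w + cnt G (Finset.univ \ {c}) w :=
        fun w => by
          rw [← cnt_union _ Finset.disjoint_sdiff,
            Finset.union_sdiff_of_subset (Finset.subset_univ _)]
      have h1 : 0 < cnt G {c} x := cnt_pos.2 ⟨c, by simp, hcx.symm⟩
      have h2 : cnt G {c} b = 0 := cnt_eq_zero fun y hy => by
        rw [Finset.mem_singleton.1 hy]; exact hadj
      have h3 := hmax x hxD
      rw [split, split b] at h3
      obtain ⟨w, -, h4, h5, h6⟩ := exists_adj_not_adj (G := G) (T := Finset.univ \ {c}) (r := x)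
        (i := b) (by simp [hbc]) (by omega)
      exact ⟨w, h4, h6, h5⟩
    have hwc : w ≠ c := by rintro rfl; exact hadj hbw
    have hwu : w ≠ u := by rintro rfl; exact hxw (hxu x hcx).symm
    have hwc' : G.Adj c w → G.Adj u w := hxu w
    refine ⟨flip4 G c b w x, cnt_flip4 hbc.symm hwx hncb hbw (fun h => hxw h.symm) hcx.symm,
      fun v hv => ?_⟩
    have e1 := hcx.ne
    have e2 := hub.ne
    have e3 := hbx.ne
    have e4 := hbw.ne
    have e5 := hxu x hcx
    by_cases hvc : v = c
    · refine ⟨b, Finset.mem_insert_self _ _, ?_⟩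
      simp only [flip4, delE_adj, path3_adj]
      grind
    have hvb : v ≠ b := by rintro rfl; exact hv (Finset.mem_insert_self _ _)
    have hvD : v ∉ D := fun h => hv (Finset.mem_insert_of_mem (Finset.mem_erase.2 ⟨hvc, h⟩))
    obtain ⟨a, ha, hav⟩ := hD v hvD
    have hab : a ≠ b := by rintro rfl; exact hb ha
    have hax : a ≠ x := by rintro rfl; exact hxD ha
    by_cases hac : a = c
    · subst hac
      have := hxu v hav
      have hvu : v ≠ u := by rintro rfl; exact hvD hu
      refine ⟨u, Finset.mem_insert_of_mem (Finset.mem_erase.2 ⟨huc, hu⟩), ?_⟩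
      simp only [flip4, delE_adj, path3_adj]
      grind
    · refine ⟨a, Finset.mem_insert_of_mem (Finset.mem_erase.2 ⟨hac, ha⟩), ?_⟩
      simp only [flip4, delE_adj, path3_adj]
      grind

end Exchange

/-! ### Necessity of the inequalities -/

section Necessity

variable {n : ℕ}

/-- The `γ` vertices of largest degree dominate some realization. -/
theorem HasDom.exists_low {d : Fin n → ℕ} {γ : ℕ} (hd : Antitone d) (hpos : ∀ i, 0 < d i)
    (hγ : γ ≤ n) (h : HasDom d γ) :
    ∃ G : SimpleGraph (Fin n), (∀ v, cnt G Finset.univ v = d v) ∧ IsDominatingSet G (low n γ) := by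
  obtain ⟨G, hG, D, hD, hcard⟩ := h
  rw [realizes_iff] at hG
  induction hm : (low n γ \ D).card generalizing G D with
  | zero =>
    rw [Finset.card_eq_zero, Finset.sdiff_eq_empty_iff_subset] at hm
    have := Finset.eq_of_subset_of_card_le hm (by rw [hcard, card_low hγ])
    exact ⟨G, hG, this ▸ hD⟩
  | succ m ih =>
    have hne : (Finset.univ \ D).Nonempty := by
      obtain ⟨x, hx⟩ := Finset.card_pos.1 (show 0 < (low n γ \ D).card by omega)
      exact ⟨x, by simpa using (Finset.mem_sdiff.1 hx).2⟩
    have hbD : (Finset.univ \ D).min' hne ∉ D := by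
      simpa using Finset.min'_mem _ hne
    -- As `d` is non-increasing, the first vertex outside `D` has the maximum degree there.
    set b := (Finset.univ \ D).min' hne with hb
    have hmin : ∀ x, x ∉ D → b ≤ x := fun x hx => Finset.min'_le _ _ (by simpa using hx)
    have hbγ : b.val < γ := by
      obtain ⟨x, hx⟩ := Finset.card_pos.1 (show 0 < (low n γ \ D).card by omega)
      rw [Finset.mem_sdiff, mem_low] at hx
      exact lt_of_le_of_lt (hmin x hx.2) hx.1
    obtain ⟨c, hc, hcγ⟩ : ∃ c ∈ D, γ ≤ c.val := by
      by_contra! hcon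
      have h1 : D ⊆ low n γ := fun x hx => by simpa using hcon x hx
      have h2 := Finset.eq_of_subset_of_card_le h1 (by rw [hcard, card_low hγ])
      exact hbD (h2 ▸ by simpa using hbγ)
    have hbc : b ≤ c := by rw [Fin.le_def]; omega
    obtain ⟨G', hG', hD'⟩ := exists_dominating_swap hD hbD hc
      (fun x hx => by rw [hG, hG]; exact_mod_cast hd (hmin x hx))
      (by rw [hG, hG]; exact_mod_cast hd hbc) (by rw [hG]; exact_mod_cast hpos c)
    refine ih G' (fun v => (hG' v).trans (hG v)) (insert b (D.erase c)) hD' ?_ ?_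
    · rw [Finset.card_insert_of_notMem (fun h => hbD (Finset.mem_of_mem_erase h)),
        Finset.card_erase_of_mem hc]
      have : 0 < D.card := Finset.card_pos.2 ⟨c, hc⟩
      omega
    · have h1 : low n γ \ insert b (D.erase c) = (low n γ \ D).erase b := by
        ext x
        simp only [Finset.mem_sdiff, Finset.mem_insert, Finset.mem_erase, mem_low, not_or, not_and]
        constructor
        · rintro ⟨h2, h3, h4⟩
          exact ⟨h3, h2, h4 (by rintro rfl; omega)⟩
        · rintro ⟨h2, h3, h4⟩
          exact ⟨h3, h2, fun _ => h4⟩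
      rw [h1, Finset.card_erase_of_mem (by simp [hbγ, hbD]), hm]
      rfl

/-- The degree sum of a set `K` with respect to its own vertices and to `S`. -/
theorem sum_cnt_le {G : SimpleGraph (Fin n)} {K S : Finset (Fin n)} {k : ℕ} {f : Fin n → ℤ}
    (hk : K.card ≤ k) (hf : ∀ s ∈ S, cnt G K s ≤ f s) :
    ∑ v ∈ K, cnt G K v + ∑ v ∈ K, cnt G S v ≤
      (k : ℤ) * ((k : ℤ) - 1) + ∑ s ∈ S, min (k : ℤ) (f s) := by
  have h1 : ∑ v ∈ K, cnt G K v ≤ (k : ℤ) * ((k : ℤ) - 1) := by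
    have h2 : ∀ v ∈ K, cnt G K v ≤ (K.card : ℤ) - 1 := by
      intro v hv
      have h3 : cnt G K v ≤ cnt G (K.erase v) v :=
        cnt_le_of_forall fun y hy hvy => Finset.mem_erase.2 ⟨hvy.ne.symm, hy⟩
      have h4 := cnt_le_card G (K.erase v) v
      rw [Finset.card_erase_of_mem hv] at h4
      have : 0 < K.card := Finset.card_pos.2 ⟨v, hv⟩
      omega
    have h3 := Finset.sum_le_card_nsmul _ _ _ h2
    rw [nsmul_eq_mul] at h3
    rcases Nat.eq_zero_or_pos K.card with h | h
    · rw [h] at h3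
      rcases Nat.eq_zero_or_pos k with rfl | hk'
      · simpa using h3
      · have : (0 : ℤ) ≤ (k : ℤ) * ((k : ℤ) - 1) :=
          mul_nonneg (by positivity) (by omega)
        simp at h3
        linarith
    · have h4 : (K.card : ℤ) ≤ k := by exact_mod_cast hk
      have h5 : (1 : ℤ) ≤ K.card := by exact_mod_cast h
      nlinarith
  have h2 : ∑ v ∈ K, cnt G S v ≤ ∑ s ∈ S, min (k : ℤ) (f s) := by
    rw [sum_cnt_comm]
    refine Finset.sum_le_sum fun s hs => le_min ?_ (hf s hs)
    exact (cnt_le_card G K s).trans (by exact_mod_cast hk)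
  linarith

theorem sysB_of_real {d : Fin n → ℕ} {G : SimpleGraph (Fin n)}
    (hG : ∀ v, cnt G Finset.univ v = d v) (k : ℕ) : SysB d k := by
  unfold SysB
  have h1 := sum_cnt_le (G := G) (K := Finset.univ.filter fun i : Fin n => i.val < k)
    (S := Finset.univ.filter fun i : Fin n => k ≤ i.val) (k := k) (f := fun i => (d i : ℤ))
    (by rw [Fin.card_filter_val_lt]; exact min_le_right _ _)
    (fun s _ => by rw [← hG]; exact cnt_le_of_subset _ (Finset.subset_univ _) _)
  refine le_trans (le_of_eq ?_) h1
  rw [← Finset.sum_add_distrib]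
  refine Finset.sum_congr rfl fun v _ => ?_
  rw [← cnt_union, ← hG]
  · congr 1
    ext i
    simp
    omega
  · rw [Finset.disjoint_left]
    intro i hi hi'
    simp at hi hi'
    omega

variable {d : Fin n → ℕ} {γ : ℕ} {G : SimpleGraph (Fin n)}

theorem cnt_split (G : SimpleGraph (Fin n)) (γ k : ℕ) (v : Fin n) :
    cnt G Finset.univ v = cnt G (Finset.univ.filter fun i : Fin n => i.val < γ) v +
      (cnt G (Finset.univ.filter fun i : Fin n => γ ≤ i.val ∧ i.val < γ + k) v +
        cnt G (Finset.univ.filter fun i : Fin n => γ + k ≤ i.val) v) := by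
  rw [← cnt_union, ← cnt_union]
  · congr 1
    ext i
    simp
    omega
  · rw [Finset.disjoint_left]
    intro i hi hi'
    simp at hi hi'
    omega
  · rw [Finset.disjoint_left]
    intro i hi hi'
    simp at hi hi'
    omega

theorem card_filter_mid_le (γ k : ℕ) :
    (Finset.univ.filter fun i : Fin n => γ ≤ i.val ∧ i.val < γ + k).card ≤ k := by
  have h := Finset.card_le_card_of_injOn (s := Finset.univ.filter fun i : Fin n =>
    γ ≤ i.val ∧ i.val < γ + k) (t := Finset.Ico γ (γ + k)) (fun i => i.val)
    (fun i hi => by simpa using hi) (fun i _ j _ h => Fin.ext h)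
  simpa using h

theorem one_le_cnt_low (hdom : IsDominatingSet G (low n γ)) {v : Fin n} (hv : γ ≤ v.val) :
    1 ≤ cnt G (Finset.univ.filter fun i : Fin n => i.val < γ) v := by
  obtain ⟨u, hu, huv⟩ := hdom v (by simpa using hv)
  have : 0 < cnt G (low n γ) v := cnt_pos.2 ⟨u, hu, huv.symm⟩
  exact this

/-- A vertex beyond the block spends an edge on its dominator, which leaves at most its degree less
one for the block. -/
theorem sysC_of_real (hG : ∀ v, cnt G Finset.univ v = d v)
    (hdom : IsDominatingSet G (low n γ)) (k : ℕ) : SysC d γ k := by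
  unfold SysC
  have h1 := sum_cnt_le (G := G) (k := k) (f := fun i => (d i : ℤ) - 1)
    (card_filter_mid_le (n := n) γ k)
    (S := Finset.univ.filter fun i : Fin n => γ + k ≤ i.val) (fun s hs => by
      have hs' : γ ≤ s.val := by simp at hs; omega
      have h2 := one_le_cnt_low hdom hs'
      have h3 := cnt_split G γ k s
      have h4 := cnt_nonneg G (Finset.univ.filter fun i : Fin n => γ + k ≤ i.val) s
      rw [hG] at h3
      linarith)
  have h2 : ∑ v : Fin n with γ ≤ v.val ∧ v.val < γ + k,
      cnt G (Finset.univ.filter fun i : Fin n => i.val < γ) v ≤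
      ∑ i : Fin n with i.val < γ, min (k : ℤ) (d i : ℤ) := by
    rw [sum_cnt_comm]
    refine Finset.sum_le_sum fun a _ => le_min ?_ ?_
    · exact (cnt_le_card _ _ _).trans (by exact_mod_cast card_filter_mid_le γ k)
    · rw [← hG]; exact cnt_le_of_subset _ (Finset.subset_univ _) _
  have h3 : ∑ i : Fin n with γ ≤ i.val ∧ i.val < γ + k, (d i : ℤ) = _ :=
    Finset.sum_congr rfl fun i _ => (hG i).symm.trans (cnt_split G γ k i)
  rw [h3, Finset.sum_add_distrib, Finset.sum_add_distrib]
  linarith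

/-- Outside `[0, γ)` no vertex has a negative surplus of neighbours below `γ` over the one required.
The surplus of the block is therefore at most the total surplus, which the first `γ` degrees less `n
- γ` bound. -/
theorem sysA_of_real (hγ : γ ≤ n) (hG : ∀ v, cnt G Finset.univ v = d v)
    (hdom : IsDominatingSet G (low n γ)) (k : ℕ) : SysA d γ k := by
  unfold SysA
  have h1 := sum_cnt_le (G := G) (k := k) (f := fun i => (d i : ℤ) - 1)
    (card_filter_mid_le (n := n) γ k)
    (S := Finset.univ.filter fun i : Fin n => γ + k ≤ i.val) (fun s hs => by
      have hs' : γ ≤ s.val := by simp at hs; omega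
      have h2 := one_le_cnt_low hdom hs'
      have h3 := cnt_split G γ k s
      have h4 := cnt_nonneg G (Finset.univ.filter fun i : Fin n => γ + k ≤ i.val) s
      rw [hG] at h3
      linarith)
  have h2 : ∑ v : Fin n with γ ≤ v.val ∧ v.val < γ + k,
      (cnt G (Finset.univ.filter fun i : Fin n => i.val < γ) v - 1) ≤
      ∑ i : Fin n with i.val < γ, (d i : ℤ) - (n - γ) := by
    have e1 : ∑ v : Fin n with γ ≤ v.val ∧ v.val < γ + k,
      (cnt G (Finset.univ.filter fun i : Fin n => i.val < γ) v - 1) ≤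
        ∑ v ∈ Finset.univ \ low n γ,
          (cnt G (Finset.univ.filter fun i : Fin n => i.val < γ) v - 1) := by
      refine Finset.sum_le_sum_of_subset_of_nonneg ?_ ?_
      · intro v hv
        simp at hv ⊢
        exact hv.1
      · intro v hv _
        have := one_le_cnt_low hdom (v := v) (by simpa using hv)
        linarith
    have e2 : ∑ v ∈ Finset.univ \ low n γ,
        cnt G (Finset.univ.filter fun i : Fin n => i.val < γ) v ≤
        ∑ i : Fin n with i.val < γ, (d i : ℤ) := by
      rw [sum_cnt_comm]
      refine Finset.sum_le_sum fun a _ => ?_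
      rw [← hG]
      exact cnt_le_of_subset _ (Finset.subset_univ _) _
    refine e1.trans ?_
    rw [Finset.sum_sub_distrib]
    simp only [Finset.sum_const, nsmul_eq_mul, mul_one, card_sdiff_low hγ]
    push_cast [hγ]
    linarith
  have h3 : ∑ i : Fin n with γ ≤ i.val ∧ i.val < γ + k, ((d i : ℤ) - 1) =
      ∑ v : Fin n with γ ≤ v.val ∧ v.val < γ + k,
        ((cnt G (Finset.univ.filter fun i : Fin n => i.val < γ) v - 1) +
        (cnt G (Finset.univ.filter fun i : Fin n => γ ≤ i.val ∧ i.val < γ + k) v +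
        cnt G (Finset.univ.filter fun i : Fin n => γ + k ≤ i.val) v)) :=
    Finset.sum_congr rfl fun i _ => by rw [← hG, cnt_split G γ k i]; ring
  rw [h3, Finset.sum_add_distrib, Finset.sum_add_distrib]
  linarith

/-- For a graphic sequence two systems of inequalities characterize the sizes of dominating
sets of realizations. -/
theorem hasDom_iff_of_isGraphic (hd : Antitone d) (hpos : ∀ i, 0 < d i) (hγ : γ ≤ n)
    (hG : IsGraphic d) : HasDom d γ ↔ ∀ k ≤ n - γ, SysA d γ k ∧ SysC d γ k := by
  constructor
  · intro h k _
    obtain ⟨G, hG, hdom⟩ := h.exists_low hd hpos hγ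
    exact ⟨sysA_of_real hγ hG hdom k, sysC_of_real hG hdom k⟩
  · intro h
    exact hasDom_of_sys hd hpos hγ hG (fun k hk => (h k hk).1) (fun k hk => (h k hk).2)

/-- The characterization of the sequences which have a realization with a dominating set of
size `γ`. -/
theorem hasDom_iff (hn : 0 < n) (hd : Antitone d) (hpos : ∀ i, 0 < d i) (hγ : γ ≤ n) :
    HasDom d γ ↔ Even (∑ i, d i) ∧ (∀ k ≤ n - γ, SysA d γ k) ∧ (∀ k ≤ n, SysB d k) ∧
      ∀ k ≤ d ⟨0, hn⟩, SysC d γ k := by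
  constructor
  · intro h
    obtain ⟨G, hG, hdom⟩ := h.exists_low hd hpos hγ
    refine ⟨?_, fun k _ => sysA_of_real hγ hG hdom k, fun k _ => sysB_of_real hG k,
      fun k _ => sysC_of_real hG hdom k⟩
    have : Even (∑ i, (d i : ℤ)) := by
      rw [← Finset.sum_congr rfl fun i _ => hG i]
      exact even_sum_cnt G
    exact_mod_cast this
  · rintro ⟨heven, hA, hB, hC⟩
    refine hasDom_of_sys hd hpos hγ (isGraphic_of_sysB hd heven hB) hA fun k _ => ?_
    by_cases hk : k ≤ d ⟨0, hn⟩
    · exact hC k hk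
    -- Beyond `d₁` every degree is at most `k - 1`, so the term `k (k - 1)` alone suffices.
    · unfold SysC
      have h1 : ∑ i : Fin n with γ ≤ i.val ∧ i.val < γ + k, (d i : ℤ) ≤
          (k : ℤ) * ((k : ℤ) - 1) := by
        have h2 : ∀ i ∈ Finset.univ.filter fun i : Fin n => γ ≤ i.val ∧ i.val < γ + k,
            (d i : ℤ) ≤ (k : ℤ) - 1 := by
          intro i _
          have := hd (show (⟨0, hn⟩ : Fin n) ≤ i from Nat.zero_le _)
          omega
        refine (Finset.sum_le_card_nsmul _ _ _ h2).trans ?_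
        rw [nsmul_eq_mul]
        refine mul_le_mul_of_nonneg_right ?_ (by omega)
        exact_mod_cast card_filter_mid_le γ k
      have h2 : 0 ≤ ∑ i : Fin n with i.val < γ, min (k : ℤ) (d i : ℤ) :=
        Finset.sum_nonneg fun i _ => le_min (by positivity) (by positivity)
      have h3 : 0 ≤ ∑ i : Fin n with γ + k ≤ i.val, min (k : ℤ) ((d i : ℤ) - 1) :=
        Finset.sum_nonneg fun i _ => le_min (by positivity) (by have := hpos i; omega)
      linarith

end Necessity

/-! ### The minimum as a threshold -/

section MinimumDominatingSet

variable {n : ℕ} {d : Fin n → ℕ} {γ : ℕ}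

theorem HasDom.mono {γ' : ℕ} (h : HasDom d γ) (hle : γ ≤ γ') (hn : γ' ≤ n) : HasDom d γ' := by
  obtain ⟨G, hG, D, hD, rfl⟩ := h
  obtain ⟨D', hDD', hcard⟩ := Finset.exists_superset_card_eq hle (by simpa using hn)
  refine ⟨G, hG, D', fun v hv => ?_, hcard⟩
  obtain ⟨u, hu, huv⟩ := hD v fun h => hv (hDD' h)
  exact ⟨u, hDD' hu, huv⟩

theorem IsGraphic.hasDom (h : IsGraphic d) : HasDom d n := by
  obtain ⟨G, hG⟩ := h
  exact ⟨G, hG, Finset.univ, fun v hv => absurd (Finset.mem_univ v) hv, by simp⟩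

theorem not_hasDom_zero (hn : 0 < n) : ¬ HasDom d 0 := by
  rintro ⟨G, -, D, hD, hcard⟩
  rw [Finset.card_eq_zero] at hcard
  subst hcard
  obtain ⟨u, hu, -⟩ := hD ⟨0, hn⟩ (by simp)
  simp at hu

theorem seqMDS_le (h : HasDom d γ) : seqMDS d ≤ γ := by
  obtain ⟨G, hG, D, hD, hcard⟩ := h
  have h1 : seqMDS d ≤ graphMDS G := Nat.sInf_le ⟨G, hG, rfl⟩
  have h2 : graphMDS G ≤ γ := Nat.sInf_le ⟨D, hD, hcard⟩
  exact h1.trans h2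

theorem hasDom_seqMDS (h : IsGraphic d) : HasDom d (seqMDS d) := by
  obtain ⟨G₀, hG₀⟩ := h
  obtain ⟨G, hG, hγ⟩ : seqMDS d ∈ {γ | ∃ G : SimpleGraph (Fin n), Realizes G d ∧ graphMDS G = γ} :=
    Nat.sInf_mem ⟨_, G₀, hG₀, rfl⟩
  obtain ⟨D, hD, hcard⟩ :
      graphMDS G ∈ {γ | ∃ D : Finset (Fin n), IsDominatingSet G D ∧ D.card = γ} :=
    Nat.sInf_mem ⟨_, Finset.univ, fun v hv => absurd (Finset.mem_univ v) hv, rfl⟩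
  exact ⟨G, hG, D, hD, hcard.trans hγ⟩

/-- The minimum is the point where `HasDom` becomes true. -/
theorem seqMDS_eq_of_hasDom_succ (hG : IsGraphic d) (hγ : γ ≤ n) (h₀ : ¬ HasDom d γ)
    (h₁ : HasDom d (γ + 1)) : seqMDS d = γ + 1 := by
  refine le_antisymm (seqMDS_le h₁) ?_
  by_contra hlt
  exact h₀ ((hasDom_seqMDS hG).mono (by omega) hγ)

/-- A positive degree needs a second vertex. This excludes `n = 1`, where neither `n ^ C` nor `n log
n` would leave any room. -/
theorem IsGraphic.two_le (hG : IsGraphic d) (hn : 0 < n) (hpos : ∀ i, 0 < d i) : 2 ≤ n := by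
  obtain ⟨G, hG⟩ := hG
  by_contra hlt
  have h1 := hG ⟨0, hn⟩
  have h2 : G.neighborSet ⟨0, hn⟩ = ∅ := by
    ext y
    have : y = ⟨0, hn⟩ := Fin.ext (by have := y.2; simp; omega)
    simp [this]
  rw [h2, Set.ncard_empty] at h1
  exact (hpos _).ne h1

theorem IsGraphic.lt (hG : IsGraphic d) (i : Fin n) : d i < n := by
  obtain ⟨G, hG⟩ := hG
  have h1 : (d i : ℤ) = cnt G Finset.univ i := ((realizes_iff.1 hG) i).symm
  have h2 : cnt G Finset.univ i ≤ cnt G (Finset.univ.erase i) i :=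
    cnt_le_of_forall fun y hy hvy => Finset.mem_erase.2 ⟨hvy.ne.symm, hy⟩
  have h3 := cnt_le_card G (Finset.univ.erase i) i
  rw [Finset.card_erase_of_mem (Finset.mem_univ _), Finset.card_univ, Fintype.card_fin] at h3
  have := i.2
  omega

end MinimumDominatingSet

/-! ### Closed forms by prefix sums -/

section ClosedForms

variable {n : ℕ}

/-- The sequence `d` continued by zeros. -/
def entry (d : Fin n → ℕ) (i : ℕ) : ℤ := if h : i < n then d ⟨i, h⟩ else 0

/-- The prefix sums of `d`. -/
def pre (d : Fin n → ℕ) (j : ℕ) : ℤ := ∑ i ∈ Finset.range j, entry d i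

/-- The entries of `d` that are at least `k` are those at the indices below `t`. -/
def IsCut (d : Fin n → ℕ) (k t : ℕ) : Prop := t ≤ n ∧ ∀ i < n, i < t ↔ (k : ℤ) ≤ entry d i

theorem entry_val (d : Fin n → ℕ) (i : Fin n) : entry d i.val = d i := by simp [entry]

theorem pre_zero (d : Fin n → ℕ) : pre d 0 = 0 := by simp [pre]

theorem pre_succ (d : Fin n → ℕ) (j : ℕ) : pre d (j + 1) = pre d j + entry d j :=
  Finset.sum_range_succ _ _

theorem pre_nonneg (d : Fin n → ℕ) (j : ℕ) : 0 ≤ pre d j :=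
  Finset.sum_nonneg fun i _ => by unfold entry; split_ifs <;> simp

theorem pre_le {d : Fin n → ℕ} (h : ∀ i, d i < n) {j : ℕ} (hj : j ≤ n) :
    pre d j ≤ (n : ℤ) * n := by
  have h1 : pre d j ≤ ∑ i ∈ Finset.range j, (n : ℤ) :=
    Finset.sum_le_sum fun i _ => by
      unfold entry
      split_ifs with hi
      · exact_mod_cast (h _).le
      · positivity
  rw [Finset.sum_const, Finset.card_range, nsmul_eq_mul] at h1
  exact h1.trans (by gcongr)

theorem sum_fin_filter_Ico (f : ℕ → ℤ) {a b : ℕ} (hb : b ≤ n) :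
    ∑ i : Fin n with a ≤ i.val ∧ i.val < b, f i.val = ∑ i ∈ Finset.Ico a b, f i := by
  rw [Finset.sum_filter, Fin.sum_univ_eq_sum_range (fun i => if a ≤ i ∧ i < b then f i else 0),
    ← Finset.sum_filter]
  refine Finset.sum_congr ?_ fun _ _ => rfl
  ext i
  simp only [Finset.mem_filter, Finset.mem_range, Finset.mem_Ico]
  omega

theorem sum_entry_Ico (d : Fin n → ℕ) {a b : ℕ} (hab : a ≤ b) :
    ∑ i ∈ Finset.Ico a b, entry d i = pre d b - pre d a :=
  Finset.sum_Ico_eq_sub _ hab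

theorem sum_mid_eq (d : Fin n → ℕ) {a b : ℕ} (hab : a ≤ b) (hb : b ≤ n) :
    ∑ i : Fin n with a ≤ i.val ∧ i.val < b, (d i : ℤ) = pre d b - pre d a := by
  rw [← sum_entry_Ico d hab, ← sum_fin_filter_Ico (entry d) hb]
  exact Finset.sum_congr rfl fun i _ => (entry_val d i).symm

theorem sum_mid_sub_one_eq (d : Fin n → ℕ) {a b : ℕ} (hab : a ≤ b) (hb : b ≤ n) :
    ∑ i : Fin n with a ≤ i.val ∧ i.val < b, ((d i : ℤ) - 1) =
      pre d b - pre d a - ((b : ℤ) - a) := by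
  have h := sum_fin_filter_Ico (n := n) (fun _ => (1 : ℤ)) (a := a) hb
  rw [Finset.sum_sub_distrib, sum_mid_eq d hab hb, h]
  simp [Nat.cast_sub hab]

theorem sum_low_eq (d : Fin n → ℕ) {b : ℕ} (hb : b ≤ n) :
    ∑ i : Fin n with i.val < b, (d i : ℤ) = pre d b := by
  have h := sum_mid_eq d (Nat.zero_le b) hb
  simpa [pre_zero] using h

theorem sum_low_min_eq {d : Fin n → ℕ} {b k t : ℕ} (hb : b ≤ n) (ht : IsCut d k t) :
    ∑ i : Fin n with i.val < b, min (k : ℤ) (d i : ℤ) =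
      (k : ℤ) * (min b t : ℕ) + pre d b - pre d (min b t) := by
  have h1 : ∑ i : Fin n with i.val < b, min (k : ℤ) (d i : ℤ) =
      ∑ i ∈ Finset.Ico 0 b, min (k : ℤ) (entry d i) := by
    rw [← sum_fin_filter_Ico (fun i => min (k : ℤ) (entry d i)) hb]
    simp [entry_val]
  have h2 : ∑ i ∈ Finset.Ico 0 (min b t), min (k : ℤ) (entry d i) =
      ∑ i ∈ Finset.Ico 0 (min b t), (k : ℤ) := Finset.sum_congr rfl fun i hi => by
    rw [Finset.mem_Ico] at hi
    exact min_eq_left ((ht.2 i (by omega)).1 (by omega))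
  have h3 : ∑ i ∈ Finset.Ico (min b t) b, min (k : ℤ) (entry d i) =
      ∑ i ∈ Finset.Ico (min b t) b, entry d i := Finset.sum_congr rfl fun i hi => by
    rw [Finset.mem_Ico] at hi
    have := ht.2 i (by omega)
    exact min_eq_right (by omega)
  rw [h1, ← Finset.sum_Ico_consecutive _ (Nat.zero_le _) (Nat.min_le_left b t), h2, h3,
    sum_entry_Ico d (Nat.min_le_left b t), Finset.sum_const, Nat.card_Ico, nsmul_eq_mul, Nat.sub_zero]
  ring

/-- The minimum is `k` exactly for entries of at least `k + 1`, hence the cut at `k + 1`; beyond it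
prefix sums take over. -/
theorem sum_high_min_eq {d : Fin n → ℕ} {a k t : ℕ} (ha : a ≤ n) (ht : IsCut d (k + 1) t) :
    ∑ i : Fin n with a ≤ i.val, min (k : ℤ) ((d i : ℤ) - 1) =
      (k : ℤ) * ((max a t : ℕ) - a) + pre d n - pre d (max a t) - ((n : ℤ) - (max a t : ℕ)) := by
  have h1 : ∑ i : Fin n with a ≤ i.val, min (k : ℤ) ((d i : ℤ) - 1) =
      ∑ i ∈ Finset.Ico a n, min (k : ℤ) (entry d i - 1) := by
    rw [← sum_fin_filter_Ico (fun i => min (k : ℤ) (entry d i - 1)) le_rfl]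
    simp [entry_val]
  have hmax : max a t ≤ n := max_le ha ht.1
  have h2 : ∑ i ∈ Finset.Ico a (max a t), min (k : ℤ) (entry d i - 1) =
      ∑ i ∈ Finset.Ico a (max a t), (k : ℤ) := Finset.sum_congr rfl fun i hi => by
    rw [Finset.mem_Ico] at hi
    have := (ht.2 i (by omega)).1 (by omega)
    push_cast at this
    exact min_eq_left (by omega)
  have h3 : ∑ i ∈ Finset.Ico (max a t) n, min (k : ℤ) (entry d i - 1) =
      ∑ i ∈ Finset.Ico (max a t) n, (entry d i - 1) := Finset.sum_congr rfl fun i hi => by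
    rw [Finset.mem_Ico] at hi
    have := ht.2 i (by omega)
    push_cast at this
    exact min_eq_right (by omega)
  rw [h1, ← Finset.sum_Ico_consecutive _ (Nat.le_max_left a t) hmax, h2, h3,
    Finset.sum_sub_distrib, sum_entry_Ico d hmax]
  simp only [Finset.sum_const, Nat.card_Ico, nsmul_eq_mul, mul_one]
  rw [Nat.cast_sub hmax, Nat.cast_sub (Nat.le_max_left a t)]
  ring

/-- Both systems of inequalities in terms of prefix sums. -/
theorem sys_iff {d : Fin n → ℕ} {γ k t u : ℕ} (hk : γ + k ≤ n) (ht : IsCut d k t)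
    (hu : IsCut d (k + 1) u) {x : ℤ}
    (hx : x = pre d (γ + k) - pre d γ - (k : ℤ) * ((k : ℤ) - 1)
      - (k : ℤ) * ((max (γ + k) u : ℕ) - ((γ : ℤ) + k)) - pre d n + pre d (max (γ + k) u)
      + ((n : ℤ) - (max (γ + k) u : ℕ))) :
    SysA d γ k ∧ SysC d γ k ↔ x ≤ (k : ℤ) - ((n : ℤ) - γ) + pre d γ ∧
      x ≤ (k : ℤ) * (min γ t : ℕ) + pre d γ - pre d (min γ t) := by
  unfold SysA SysC
  rw [sum_mid_sub_one_eq d (Nat.le_add_right γ k) hk, sum_mid_eq d (Nat.le_add_right γ k) hk,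
    sum_low_eq d (by omega), sum_low_min_eq (by omega) ht, sum_high_min_eq hk hu, hx]
  push_cast
  refine and_congr ⟨fun h => ?_, fun h => ?_⟩ ⟨fun h => ?_, fun h => ?_⟩ <;> linarith

end ClosedForms

/-! ### A program logic for the machine -/

section MachineLogic

/-- Program `p` started in `s` halts after at most `T` steps in a state that satisfies `Q`. -/
def Runs (W : ℤ) (p : RAMProg) (s : RAMState) (T : ℕ) (Q : RAMState → Prop) : Prop :=
  ∃ t s', RAMRun W p s t s' ∧ t ≤ T ∧ Q s'

/-- The state with registers `l` and memory `m`. -/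
def st (l : List ℤ) (m : ℤ → ℤ) : RAMState where
  reg r := l.getD r 0
  mem := m

variable {W : ℤ} {p q : RAMProg} {s : RAMState} {T T' : ℕ} {Q Q' : RAMState → Prop} {a b r : ℕ}
  {l : List ℤ} {m : ℤ → ℤ}

theorem Runs.mono (h : Runs W p s T Q) (hT : T ≤ T') (hQ : ∀ s', Q s' → Q' s') :
    Runs W p s T' Q' := by
  obtain ⟨t, s', h1, h2, h3⟩ := h
  exact ⟨t, s', h1, h2.trans hT, hQ _ h3⟩

theorem Runs.seq (h : Runs W p s T fun s' => Runs W q s' T' Q) :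
    Runs W (.seq p q) s (T + T') Q := by
  obtain ⟨t, s', h1, h2, t', s'', h3, h4, h5⟩ := h
  exact ⟨_, _, .seq h1 h3, by omega, h5⟩

theorem Runs.skip (h : Q s) : Runs W .skip s 1 Q := ⟨_, _, .skip s, le_rfl, h⟩

theorem Runs.instr {i : RAMInstr} (hi : |i.value s| ≤ W) (h : Q (i.exec s)) :
    Runs W (.instr i) s 1 Q := ⟨_, _, .instr i s hi, le_rfl, h⟩

theorem Runs.ite (h₁ : s.reg a ≤ s.reg b → Runs W p s T Q)
    (h₂ : ¬ s.reg a ≤ s.reg b → Runs W q s T Q) : Runs W (.ite a b p q) s (T + 1) Q := by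
  by_cases hab : s.reg a ≤ s.reg b
  · obtain ⟨t, s', h1, h2, h3⟩ := h₁ hab
    exact ⟨_, _, .ite_true hab h1, by omega, h3⟩
  · obtain ⟨t, s', h1, h2, h3⟩ := h₂ hab
    exact ⟨_, _, .ite_false hab h1, by omega, h3⟩

/-- The rule for loops, with an invariant indexed by a bound on the number of iterations. -/
theorem Runs.while {I : ℕ → RAMState → Prop}
    (hbody : ∀ v s, I v s → s.reg a ≤ s.reg b → Runs W p s T fun s' => ∃ v' < v, I v' s') :
    ∀ v s, I v s → Runs W (.while a b p) s (v * (T + 1) + 1)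
      fun s' => (∃ v', I v' s') ∧ ¬ s'.reg a ≤ s'.reg b := by
  intro v
  induction v using Nat.strong_induction_on with
  | _ v ih =>
    intro s hI
    by_cases hab : s.reg a ≤ s.reg b
    · obtain ⟨t, s', h1, h2, v', hv', hI'⟩ := hbody v s hI hab
      obtain ⟨t', s'', h3, h4, h5⟩ := ih v' hv' s' hI'
      refine ⟨_, _, .while_true hab h1 h3, ?_, h5⟩
      -- The drop of the index pays for one body and one test.
      have : (v' + 1) * (T + 1) ≤ v * (T + 1) := Nat.mul_le_mul_right _ hv'
      linarith
    · exact ⟨_, _, .while_false hab, by omega, ⟨v, hI⟩, hab⟩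

/-- A sequence of basic instructions. -/
def block : List RAMInstr → RAMProg
  | [] => .skip
  | i :: is => .seq (.instr i) (block is)

/-- The weakest precondition of a sequence of basic instructions. -/
def BlockPre (W : ℤ) (Q : RAMState → Prop) : List RAMInstr → List ℤ → (ℤ → ℤ) → Prop
  | [], l, m => Q (st l m)
  | .const r c :: is, l, m => r < l.length ∧ |c| ≤ W ∧ BlockPre W Q is (l.set r c) m
  | .add r a b :: is, l, m => r < l.length ∧ |l.getD a 0 + l.getD b 0| ≤ W ∧
      BlockPre W Q is (l.set r (l.getD a 0 + l.getD b 0)) m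
  | .sub r a b :: is, l, m => r < l.length ∧ |l.getD a 0 - l.getD b 0| ≤ W ∧
      BlockPre W Q is (l.set r (l.getD a 0 - l.getD b 0)) m
  | .mul r a b :: is, l, m => r < l.length ∧ |l.getD a 0 * l.getD b 0| ≤ W ∧
      BlockPre W Q is (l.set r (l.getD a 0 * l.getD b 0)) m
  | .half r a :: is, l, m => r < l.length ∧ |l.getD a 0 / 2| ≤ W ∧
      BlockPre W Q is (l.set r (l.getD a 0 / 2)) m
  | .load r a :: is, l, m => r < l.length ∧ |m (l.getD a 0)| ≤ W ∧
      BlockPre W Q is (l.set r (m (l.getD a 0))) m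
  | .store a b :: is, l, m => |l.getD b 0| ≤ W ∧
      BlockPre W Q is l (Function.update m (l.getD a 0) (l.getD b 0))

theorem update_st (hr : r < l.length) (v : ℤ) :
    ({ st l m with reg := Function.update (st l m).reg r v } : RAMState) = st (l.set r v) m := by
  refine congrArg (RAMState.mk · m) (funext fun x => ?_)
  simp only [st]
  by_cases hx : x = r
  · subst hx
    simp [List.getD_eq_getElem?_getD, hr]
  · simp [Function.update_of_ne hx, List.getD_eq_getElem?_getD, List.getElem?_set_ne (Ne.symm hx)]

theorem Runs.block {is : List RAMInstr} (h : BlockPre W Q is l m) :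
    Runs W (block is) (st l m) (is.length + 1) Q := by
  induction is generalizing l m with
  | nil => exact .skip h
  | cons i is ih =>
    rw [List.length_cons, add_comm (is.length) 1, add_assoc]
    refine .seq ?_
    cases i with
    | store a b => exact .instr h.1 (ih h.2)
    | _ =>
      have h' := ih h.2.2
      rw [← update_st h.1] at h'
      exact .instr h.2.1 h'

/-- The instruction `r := min a b`. -/
def minProg (z r a b : ℕ) : RAMProg := .ite a b (block [.add r a z]) (block [.add r b z])

theorem Runs.min {z : ℕ} (hr : r < l.length) (hz : l.getD z 0 = 0)
    (h : |min (l.getD a 0) (l.getD b 0)| ≤ W)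
    (hQ : Q (st (l.set r (min (l.getD a 0) (l.getD b 0))) m)) :
    Runs W (minProg z r a b) (st l m) 3 Q := by
  refine .ite (fun hab => .block ?_) (fun hab => .block ?_)
  · have hab : l.getD a 0 ≤ l.getD b 0 := hab
    rw [min_eq_left hab] at h hQ
    refine ⟨hr, ?_, ?_⟩ <;> rw [hz, add_zero]
    exacts [h, hQ]
  · have hab : ¬ l.getD a 0 ≤ l.getD b 0 := hab
    rw [min_eq_right (not_le.1 hab).le] at h hQ
    refine ⟨hr, ?_, ?_⟩ <;> rw [hz, add_zero]
    exacts [h, hQ]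

/-- The instruction `r := max a b`. -/
def maxProg (z r a b : ℕ) : RAMProg := .ite a b (block [.add r b z]) (block [.add r a z])

theorem Runs.max {z : ℕ} (hr : r < l.length) (hz : l.getD z 0 = 0)
    (h : |max (l.getD a 0) (l.getD b 0)| ≤ W)
    (hQ : Q (st (l.set r (max (l.getD a 0) (l.getD b 0))) m)) :
    Runs W (maxProg z r a b) (st l m) 3 Q := by
  refine .ite (fun hab => .block ?_) (fun hab => .block ?_)
  · have hab : l.getD a 0 ≤ l.getD b 0 := hab
    rw [max_eq_right hab] at h hQ
    refine ⟨hr, ?_, ?_⟩ <;> rw [hz, add_zero]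
    exacts [h, hQ]
  · have hab : ¬ l.getD a 0 ≤ l.getD b 0 := hab
    rw [max_eq_left (not_le.1 hab).le] at h hQ
    refine ⟨hr, ?_, ?_⟩ <;> rw [hz, add_zero]
    exacts [h, hQ]

end MachineLogic

/-! ### Computing the prefix sums and the cuts -/

section Tables

variable {W : ℤ} {n : ℕ} {d : Fin n → ℕ}

/-- The memory holds `d` from address `0` and its first prefix sums from address `n`. -/
def Sums (d : Fin n → ℕ) (j : ℕ) (m : ℤ → ℤ) : Prop :=
  (∀ i < n, m i = entry d i) ∧ ∀ i ≤ j, m (n + i) = pre d i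

/-- The memory holds the numbers of entries of `d` that are at least `0, …, k - 1` from
address `2 n + 1`. -/
def Cuts (d : Fin n → ℕ) (k : ℕ) (m : ℤ → ℤ) : Prop :=
  ∀ i < k, ∃ t : ℕ, IsCut d i t ∧ m (2 * n + 1 + i) = t

/-- The program that computes the prefix sums. -/
def sumsProg : RAMProg :=
  .seq (block [.const 6 1, .sub 7 0 6])
    (.while 2 7 (block [.load 11 2, .add 3 3 11, .add 2 2 6, .add 12 0 2, .store 12 3]))

theorem input_eq (d : Fin n → ℕ) :
    ∃ m, RAMState.input d = st [(n : ℤ), 0, 0, 0, 0, 0, 0, 0, 0, 0, 0, 0, 0, 0, 0, 0, 0, 0, 0] m ∧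
      Sums d 0 m := by
  refine ⟨(RAMState.input d).mem, ?_, fun i hi => ?_, fun i hi => ?_⟩
  · refine congrArg (RAMState.mk · (RAMState.input d).mem) (funext fun r => ?_)
    rcases r with _ | r
    · rfl
    · have : ∀ k r : ℕ, (List.replicate k (0 : ℤ)).getD r 0 = 0 := by
        intro k r
        rw [List.getD_eq_getElem?_getD, List.getElem?_replicate]
        split_ifs <;> rfl
      exact (this 18 r).symm
  · simp [RAMState.input, entry, hi]
  · obtain rfl : i = 0 := by omega
    simp [RAMState.input, pre_zero]

/-- Registers here and below: `0` holds `n`, `1` the tested `γ`, `2` the loop counter, `3` an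
accumulator or flag, `4` and `5` the search bounds, `6` the constant one, `7` the loop limit, `8`
the base address of the cuts, `9` the lower bound plus two, `10` zero; the rest is scratch. -/
theorem runs_sumsProg (hn : 2 ≤ n) (hd : ∀ i, d i < n) (hW : 100 * ((n : ℤ) * n) ≤ W) {m : ℤ → ℤ}
    (hm : Sums d 0 m) :
    Runs W sumsProg
      (st [(n : ℤ), 0, 0, 0, 0, 0, 0, 0, 0, 0, 0, 0, 0, 0, 0, 0, 0, 0, 0] m) (n * 7 + 4) fun s' =>
      ∃ x₁ x₂ x₃ x₄ x₅ m', s' =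
        st [(n : ℤ), 0, x₁, x₂, 0, 0, 1, x₃, 0, 0, 0, x₄, x₅, 0, 0, 0, 0, 0, 0] m' ∧ Sums d n m' := by
  have hn' : (2 : ℤ) ≤ n := by exact_mod_cast hn
  have hnn : 2 * (n : ℤ) ≤ n * n := by nlinarith
  have hsetup : Runs W (block [.const 6 1, .sub 7 0 6])
      (st [(n : ℤ), 0, 0, 0, 0, 0, 0, 0, 0, 0, 0, 0, 0, 0, 0, 0, 0, 0, 0] m) 3 fun s' =>
      s' = st [(n : ℤ), 0, 0, 0, 0, 0, 1, n - 1, 0, 0, 0, 0, 0, 0, 0, 0, 0, 0, 0] m := by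
    refine .block ?_
    simp only [BlockPre, List.getD_cons_zero, List.getD_cons_succ, List.set_cons_zero,
      List.set_cons_succ]
    refine ⟨by simp, ?_, by simp, ?_, trivial⟩ <;> rw [abs_le] <;> constructor <;> linarith
  have hloop := Runs.while (W := W) (a := 2) (b := 7) (T := 6)
    (p := block [.load 11 2, .add 3 3 11, .add 2 2 6, .add 12 0 2, .store 12 3])
    (I := fun v s => ∃ (j : ℕ) (x y : ℤ) (m' : ℤ → ℤ), v = n - j ∧ j ≤ n ∧ s =
      st [(n : ℤ), 0, j, pre d j, 0, 0, 1, n - 1, 0, 0, 0, x, y, 0, 0, 0, 0, 0, 0] m' ∧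
        Sums d j m') ?_
  · refine (hsetup.mono le_rfl ?_).seq.mono (T := 3 + (n * 7 + 1)) (by omega) fun _ h => h
    rintro _ rfl
    refine (hloop n _ ⟨0, 0, 0, m, by simp, by simp, by simp [pre_zero], hm⟩).mono (by omega) ?_
    rintro _ ⟨⟨-, j, x, y, m', -, hj, rfl, hm'⟩, hend⟩
    simp only [st, List.getD_cons_zero, List.getD_cons_succ] at hend
    obtain rfl : j = n := by omega
    exact ⟨_, _, _, _, _, m', rfl, hm'⟩
  · rintro _ _ ⟨j, x, y, m', rfl, hj, rfl, hm'⟩ hcond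
    simp only [st, List.getD_cons_zero, List.getD_cons_succ] at hcond
    have hjn : j < n := by omega
    refine .block ?_
    simp only [BlockPre, List.getD_cons_zero, List.getD_cons_succ, List.set_cons_zero,
      List.set_cons_succ, hm'.1 j hjn]
    have h1 := pre_nonneg d j
    have h2 := pre_le hd hj
    have h3 := pre_le hd (show j + 1 ≤ n from hjn)
    have h4 := pre_nonneg d (j + 1)
    rw [pre_succ] at h3 h4
    refine ⟨by simp, ?_, by simp, ?_, by simp, ?_, by simp, ?_, ?_, n - (j + 1), by omega,
      j + 1, entry d j, n + (j + 1), Function.update m' (n + (j + 1)) (pre d j + entry d j), rfl,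
      hjn, ?_, ?_⟩
    iterate 5 rw [abs_le]; constructor <;> linarith
    · rw [pre_succ]
      push_cast
      rfl
    · refine ⟨fun i hi => ?_, fun i hi => ?_⟩
      · rw [Function.update_of_ne (by omega)]
        exact hm'.1 i hi
      · by_cases hij : i = j + 1
        · subst hij
          push_cast
          rw [Function.update_self, pre_succ]
        · rw [Function.update_of_ne (by omega)]
          exact hm'.2 i (by omega)

/-- The program that computes the numbers of entries that are at least a given number. -/
def cutsProg : RAMProg :=
  .seq (block [.const 2 0, .add 3 0 10, .add 8 0 0, .add 8 8 6, .add 12 0 6, .add 12 12 6,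
      .sub 11 10 6, .store 11 12])
    (.while 2 0 (.seq (block [.sub 11 3 6, .load 12 11])
      (.ite 2 12 (block [.add 11 8 2, .store 11 3, .add 2 2 6]) (block [.sub 3 3 6]))))

theorem entry_antitone (hd : Antitone d) {i j : ℕ} (hij : i ≤ j) (hj : j < n) :
    entry d j ≤ entry d i := by
  simp only [entry, hj, hij.trans_lt hj, dif_pos]
  exact_mod_cast hd (show (⟨i, hij.trans_lt hj⟩ : Fin n) ≤ ⟨j, hj⟩ from hij)

/-- Two pointers: as `k` grows, the cut `t` can only fall. Each iteration lowers `n + 1 - k + t`, so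
the total time is linear. -/
theorem runs_cutsProg (hn : 2 ≤ n) (hanti : Antitone d) (hd : ∀ i, d i < n)
    (hW : 100 * ((n : ℤ) * n) ≤ W) {m : ℤ → ℤ} {x₁ x₂ x₃ x₄ x₅ : ℤ} (hm : Sums d n m) :
    Runs W cutsProg
      (st [(n : ℤ), 0, x₁, x₂, 0, 0, 1, x₃, 0, 0, 0, x₄, x₅, 0, 0, 0, 0, 0, 0] m)
      ((2 * n + 1) * 9 + 10) fun s' =>
      ∃ y₁ y₂ y₃ y₄ y₅ m', s' =
        st [(n : ℤ), 0, y₁, y₂, 0, 0, 1, y₃, 2 * n + 1, 0, 0, y₄, y₅, 0, 0, 0, 0, 0, 0] m' ∧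
        Sums d n m' ∧ Cuts d (n + 1) m' := by
  have hn' : (2 : ℤ) ≤ n := by exact_mod_cast hn
  have hnn : 2 * (n : ℤ) ≤ n * n := by nlinarith
  -- Address `-1` receives the sentinel `n + 2`, above every tested `k`, so that reading cell `t -
  -- 1` at `t = 0` ends the descent.
  have hsetup : Runs W (block [.const 2 0, .add 3 0 10, .add 8 0 0, .add 8 8 6, .add 12 0 6,
      .add 12 12 6, .sub 11 10 6, .store 11 12])
      (st [(n : ℤ), 0, x₁, x₂, 0, 0, 1, x₃, 0, 0, 0, x₄, x₅, 0, 0, 0, 0, 0, 0] m) 9 fun s' =>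
      ∃ m', s' = st [(n : ℤ), 0, 0, n, 0, 0, 1, x₃, 2 * n + 1, 0, 0, -1, n + 2, 0, 0, 0, 0, 0, 0] m'
        ∧ Sums d n m' ∧ m' (-1) = n + 2 := by
    refine .block ?_
    simp only [BlockPre, List.getD_cons_zero, List.getD_cons_succ, List.set_cons_zero,
      List.set_cons_succ]
    refine ⟨by simp, ?_, by simp, ?_, by simp, ?_, by simp, ?_, by simp, ?_, by simp,
      ?_, by simp, ?_, ?_, Function.update m (-1) (n + 2), ?_, ⟨fun i hi => ?_, fun i hi => ?_⟩,
      Function.update_self _ _ _⟩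
    iterate 8 rw [abs_le]; constructor <;> linarith
    · simp only [zero_sub, add_zero, add_assoc, two_mul, one_add_one_eq_two]
    · rw [Function.update_of_ne (by omega)]
      exact hm.1 i hi
    · rw [Function.update_of_ne (by omega)]
      exact hm.2 i hi
  have hloop := Runs.while (W := W) (a := 2) (b := 0) (T := 8)
    (p := .seq (block [.sub 11 3 6, .load 12 11])
      (.ite 2 12 (block [.add 11 8 2, .store 11 3, .add 2 2 6]) (block [.sub 3 3 6])))
    (I := fun v s => ∃ (k t : ℕ) (x y : ℤ) (m' : ℤ → ℤ), v = n + 1 - k + t ∧ k ≤ n + 1 ∧ t ≤ n ∧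
      s = st [(n : ℤ), 0, k, t, 0, 0, 1, x₃, 2 * n + 1, 0, 0, x, y, 0, 0, 0, 0, 0, 0] m' ∧
        Sums d n m' ∧ m' (-1) = n + 2 ∧ Cuts d k m' ∧ ∀ i < n, t ≤ i → entry d i < k) ?_
  · refine (hsetup.mono le_rfl ?_).seq.mono (T := 9 + ((2 * n + 1) * 9 + 1)) (by omega)
      fun _ h => h
    rintro _ ⟨m', rfl, h1, h2⟩
    refine (hloop (n + 1 - 0 + n) _ ⟨0, n, _, _, m', rfl, by simp, le_rfl, rfl, h1, h2,
      fun i hi => by omega, fun i hi hi' => by omega⟩).mono (by omega) ?_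
    rintro _ ⟨⟨-, k, t, x, y, m', -, hk, ht, rfl, h3, h4, h5, -⟩, hend⟩
    simp only [st, List.getD_cons_zero, List.getD_cons_succ] at hend
    obtain rfl : k = n + 1 := by omega
    exact ⟨_, _, _, _, _, m', rfl, h3, h5⟩
  · rintro _ _ ⟨k, t, x, y, m', rfl, hk, ht, rfl, h1, h2, h3, h4⟩ hcond
    simp only [st, List.getD_cons_zero, List.getD_cons_succ] at hcond
    have hkn : k ≤ n := by omega
    obtain ⟨e, he, he0, hen, het⟩ : ∃ e, m' (t - 1) = e ∧ 0 ≤ e ∧ e ≤ n + 2 ∧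
        ((k : ℤ) ≤ e ↔ IsCut d k t) := by
      refine ⟨_, rfl, ?_⟩
      rcases t with _ | t
      · have : ((0 : ℕ) : ℤ) - 1 = -1 := by simp
        rw [this, h2]
        refine ⟨by omega, le_rfl, iff_of_true (by omega) ⟨by omega, fun i hi => ?_⟩⟩
        have := h4 i hi (by omega)
        omega
      · have : ((t + 1 : ℕ) : ℤ) - 1 = t := by simp
        have hv := entry_val d ⟨t, ht⟩
        have hb := hd ⟨t, ht⟩
        simp only at hv
        rw [this, h1.1 t ht]
        refine ⟨by omega, by omega, fun h => ⟨ht, fun i hi => ⟨fun hit => ?_, fun hki => ?_⟩⟩,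
          fun h => (h.2 t ht).1 (by omega)⟩
        · exact h.trans (entry_antitone hanti (by omega) ht)
        · by_contra hit
          have := h4 i hi (by omega)
          omega
    refine Runs.seq (T := 3) (T' := 5) (.block ?_)
    simp only [BlockPre, List.getD_cons_zero, List.getD_cons_succ, List.set_cons_zero,
      List.set_cons_succ, he]
    refine ⟨by simp, by rw [abs_le]; constructor <;> linarith, by simp,
      by rw [abs_le]; constructor <;> linarith, .ite (fun hke => .block ?_) fun hke =>
      (Runs.block ?_).mono (T := 2) (by omega) fun _ h => h⟩
    · simp only [st, List.getD_cons_zero, List.getD_cons_succ] at hke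
      simp only [BlockPre, List.getD_cons_zero, List.getD_cons_succ, List.set_cons_zero,
        List.set_cons_succ]
      refine ⟨by simp, ?_, ?_, by simp, ?_, n + 1 - (k + 1) + t, by omega, k + 1, t, _, _, _,
        rfl, by omega, ht, by push_cast; rfl, ⟨fun i hi => ?_, fun i hi => ?_⟩, ?_,
        fun i hi => ?_, fun i hi hti => ?_⟩
      iterate 3 rw [abs_le]; constructor <;> linarith
      · rw [Function.update_of_ne (by omega)]
        exact h1.1 i hi
      · rw [Function.update_of_ne (by omega)]
        exact h1.2 i hi
      · rw [Function.update_of_ne (by omega)]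
        exact h2
      · by_cases hik : i = k
        · subst hik
          exact ⟨t, het.1 hke, Function.update_self _ _ _⟩
        · rw [Function.update_of_ne (by omega)]
          exact h3 i (by omega)
      · have := h4 i hi hti
        push_cast
        omega
    · simp only [st, List.getD_cons_zero, List.getD_cons_succ] at hke
      simp only [BlockPre, List.getD_cons_zero, List.getD_cons_succ, List.set_cons_zero,
        List.set_cons_succ]
      have ht0 : t ≠ 0 := by
        rintro rfl
        have : ((0 : ℕ) : ℤ) - 1 = -1 := by simp
        rw [this, h2] at he
        omega
      refine ⟨by simp, ?_, n + 1 - k + (t - 1), by omega, k, t - 1, t - 1, e, m', rfl, hk,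
        by omega, ?_, h1, h2, h3, fun i hi hti => ?_⟩
      · rw [abs_le]; constructor <;> linarith
      · rw [Nat.cast_sub (by omega), Nat.cast_one]
      · by_cases hit : t ≤ i
        · exact h4 i hi hit
        · obtain rfl : i = t - 1 := by omega
          rw [← h1.1 _ hi, Nat.cast_sub (by omega), Nat.cast_one, he]
          omega

end Tables

/-! ### Testing the inequalities, and binary search -/

section Search

variable {W : ℤ} {n : ℕ} {d : Fin n → ℕ}

/-- The instructions that evaluate both inequalities. -/
def evalInstrs : List RAMInstr :=
  [.add 12 0 11, .load 15 12, .add 12 0 1, .load 16 12, .sub 15 15 16, .sub 12 2 6, .mul 12 2 12,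
    .sub 15 15 12, .sub 12 14 11, .mul 12 2 12, .sub 15 15 12, .add 12 0 0, .load 12 12,
    .sub 15 15 12, .add 12 0 14, .load 12 12, .add 15 15 12, .sub 12 0 14, .add 15 15 12,
    .sub 17 2 7, .add 17 17 16, .mul 18 2 13, .add 18 18 16, .add 12 0 13, .load 12 12,
    .sub 18 18 12]

/-- Registers `15`, `17` and `18` receive the common left side and the two right sides of `sys_iff`.
Every intermediate value combines a few terms of size at most `N * N`, which the generous factor
`100` covers. -/
theorem runs_evalInstrs {N g k r₃ r₄ r₅ L r₈ r₉ j r₁₂ M P r₁₅ r₁₆ r₁₇ r₁₈ A B E F H : ℤ}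
    {m : ℤ → ℤ} (hW : 100 * (N * N) ≤ W) (hN : 1 ≤ N) (hg : 0 ≤ g ∧ g ≤ N) (hk : 0 ≤ k ∧ k ≤ N)
    (hL : 0 ≤ L ∧ L ≤ N) (hj : 0 ≤ j ∧ j ≤ N) (hM : 0 ≤ M ∧ M ≤ N) (hP : 0 ≤ P ∧ P ≤ N)
    (hA : m (N + j) = A) (hB : m (N + g) = B) (hE : m (N + N) = E) (hF : m (N + P) = F)
    (hH : m (N + M) = H) (hA' : 0 ≤ A ∧ A ≤ N * N) (hB' : 0 ≤ B ∧ B ≤ N * N)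
    (hE' : 0 ≤ E ∧ E ≤ N * N) (hF' : 0 ≤ F ∧ F ≤ N * N) (hH' : 0 ≤ H ∧ H ≤ N * N) :
    Runs W (block evalInstrs)
      (st [N, g, k, r₃, r₄, r₅, 1, L, r₈, r₉, 0, j, r₁₂, M, P, r₁₅, r₁₆, r₁₇, r₁₈] m) 27 fun s' =>
      s' = st [N, g, k, r₃, r₄, r₅, 1, L, r₈, r₉, 0, j, H, M, P,
        A - B - k * (k - 1) - k * (P - j) - E + F + (N - P), B, k - L + B, k * M + B - H] m := by
  have hmul : ∀ {x y : ℤ}, 0 ≤ x ∧ x ≤ N → 0 ≤ y ∧ y ≤ N → 0 ≤ x * y ∧ x * y ≤ N * N :=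
    fun hx hy => ⟨mul_nonneg hx.1 hy.1, mul_le_mul hx.2 hy.2 hy.1 (by linarith)⟩
  have h1 := hmul hk hk
  have h2 := hmul hk hP
  have h3 := hmul hk hj
  have h4 := hmul hk hM
  have h5 : N ≤ N * N := by nlinarith
  refine .block ?_
  simp only [evalInstrs, BlockPre, List.getD_cons_zero, List.getD_cons_succ, List.set_cons_zero,
    List.set_cons_succ, List.length_cons, List.length_nil, hA, hB, hE, hF, hH]
  norm_num only [abs_le, true_and, and_true]
  refine ⟨?_, ?_, ?_, ?_, ?_, ?_, ?_, ?_, ?_, ?_, ?_, ?_, ?_, ?_, ?_, ?_, ?_, ?_, ?_, ?_, ?_, ?_,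
    ?_, ?_, ?_, ?_⟩
  all_goals constructor <;> linarith

/-- The loop body that tests both inequalities for one `k`. -/
def checkProg : RAMProg :=
  .seq (block [.add 11 1 2, .add 12 8 2, .load 13 12, .add 12 12 6, .load 14 12])
    (.seq (minProg 10 13 1 13) (.seq (maxProg 10 14 11 14) (.seq (block evalInstrs)
      (.seq (.ite 15 17 (.ite 15 18 .skip (block [.const 3 1])) (block [.const 3 1]))
        (block [.add 2 2 6])))))

/-- Register `3` is a failure flag, raised by a violated inequality and never lowered. Since `γ` is
positive, `k + 1` stays within the table of cuts. -/
theorem runs_checkProg (hn : 2 ≤ n) (hd : ∀ i, d i < n) (hW : 100 * ((n : ℤ) * n) ≤ W)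
    {m : ℤ → ℤ} (hm : Sums d n m) (hm' : Cuts d (n + 1) m) {γ k : ℕ} (hγ : 1 ≤ γ)
    (hk : γ + k ≤ n) {b r₄ r₅ r₉ x₁ x₂ x₃ x₄ x₅ x₆ x₇ x₈ : ℤ} :
    Runs W checkProg (st [(n : ℤ), γ, k, b, r₄, r₅, 1, n - γ, 2 * n + 1, r₉, 0,
      x₁, x₂, x₃, x₄, x₅, x₆, x₇, x₈] m) 45 fun s' =>
      ∃ b' y₁ y₂ y₃ y₄ y₅ y₆ y₇ y₈, s' = st [(n : ℤ), γ, (k + 1 : ℕ), b', r₄, r₅, 1, n - γ,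
        2 * n + 1, r₉, 0, y₁, y₂, y₃, y₄, y₅, y₆, y₇, y₈] m ∧
        (b' ≤ 0 ↔ b ≤ 0 ∧ SysA d γ k ∧ SysC d γ k) := by
  have hn' : (2 : ℤ) ≤ n := by exact_mod_cast hn
  have hnn : 2 * (n : ℤ) ≤ n * n := by nlinarith
  obtain ⟨t, ht, hmt⟩ := hm' k (by omega)
  obtain ⟨u, hu, hmu⟩ := hm' (k + 1) (by omega)
  rw [Nat.cast_succ, ← add_assoc] at hmu
  have htn := ht.1
  have hun := hu.1
  have hsys := sys_iff hk ht hu rfl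
  set M := min γ t with hM
  set P := max (γ + k) u with hP
  have hMn : M ≤ n := by omega
  have hPn : P ≤ n := by omega
  have hS : ∀ i ≤ n, 0 ≤ pre d i ∧ pre d i ≤ (n : ℤ) * n := fun i hi =>
    ⟨pre_nonneg d i, pre_le hd hi⟩
  refine Runs.seq (T := 6) (T' := 39) (.block ?_)
  simp only [BlockPre, List.getD_cons_zero, List.getD_cons_succ, List.set_cons_zero,
    List.set_cons_succ, hmt, hmu]
  refine ⟨by simp, ?_, by simp, ?_, by simp, ?_, by simp, ?_, by simp, ?_, ?_⟩
  iterate 5 rw [abs_le]; constructor <;> linarith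
  refine Runs.seq (T := 3) (T' := 36) (.min (by simp) (by simp) ?_ ?_)
  · simp only [List.getD_cons_zero, List.getD_cons_succ]
    rw [← Nat.cast_min, ← hM, abs_le]
    constructor <;> linarith
  simp only [List.getD_cons_zero, List.getD_cons_succ, List.set_cons_zero, List.set_cons_succ]
  rw [← Nat.cast_min, ← hM]
  refine Runs.seq (T := 3) (T' := 33) (.max (by simp) (by simp) ?_ ?_)
  · simp only [List.getD_cons_zero, List.getD_cons_succ]
    rw [← Nat.cast_add, ← Nat.cast_max, ← hP, abs_le]
    constructor <;> linarith
  simp only [List.getD_cons_zero, List.getD_cons_succ, List.set_cons_zero, List.set_cons_succ]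
  rw [← Nat.cast_add, ← Nat.cast_max, ← hP]
  refine Runs.seq (T := 27) (T' := 6) ((runs_evalInstrs hW (by omega) (by omega) (by omega)
    (by omega) (by omega) (by omega) (by omega) (hm.2 _ hk) (hm.2 γ (by omega)) (hm.2 n le_rfl)
    (hm.2 P hPn) (hm.2 M hMn) (hS _ hk) (hS _ (by omega)) (hS _ le_rfl) (hS _ hPn)
    (hS _ hMn)).mono le_rfl ?_)
  rintro _ rfl
  rw [Nat.cast_add] at *
  generalize hX : pre d (γ + k) - pre d γ - (k : ℤ) * ((k : ℤ) - 1) -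
    (k : ℤ) * ((P : ℤ) - ((γ : ℤ) + k)) - pre d n + pre d P + ((n : ℤ) - P) = X at *
  have hfinal : ∀ {b' y₁ y₂ y₃ y₄ y₅ y₆ y₇ y₈ : ℤ}, (b' ≤ 0 ↔ b ≤ 0 ∧ SysA d γ k ∧ SysC d γ k) →
      Runs W (block [.add 2 2 6]) (st [(n : ℤ), γ, k, b', r₄, r₅, 1, n - γ, 2 * n + 1, r₉, 0,
        y₁, y₂, y₃, y₄, y₅, y₆, y₇, y₈] m) 2 fun s' =>
      ∃ b' y₁ y₂ y₃ y₄ y₅ y₆ y₇ y₈, s' = st [(n : ℤ), γ, (k + 1 : ℕ), b', r₄, r₅, 1, n - γ,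
        2 * n + 1, r₉, 0, y₁, y₂, y₃, y₄, y₅, y₆, y₇, y₈] m ∧
        (b' ≤ 0 ↔ b ≤ 0 ∧ SysA d γ k ∧ SysC d γ k) := by
    intro b' y₁ y₂ y₃ y₄ y₅ y₆ y₇ y₈ hb'
    refine .block ?_
    simp only [BlockPre, List.getD_cons_zero, List.getD_cons_succ, List.set_cons_zero,
      List.set_cons_succ]
    refine ⟨by simp, ?_, b', y₁, y₂, y₃, y₄, y₅, y₆, y₇, y₈, by rw [Nat.cast_succ], hb'⟩
    rw [abs_le]
    constructor <;> linarith
  refine Runs.seq (T := 4) (T' := 2) (.ite (fun h1 => .ite (fun h2 => (Runs.skip ?_).mono (T := 1)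
    (by omega) fun _ h => h) fun h2 => .block ?_) fun h1 => (Runs.block ?_).mono (T := 2) (by omega)
    fun _ h => h)
  · simp only [st, List.getD_cons_zero, List.getD_cons_succ] at h1 h2
    exact hfinal (by rw [hsys]; tauto)
  · simp only [st, List.getD_cons_zero, List.getD_cons_succ] at h1 h2
    simp only [BlockPre, List.set_cons_zero, List.set_cons_succ]
    refine ⟨by simp, ?_, hfinal ?_⟩
    · rw [abs_one]
      linarith
    · rw [hsys]
      exact iff_of_false (by norm_num) (by tauto)
  · simp only [st, List.getD_cons_zero, List.getD_cons_succ] at h1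
    simp only [BlockPre, List.set_cons_zero, List.set_cons_succ]
    refine ⟨by simp, ?_, hfinal ?_⟩
    · rw [abs_one]
      linarith
    · rw [hsys]
      exact iff_of_false (by norm_num) (by tauto)

theorem runs_checkLoop (hn : 2 ≤ n) (hanti : Antitone d) (hpos : ∀ i, 0 < d i)
    (hG : IsGraphic d) (hW : 100 * ((n : ℤ) * n) ≤ W)
    {m : ℤ → ℤ} (hm : Sums d n m) (hm' : Cuts d (n + 1) m) {γ : ℕ} (hγ : 1 ≤ γ) (hγn : γ ≤ n)
    {r₄ r₅ r₉ x₁ x₂ x₃ x₄ x₅ x₆ x₇ x₈ : ℤ} :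
    Runs W (.while 2 7 checkProg) (st [(n : ℤ), γ, 0, 0, r₄, r₅, 1, n - γ, 2 * n + 1, r₉, 0,
      x₁, x₂, x₃, x₄, x₅, x₆, x₇, x₈] m) (n * 46 + 1) fun s' =>
      ∃ k b y₁ y₂ y₃ y₄ y₅ y₆ y₇ y₈, s' = st [(n : ℤ), γ, k, b, r₄, r₅, 1, n - γ,
        2 * n + 1, r₉, 0, y₁, y₂, y₃, y₄, y₅, y₆, y₇, y₈] m ∧ (b ≤ 0 ↔ HasDom d γ) := by
  have hloop := Runs.while (W := W) (a := 2) (b := 7) (T := 45) (p := checkProg)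
    (I := fun v s => ∃ (k : ℕ) (b y₁ y₂ y₃ y₄ y₅ y₆ y₇ y₈ : ℤ), v = n - γ + 1 - k ∧
      k ≤ n - γ + 1 ∧ s = st [(n : ℤ), γ, k, b, r₄, r₅, 1, n - γ,
        2 * n + 1, r₉, 0, y₁, y₂, y₃, y₄, y₅, y₆, y₇, y₈] m ∧
        (b ≤ 0 ↔ ∀ i < k, SysA d γ i ∧ SysC d γ i)) ?_
  · refine (hloop (n - γ + 1) _ ⟨0, 0, x₁, x₂, x₃, x₄, x₅, x₆, x₇, x₈, rfl, Nat.zero_le _, rfl,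
      by simp⟩).mono (by gcongr; omega) ?_
    rintro _ ⟨⟨-, k, b, y₁, y₂, y₃, y₄, y₅, y₆, y₇, y₈, -, hk, rfl, hb⟩, hend⟩
    simp only [st, List.getD_cons_zero, List.getD_cons_succ] at hend
    refine ⟨k, b, y₁, y₂, y₃, y₄, y₅, y₆, y₇, y₈, rfl, ?_⟩
    rw [hb, hasDom_iff_of_isGraphic hanti hpos hγn hG]
    obtain rfl : k = n - γ + 1 := by omega
    simp only [Nat.lt_succ_iff]
  · rintro _ _ ⟨k, b, y₁, y₂, y₃, y₄, y₅, y₆, y₇, y₈, rfl, hk, rfl, hb⟩ hcond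
    simp only [st, List.getD_cons_zero, List.getD_cons_succ] at hcond
    refine (runs_checkProg hn (IsGraphic.lt hG) hW hm hm' hγ (k := k) (by omega)).mono le_rfl ?_
    rintro _ ⟨b', z₁, z₂, z₃, z₄, z₅, z₆, z₇, z₈, rfl, hb'⟩
    refine ⟨n - γ + 1 - (k + 1), by omega, k + 1, b', z₁, z₂, z₃, z₄, z₅, z₆, z₇, z₈, rfl,
      by omega, rfl, ?_⟩
    rw [hb', hb]
    simp only [Nat.lt_succ_iff_lt_or_eq, or_imp, forall_and, forall_eq]
    tauto

/-- One step of the binary search. -/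
def bisectProg : RAMProg :=
  .seq (block [.add 1 4 5, .half 1 1, .const 3 0, .const 2 0, .sub 7 0 1])
    (.seq (.while 2 7 checkProg)
      (.seq (.ite 3 10 (block [.add 5 1 10]) (block [.add 4 1 10]))
        (block [.add 9 4 6, .add 9 9 6])))

/-- The binary search. -/
def searchProg : RAMProg :=
  .seq (block [.add 5 0 10, .const 9 2]) (.seq (.while 9 5 bisectProg) (block [.add 0 5 10]))

/-- Bisection leaves at most half the width, rounded up, so the rounded-up logarithm bounds the
remaining rounds. -/
theorem clog_half_lt {w w' : ℕ} (hw : 2 ≤ w) (hw' : w' ≤ (w + 1) / 2) :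
    Nat.clog 2 w' < Nat.clog 2 w := by
  rw [Nat.clog_of_two_le one_lt_two hw]
  exact Nat.lt_succ_of_le (Nat.clog_mono_right 2 hw')

/-- The lower bound always fails and the upper one always succeeds, starting from `0` and `n`.
Register `9` is two above the lower bound, so the loop runs while the gap is at least two. -/
theorem runs_searchProg (hn : 2 ≤ n) (hanti : Antitone d) (hpos : ∀ i, 0 < d i)
    (hG : IsGraphic d) (hW : 100 * ((n : ℤ) * n) ≤ W)
    {m : ℤ → ℤ} (hm : Sums d n m) (hm' : Cuts d (n + 1) m) {x₁ x₂ x₃ x₄ x₅ : ℤ} :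
    Runs W searchProg (st [(n : ℤ), 0, x₁, x₂, 0, 0, 1, x₃, 2 * n + 1, 0, 0, x₄, x₅,
      0, 0, 0, 0, 0, 0] m) (Nat.clog 2 n * (46 * n + 14) + 6) fun s' => s'.reg 0 = seqMDS d := by
  have hn' : (2 : ℤ) ≤ n := by exact_mod_cast hn
  have hnn : 2 * (n : ℤ) ≤ n * n := by nlinarith
  have hloop := Runs.while (W := W) (a := 9) (b := 5) (T := 46 * n + 13) (p := bisectProg)
    (I := fun v s => ∃ (lo hi : ℕ) (r₁ r₂ r₃ r₇ y₁ y₂ y₃ y₄ y₅ y₆ y₇ y₈ : ℤ),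
      v = Nat.clog 2 (hi - lo) ∧ lo < hi ∧ hi ≤ n ∧ ¬ HasDom d lo ∧ HasDom d hi ∧
      s = st [(n : ℤ), r₁, r₂, r₃, lo, hi, 1, r₇, 2 * n + 1, lo + 2, 0,
        y₁, y₂, y₃, y₄, y₅, y₆, y₇, y₈] m) ?_
  · refine Runs.mono (T := 3 + ((Nat.clog 2 n * (46 * n + 14) + 1) + 2)) (.seq (.block ?_))
      (by omega) fun _ h => h
    simp only [BlockPre, List.getD_cons_zero, List.getD_cons_succ, List.set_cons_zero,
      List.set_cons_succ]
    refine ⟨by simp, ?_, by simp, ?_, .seq ((hloop _ _ ⟨0, n, 0, x₁, x₂, x₃, x₄, x₅, 0, 0, 0, 0, 0,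
      0, rfl, by omega, le_rfl, not_hasDom_zero (by omega), IsGraphic.hasDom hG, by simp⟩).mono le_rfl ?_)⟩
    iterate 2 rw [abs_le]; constructor <;> linarith
    rintro _ ⟨⟨-, lo, hi, r₁, r₂, r₃, r₇, y₁, y₂, y₃, y₄, y₅, y₆, y₇, y₈, -, hlt, hhi, hlo, hdom,
      rfl⟩, hend⟩
    simp only [st, List.getD_cons_zero, List.getD_cons_succ] at hend
    obtain rfl : hi = lo + 1 := by omega
    refine .block ?_
    simp only [BlockPre, List.getD_cons_zero, List.getD_cons_succ, List.set_cons_zero]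
    refine ⟨by simp, ?_, ?_⟩
    · rw [abs_le]
      push_cast
      constructor <;> linarith
    · rw [seqMDS_eq_of_hasDom_succ hG (by omega) hlo hdom]
      simp [st]
  · rintro _ _ ⟨lo, hi, r₁, r₂, r₃, r₇, y₁, y₂, y₃, y₄, y₅, y₆, y₇, y₈, rfl, hlt, hhi, hlo, hdom,
      rfl⟩ hcond
    simp only [st, List.getD_cons_zero, List.getD_cons_succ] at hcond
    -- With a gap of at least two the midpoint lies strictly between the bounds. In particular it is
    -- positive, as the test requires.
    obtain ⟨γ, hγ⟩ : ∃ γ, γ = (lo + hi) / 2 := ⟨_, rfl⟩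
    have hγ' : ((lo : ℤ) + hi) / 2 = γ := by omega
    have hγn : (γ : ℤ) ≤ n := by omega
    refine Runs.mono (T := 6 + ((n * 46 + 1) + (3 + 3))) (.seq (.block ?_)) (by omega) fun _ h => h
    simp only [BlockPre, List.getD_cons_zero, List.getD_cons_succ, List.set_cons_zero,
      List.set_cons_succ, hγ']
    refine ⟨by simp, ?_, by simp, ?_, by simp, ?_, by simp, ?_, by simp, ?_, .seq ((runs_checkLoop
      hn hanti hpos hG hW hm hm' (γ := γ) (by omega) (by omega)).mono le_rfl ?_)⟩
    iterate 5 rw [abs_le]; constructor <;> linarith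
    rintro _ ⟨k, b, z₁, z₂, z₃, z₄, z₅, z₆, z₇, z₈, rfl, hb⟩
    have hfinal : ∀ {lo' hi' : ℕ}, hi' - lo' ≤ (hi - lo + 1) / 2 → lo' < hi' → hi' ≤ n →
        ¬ HasDom d lo' → HasDom d hi' → ∀ w : ℤ, Runs W (block [.add 9 4 6, .add 9 9 6])
        (st [(n : ℤ), γ, k, b, lo', hi', 1, n - γ, 2 * n + 1, w, 0,
          z₁, z₂, z₃, z₄, z₅, z₆, z₇, z₈] m) 3 fun s' => ∃ v' < Nat.clog 2 (hi - lo),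
        ∃ (lo hi : ℕ) (r₁ r₂ r₃ r₇ y₁ y₂ y₃ y₄ y₅ y₆ y₇ y₈ : ℤ),
        v' = Nat.clog 2 (hi - lo) ∧ lo < hi ∧ hi ≤ n ∧ ¬ HasDom d lo ∧ HasDom d hi ∧
        s' = st [(n : ℤ), r₁, r₂, r₃, lo, hi, 1, r₇, 2 * n + 1, lo + 2, 0,
          y₁, y₂, y₃, y₄, y₅, y₆, y₇, y₈] m := by
      intro lo' hi' hw hlt' hhi' hlo' hdom' w
      refine .block ?_
      simp only [BlockPre, List.getD_cons_zero, List.getD_cons_succ, List.set_cons_zero,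
        List.set_cons_succ]
      refine ⟨by simp, ?_, by simp, ?_, _, clog_half_lt (by omega) hw, lo', hi', γ, k, b, n - γ,
        z₁, z₂, z₃, z₄, z₅, z₆, z₇, z₈, rfl, hlt', hhi', hlo', hdom', ?_⟩
      iterate 2 rw [abs_le]; constructor <;> linarith
      rw [add_assoc, one_add_one_eq_two]
    refine Runs.seq (.ite (T := 2) (fun h => .block ?_) fun h => .block ?_)
    · simp only [st, List.getD_cons_zero, List.getD_cons_succ] at h
      simp only [BlockPre, List.getD_cons_zero, List.getD_cons_succ, List.set_cons_zero,
        List.set_cons_succ, add_zero]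
      refine ⟨by simp, ?_, hfinal (by omega) (by omega) (by omega) hlo (hb.1 h) _⟩
      rw [abs_le]
      constructor <;> linarith
    · simp only [st, List.getD_cons_zero, List.getD_cons_succ] at h
      simp only [BlockPre, List.getD_cons_zero, List.getD_cons_succ, List.set_cons_zero,
        List.set_cons_succ, add_zero]
      refine ⟨by simp, ?_, hfinal (by omega) (by omega) (by omega) (mt hb.2 h) hdom _⟩
      rw [abs_le]
      constructor <;> linarith

/-- The program that computes the minimum. -/
def mdsProg : RAMProg := .seq sumsProg (.seq cutsProg searchProg)

theorem runs_mdsProg (hn : 2 ≤ n) (hanti : Antitone d) (hpos : ∀ i, 0 < d i)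
    (hG : IsGraphic d) (hW : 100 * ((n : ℤ) * n) ≤ W) :
    Runs W mdsProg (RAMState.input d) (100 * (n * Nat.clog 2 n)) fun s' =>
      s'.reg 0 = seqMDS d := by
  obtain ⟨m, hinput, hm⟩ := input_eq d
  have hclog : 0 < Nat.clog 2 n := Nat.clog_pos one_lt_two hn
  rw [hinput]
  refine Runs.mono (T := (n * 7 + 4) + (((2 * n + 1) * 9 + 10) +
    (Nat.clog 2 n * (46 * n + 14) + 6))) (.seq ((runs_sumsProg hn (IsGraphic.lt hG) hW hm).mono le_rfl ?_)) ?_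
    fun _ h => h
  · rintro _ ⟨x₁, x₂, x₃, x₄, x₅, m', rfl, hm'⟩
    refine .seq ((runs_cutsProg hn hanti (IsGraphic.lt hG) hW hm').mono le_rfl ?_)
    rintro _ ⟨y₁, y₂, y₃, y₄, y₅, m'', rfl, h1, h2⟩
    exact runs_searchProg hn hanti hpos hG hW h1 h2
  · nlinarith

end Search

/-! ### Numerical bounds and the main theorem -/

theorem clog_two_le_log {n : ℕ} (hn : 2 ≤ n) : (Nat.clog 2 n : ℝ) ≤ 4 * Real.log n := by
  have h1 : (Nat.clog 2 n : ℝ) ≤ Nat.log 2 n + 1 := by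
    have : Nat.clog 2 n ≤ Nat.log 2 n + 1 :=
      Nat.clog_le_of_le_pow (Nat.lt_pow_succ_log_self one_lt_two n).le
    exact_mod_cast this
  have h2 : (Nat.log 2 n : ℝ) * Real.log 2 ≤ Real.log n := by
    rw [← Real.log_pow]
    exact Real.log_le_log (by positivity) (by exact_mod_cast Nat.pow_log_le_self 2 (by omega))
  have h3 : Real.log 2 ≤ Real.log n := Real.log_le_log (by norm_num) (by exact_mod_cast hn)
  have h4 := Real.log_two_gt_d9
  have h5 : (0 : ℝ) ≤ Nat.log 2 n := by positivity
  -- Both `Nat.log 2 n` and `1` are at most `log n / log 2`, and `2 / log 2 < 4`.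
  nlinarith

theorem hundred_mul_sq_le_pow {n : ℕ} (hn : 2 ≤ n) :
    100 * ((n : ℤ) * n) ≤ (n : ℤ) ^ 400 := by
  have h1 : (2 : ℤ) ≤ n := by exact_mod_cast hn
  have h2 : (2 : ℤ) ^ 7 ≤ (n : ℤ) ^ 7 := pow_le_pow_left₀ (by norm_num) h1 7
  have h3 : (n : ℤ) ^ 9 ≤ (n : ℤ) ^ 400 := pow_le_pow_right₀ (by linarith) (by norm_num)
  nlinarith [mul_self_nonneg (n : ℤ)]

end DegreeDomination

open DegreeDomination in
theorem mainTheorem1 :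
    (∀ (n : ℕ) (hn : 0 < n) (d : Fin n → ℕ), Antitone d → (∀ i, 0 < d i) →
      ∀ γ : ℕ, γ ≤ n →
        ((∃ G : SimpleGraph (Fin n), Realizes G d ∧
            ∃ D : Finset (Fin n), IsDominatingSet G D ∧ D.card = γ) ↔
          Even (∑ i, d i) ∧
          (∀ k : ℕ, k ≤ n - γ →
            ∑ i : Fin n with γ ≤ i.val ∧ i.val < γ + k, ((d i : ℤ) - 1) ≤
              (k : ℤ) * ((k : ℤ) - 1) - ((n : ℤ) - (γ : ℤ))
                + ∑ i : Fin n with i.val < γ, (d i : ℤ)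
                + ∑ i : Fin n with γ + k ≤ i.val, min (k : ℤ) ((d i : ℤ) - 1)) ∧
          (∀ k : ℕ, k ≤ n →
            ∑ i : Fin n with i.val < k, (d i : ℤ) ≤
              (k : ℤ) * ((k : ℤ) - 1) + ∑ i : Fin n with k ≤ i.val, min (k : ℤ) (d i : ℤ)) ∧
          (∀ k : ℕ, k ≤ d ⟨0, hn⟩ →
            ∑ i : Fin n with γ ≤ i.val ∧ i.val < γ + k, (d i : ℤ) ≤
              (k : ℤ) * ((k : ℤ) - 1)
                + ∑ i : Fin n with i.val < γ, min (k : ℤ) (d i : ℤ)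
                + ∑ i : Fin n with γ + k ≤ i.val, min (k : ℤ) ((d i : ℤ) - 1)))) ∧
    (∃ (p : RAMProg) (C : ℕ), ∀ (n : ℕ) (d : Fin n → ℕ), 0 < n → Antitone d → (∀ i, 0 < d i) →
      IsGraphic d →
        ∃ (t : ℕ) (s : RAMState),
          RAMRun ((n : ℤ) ^ C) p (RAMState.input d) t s ∧
          s.reg 0 = (seqMDS d : ℤ) ∧
          (t : ℝ) ≤ (C : ℝ) * ((n : ℝ) * Real.log (n : ℝ))) := by
  -- The constant is `100 · 4`, from `runs_mdsProg` and `clog_two_le_log`; as the exponent of the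
  -- word bound it is more than enough.
  refine ⟨fun n hn d hd hpos γ hγ => hasDom_iff hn hd hpos hγ, mdsProg, 400, ?_⟩
  intro n d hn hd hpos hG
  have hn2 := IsGraphic.two_le hG hn hpos
  obtain ⟨t, s, hrun, ht, hs⟩ := runs_mdsProg hn2 hd hpos hG (hundred_mul_sq_le_pow hn2)
  refine ⟨t, s, hrun, hs, ?_⟩
  have h1 : (t : ℝ) ≤ 100 * (n * Nat.clog 2 n) := by exact_mod_cast ht
  have h2 : (n : ℝ) * Nat.clog 2 n ≤ n * (4 * Real.log n) :=
    mul_le_mul_of_nonneg_left (clog_two_le_log hn2) (by positivity)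
  push_cast
  linarith
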